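/- **Definitions.** Let $\mathbf G$ be a reductive group over an algebraically closed field of characteristic $0$ and $\mathbf H\subset\mathbf G$ a reductive subgroup. Let $\mathbf S\subset\mathbf T$ be maximal tori of $\mathbf H\subset\mathbf G$, and put $\mathfrak s=X_*(\mathbf S)\otimes_{\mathbb Z}\mathbb R\subset\mathfrak t=X_*(\mathbf T)\otimes_{\mathbb Z}\mathbb R$. Let $W_{\mathbf G}$ be the Weyl group of the root system $\Phi(\mathbf G:\mathbf T)$, let $\rho_{\mathbf G}$ be the half sum of the positive roots for some choice of positivity, and for $X\in\mathfrak t$ put $\|X\|_{\mathbf G}=\max_{w\in W_{\mathbf G}}\langle\rho_{\mathbf G},w.X\rangle$; define $\|X\|_{\mathbf H}$ for $X\in\mathfrak s$ in the same way from $\Phi(\mathbf H:\mathbf S)$. The subgroup $\mathbf H$ is *tempered* in $\mathbf G$ if $\|X\|_{\mathbf H}\le\frac12\|X\|_{\mathbf G}$ for all $X\in\mathfrak s$. It is *small* in $\mathbf G$ if it is tempered and either (a) $\dim\mathbf S<\dim\mathbf T$, or (b) $\mathbf S=\mathbf T$ and there is $X\in\mathfrak t$ with $\|w.X\|_{\mathbf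 H}<\frac12\|X\|_{\mathbf G}$ for all $w\in W_{\mathbf G}$. A non-reductive subgroup is small if it is contained in a small reductive subgroup. Over a field $F$ of characteristic $0$, an $F$-subgroup $\mathbf H\subset\mathbf G$ is small if $\mathbf H_{\bar F}\subset\mathbf G_{\bar F}$ is. Let $\mathbf G=\mathrm{SO}(Q)$ with $Q=2x_0x_1+x_2^2+x_3^2+x_4^2$, regarded as a group over any field $F\supset\mathbb Q$, and let $G=\mathbf G(\mathbb R)\simeq\mathrm{SO}(1,4)$. Let $A=\{\mathrm{diag}(\lambda,\lambda^{-1},1,1,1):\lambda>0\}$, let $M=\{\mathrm{diag}(\varepsilon I_2,m):\varepsilon=\pm1,\ m\in\mathrm{SO}(3)\}$ be the compact factor of the centralizer of $A$ in $G$, and let $K=\mathrm{SO}(5)\cap G$. **Lemma 5.2.** 1. There is a $\mathbb Q$-subgroup $\mathbf H\subset\mathbf G$, small in $\mathbf G$, with $\mathbf H(\mathbb R)=AM$. 2. Let $K_1\subset K$ be any connected Lie subgroup isogenous to $\mathrm{SO}(3)\times\mathrm{SO}(2)$ (that is, with Lie algebra isomorphic to $\mathfrak{so}(3)\oplus\mathfrak{so}(2)$).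 Then there is an $\mathbb R$-subgroup $\mathbf H'\subset\mathbf G_{\mathbb R}$, small in $\mathbf G_{\mathbb R}$, with $\mathbf H'(\mathbb R)=K_1$. Moreover there are $g\in G$ and a $\mathbb Q$-subgroup $\mathbf H''\subset\mathbf G$, small in $\mathbf G$, with $\mathbf H''(\mathbb R)=gK_1g^{-1}$. -/

import Mathlib

open scoped TensorProduct Matrix MatrixGroups

set_option linter.unusedSectionVars false

noncomputable section

namespace SmallSubgroups

/-! ### Linear algebraic groups over an algebraically closed field

A linear algebraic group over an algebraically closed field `K` is a Zariski closed subgroup of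
`GL ι K`.  The field is algebraically closed wherever the notions below are used. -/

section OverField

variable {ι : Type} [Fintype ι] [DecidableEq ι] {K : Type} [Field K]

/-- The value of a polynomial in the matrix entries at an invertible matrix. -/
def evalAt (g : GL ι K) (p : MvPolynomial (ι × ι) K) : K :=
  MvPolynomial.eval (fun ij => (g : Matrix ι ι K) ij.1 ij.2) p

/-- `H` is Zariski closed in `GL ι K`. -/
def IsZariskiClosed (H : Subgroup (GL ι K)) : Prop :=
  ∃ I : Set (MvPolynomial (ι × ι) K), ∀ g : GL ι K, g ∈ H ↔ ∀ p ∈ I, evalAt g p = 0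

/-- The identity component `G°`: the smallest closed subgroup of finite index. -/
def identityComponent (G : Subgroup (GL ι K)) : Subgroup (GL ι K) :=
  sInf {U | U ≤ G ∧ IsZariskiClosed U ∧ U.relIndex G ≠ 0}

/-- Zariski connectedness of a closed subgroup. -/
def IsZariskiConnected (G : Subgroup (GL ι K)) : Prop := identityComponent G = G

/-- All elements of `U` are unipotent. -/
def IsUnipotent (U : Subgroup (GL ι K)) : Prop :=
  ∀ u ∈ U, IsNilpotent ((u : Matrix ι ι K) - 1)

/-- `G` is reductive: it is closed, and its unipotent radical is trivial
(a reductive group need not be connected). -/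
def IsReductive (G : Subgroup (GL ι K)) : Prop :=
  IsZariskiClosed G ∧
    ∀ U : Subgroup (GL ι K), U ≤ G → IsZariskiClosed U → IsZariskiConnected U →
      (∀ g ∈ G, ∀ u ∈ U, g * u * g⁻¹ ∈ U) → IsUnipotent U → U = ⊥

/-- The Lie algebra of a closed subgroup `G`: the tangent space at the identity, that is the
matrices `X` with `dp_1(X) = 0` for every polynomial `p` vanishing on `G`. -/
def lieAlg (G : Subgroup (GL ι K)) : Submodule K (Matrix ι ι K) where
  carrier := {X | ∀ p : MvPolynomial (ι × ι) K, (∀ g ∈ G, evalAt g p = 0) →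
    ∑ i, ∑ j, X i j * evalAt 1 (MvPolynomial.pderiv (i, j) p) = 0}
  zero_mem' := by intro p _; simp
  add_mem' := by
    intro X Y hX hY p hp
    simp only [Matrix.add_apply, add_mul, Finset.sum_add_distrib]
    rw [hX p hp, hY p hp, add_zero]
  smul_mem' := by
    intro c X hX p hp
    simp only [Matrix.smul_apply, smul_eq_mul, mul_assoc, ← Finset.mul_sum]
    rw [hX p hp, mul_zero]

variable (ι K) in
/-- An algebraic torus in `GL ι K`: a closed connected subgroup that can be simultaneously
diagonalized. -/
structure AlgTorus where
  carrier : Subgroup (GL ι K)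
  closed : IsZariskiClosed carrier
  connected : IsZariskiConnected carrier
  diagonalizable : ∃ g : GL ι K, ∀ t ∈ carrier, ((g * t * g⁻¹ : GL ι K) : Matrix ι ι K).IsDiag

/-- `T` is a maximal torus of `G`. -/
def IsMaximalTorus (T : AlgTorus ι K) (G : Subgroup (GL ι K)) : Prop :=
  T.carrier ≤ G ∧
    ∀ T' : AlgTorus ι K, T'.carrier ≤ G → T.carrier ≤ T'.carrier → T'.carrier = T.carrier

theorem AlgTorus.comm (T : AlgTorus ι K) (a b : T.carrier) : a * b = b * a := by
  obtain ⟨g, hg⟩ := T.diagonalizable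
  have h : (g * a * g⁻¹) * (g * b * g⁻¹) = (g * b * g⁻¹) * (g * (a : GL ι K) * g⁻¹) := by
    apply Units.ext
    have ha := (Matrix.isDiag_iff_diagonal_diag _).1 (hg a a.2)
    have hb := (Matrix.isDiag_iff_diagonal_diag _).1 (hg b b.2)
    rw [Units.val_mul (g * (a : GL ι K) * g⁻¹), Units.val_mul (g * (b : GL ι K) * g⁻¹),
      ← ha, ← hb, Matrix.diagonal_mul_diagonal, Matrix.diagonal_mul_diagonal]
    simp only [mul_comm]
  apply Subtype.ext
  have h2 : g * ((a : GL ι K) * b) * g⁻¹ = g * ((b : GL ι K) * a) * g⁻¹ := by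
    simpa [mul_assoc] using h
  simpa using h2

instance (T : AlgTorus ι K) : CommGroup T.carrier :=
  { (inferInstance : Group T.carrier) with mul_comm := T.comm }

variable (K) in
/-- The regular functions on the multiplicative group, i.e. the Laurent polynomials in `z`. -/
def regularGm : Subalgebra K (Kˣ → K) :=
  Algebra.adjoin K {(fun z => (z : K) : Kˣ → K), (fun z => ((z⁻¹ : Kˣ) : K) : Kˣ → K)}

theorem regularGm_inv {f : Kˣ → K} (hf : f ∈ regularGm K) :
    (fun z => f z⁻¹) ∈ regularGm K := by
  refine Algebra.adjoin_induction (p := fun f _ => (fun z => f z⁻¹) ∈ regularGm K)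
    ?_ ?_ ?_ ?_ hf
  · rintro x (rfl | rfl)
    · exact Algebra.subset_adjoin (by simp)
    · exact Algebra.subset_adjoin (by simp)
  · intro r
    exact (regularGm K).algebraMap_mem r
  · intro x y _ _ hx hy
    exact (regularGm K).add_mem hx hy
  · intro x y _ _ hx hy
    exact (regularGm K).mul_mem hx hy

/-- A map from the multiplicative group to matrices is regular if all entries are. -/
def IsRegularMap (f : Kˣ → Matrix ι ι K) : Prop := ∀ i j, (fun z => f z i j) ∈ regularGm K

theorem IsRegularMap.mul {f g : Kˣ → Matrix ι ι K} (hf : IsRegularMap f) (hg : IsRegularMap g) :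
    IsRegularMap (fun z => f z * g z) := by
  intro i j
  have : (fun z => (f z * g z) i j) = ∑ k, (fun z => f z i k) * (fun z => g z k j) := by
    funext z
    simp [Matrix.mul_apply, Finset.sum_apply]
  rw [this]
  exact (regularGm K).sum_mem fun k _ => (regularGm K).mul_mem (hf i k) (hg k j)

theorem IsRegularMap.const (A : Matrix ι ι K) : IsRegularMap (fun _ : Kˣ => A) :=
  fun i j => (regularGm K).algebraMap_mem (A i j)

/-- The group of cocharacters of `T`: algebraic homomorphisms from the multiplicative group. -/
def cocharSubgroup (T : AlgTorus ι K) : Subgroup (Kˣ →* T.carrier) where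
  carrier := {f | IsRegularMap (fun z => ((f z : GL ι K) : Matrix ι ι K))}
  one_mem' := IsRegularMap.const 1
  mul_mem' := fun {a b} ha hb => IsRegularMap.mul ha hb
  inv_mem' := by
    intro f hf i j
    have h := regularGm_inv (hf i j)
    have e : ∀ z, f⁻¹ z = f z⁻¹ := fun z => (map_inv f z).symm
    simpa only [e] using h

/-- The cocharacter lattice `X_*(T)`, written additively. -/
abbrev Cochar (T : AlgTorus ι K) : Type := Additive (cocharSubgroup T)

/-- The value of a cocharacter at a scalar. -/
def Cochar.eval {T : AlgTorus ι K} (l : Cochar T) (z : Kˣ) : T.carrier := l.toMul.1 z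

/-- The real vector space `𝔱 = X_*(T) ⊗ ℝ`. -/
abbrev RealCochar (T : AlgTorus ι K) : Type := ℝ ⊗[ℤ] Cochar T

/-- The map `X_*(S) → X_*(T)`, `l ↦ g l g⁻¹`, for an element `g` with `g S g⁻¹ ⊆ T`. -/
def cocharConj {S T : AlgTorus ι K} (g : GL ι K)
    (h : ∀ s ∈ S.carrier, g * s * g⁻¹ ∈ T.carrier) : Cochar S →+ Cochar T :=
  MonoidHom.toAdditive
    { toFun := fun f =>
        ⟨{ toFun := fun z => ⟨g * (f.1 z : GL ι K) * g⁻¹, h _ (f.1 z).2⟩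
           map_one' := by apply Subtype.ext; simp
           map_mul' := by intro x y; apply Subtype.ext; simp [mul_assoc] },
          ((IsRegularMap.const (g : Matrix ι ι K)).mul f.2).mul
            (IsRegularMap.const ((g⁻¹ : GL ι K) : Matrix ι ι K))⟩
      map_one' := by
        apply Subtype.ext; apply MonoidHom.ext; intro z; apply Subtype.ext
        change g * 1 * g⁻¹ = 1
        simp
      map_mul' := by
        intro a b
        apply Subtype.ext; apply MonoidHom.ext; intro z; apply Subtype.ext
        change g * ((a.1 z : GL ι K) * (b.1 z : GL ι K)) * g⁻¹ =
          (g * (a.1 z : GL ι K) * g⁻¹) * (g * (b.1 z : GL ι K) * g⁻¹)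
        simp [mul_assoc] }

/-- The induced real linear map `X_*(S) ⊗ ℝ → X_*(T) ⊗ ℝ`. -/
def realConj {S T : AlgTorus ι K} (g : GL ι K)
    (h : ∀ s ∈ S.carrier, g * s * g⁻¹ ∈ T.carrier) : RealCochar S →ₗ[ℝ] RealCochar T :=
  (cocharConj g h).toIntLinearMap.baseChange ℝ

/-- The inclusion `𝔰 → 𝔱` induced by an inclusion of tori `S ≤ T`. -/
def realIncl {S T : AlgTorus ι K} (h : S.carrier ≤ T.carrier) :
    RealCochar S →ₗ[ℝ] RealCochar T :=
  realConj 1 (fun s hs => by simpa using h hs)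

/-- The linear functional `α` on `𝔱 = X_*(T) ⊗ ℝ` is the one given by the character `χ` of `T`
through the pairing `χ (l z) = z ^ ⟨χ, l⟩` with cocharacters `l`. -/
def IsCharFunctional {T : AlgTorus ι K} (χ : T.carrier →* Kˣ)
    (α : Module.Dual ℝ (RealCochar T)) : Prop :=
  ∀ l : Cochar T, ∃ m : ℤ, (∀ z : Kˣ, χ (l.eval z) = z ^ m) ∧ α (1 ⊗ₜ[ℤ] l) = m

/-- The roots `Φ(G : T)`, as elements of `𝔱* = X^*(T) ⊗ ℝ`: the nonzero weights of `T` acting on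
the Lie algebra of `G` by conjugation (a character with a weight vector is automatically
algebraic). -/
def roots (G : Subgroup (GL ι K)) (T : AlgTorus ι K) : Set (Module.Dual ℝ (RealCochar T)) :=
  {α | α ≠ 0 ∧ ∃ χ : T.carrier →* Kˣ, IsCharFunctional χ α ∧
    ∃ X ∈ lieAlg G, X ≠ 0 ∧ ∀ t : T.carrier,
      ((t : GL ι K) : Matrix ι ι K) * X * (((t : GL ι K)⁻¹ : GL ι K) : Matrix ι ι K)
        = (χ t : K) • X}

/-- `X₀ ∈ 𝔱` lies on no root hyperplane, so that it defines a notion of positivity. -/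
def IsRegularElt (G : Subgroup (GL ι K)) (T : AlgTorus ι K) (X₀ : RealCochar T) : Prop :=
  ∀ α ∈ roots G T, α X₀ ≠ 0

/-- The positive roots, for the notion of positivity given by `X₀`. -/
def posRoots (G : Subgroup (GL ι K)) (T : AlgTorus ι K) (X₀ : RealCochar T) :
    Set (Module.Dual ℝ (RealCochar T)) := {α ∈ roots G T | 0 < α X₀}

/-- The half sum `ρ` of the positive roots (a finite sum). -/
def rho (G : Subgroup (GL ι K)) (T : AlgTorus ι K) (X₀ : RealCochar T) :
    Module.Dual ℝ (RealCochar T) := (1 / 2 : ℝ) • ∑ᶠ α ∈ posRoots G T X₀, α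

/-- The Weyl group of `Φ(G : T)`, as a (finite) set of linear maps of `𝔱`: the action of the
normalizer of `T` in the identity component of `G`. -/
def weylGroup (G : Subgroup (GL ι K)) (T : AlgTorus ι K) :
    Set (RealCochar T →ₗ[ℝ] RealCochar T) :=
  {w | ∃ n ∈ identityComponent G, ∃ h : ∀ t, t ∈ T.carrier ↔ n * t * n⁻¹ ∈ T.carrier,
    w = realConj n (fun t ht => (h t).1 ht)}

/-- `‖X‖_G = max_{w ∈ W} ⟨ρ, w X⟩` (the maximum of a finite set). -/
def rhoNorm (G : Subgroup (GL ι K)) (T : AlgTorus ι K) (X₀ X : RealCochar T) : ℝ :=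
  ⨆ w : weylGroup G T, rho G T X₀ (w.1 X)

/-- The reductive subgroup `H` is tempered in the reductive group `G`: `‖X‖_H ≤ ½ ‖X‖_G` on `𝔰`,
for maximal tori `S ≤ T` of `H ≤ G` and notions of positivity `Y₀`, `X₀`.  (The condition does
not depend on these choices.) -/
def IsTemperedRed (G H : Subgroup (GL ι K)) : Prop :=
  IsReductive G ∧ IsReductive H ∧ H ≤ G ∧
    ∃ (S T : AlgTorus ι K) (hST : S.carrier ≤ T.carrier) (Y₀ : RealCochar S) (X₀ : RealCochar T),
      IsMaximalTorus S H ∧ IsMaximalTorus T G ∧ IsRegularElt H S Y₀ ∧ IsRegularElt G T X₀ ∧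
      ∀ X : RealCochar S, rhoNorm H S Y₀ X ≤ 1 / 2 * rhoNorm G T X₀ (realIncl hST X)

/-- The reductive subgroup `H` is small in the reductive group `G`: it is tempered, and either
`dim S < dim T`, or `S = T` and there is `X ∈ 𝔱` with `‖w X‖_H < ½ ‖X‖_G` for all `w ∈ W_G`.
(Again independent of the choices; `dim S` is the dimension of `X_*(S) ⊗ ℝ`.) -/
def IsSmallRed (G H : Subgroup (GL ι K)) : Prop :=
  IsTemperedRed G H ∧
    ((∃ S T : AlgTorus ι K, S.carrier ≤ T.carrier ∧ IsMaximalTorus S H ∧ IsMaximalTorus T G ∧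
        Module.finrank ℝ (RealCochar S) < Module.finrank ℝ (RealCochar T)) ∨
     (∃ (T : AlgTorus ι K) (Y₀ X₀ : RealCochar T),
        IsMaximalTorus T H ∧ IsMaximalTorus T G ∧ IsRegularElt H T Y₀ ∧ IsRegularElt G T X₀ ∧
        ∃ X : RealCochar T, ∀ w ∈ weylGroup G T,
          rhoNorm H T Y₀ (w X) < 1 / 2 * rhoNorm G T X₀ X))

/-- The closed subgroup `H` is small in the reductive group `G`: for reductive `H` this is
`IsSmallRed`; a non-reductive `H` is small if it is contained in a small reductive subgroup. -/
def IsSmall (G H : Subgroup (GL ι K)) : Prop :=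
  IsZariskiClosed H ∧
    ((IsReductive H ∧ IsSmallRed G H) ∨ (¬ IsReductive H ∧ ∃ L, H ≤ L ∧ IsSmallRed G L))

end OverField

/-! ### Groups over a field of characteristic zero -/

/-- A linear algebraic group over `F`: a closed subgroup scheme of `GL ι`, given by its functor of
points on commutative `F`-algebras, which is cut out by polynomial equations over `F`. -/
structure AlgGroup (ι : Type) [Fintype ι] [DecidableEq ι] (F : Type) [Field F] where
  points : ∀ (R : Type) [CommRing R] [Algebra F R], Subgroup (GL ι R)
  exists_equations : ∃ I : Set (MvPolynomial (ι × ι) F),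
    ∀ (R : Type) [CommRing R] [Algebra F R] (g : GL ι R),
      g ∈ points R ↔
        ∀ p ∈ I, MvPolynomial.aeval (fun ij : ι × ι => (g : Matrix ι ι R) ij.1 ij.2) p = 0

/-- Over a field `F` of characteristic zero, the `F`-subgroup `H` of the `F`-group `G` is small if
it is so after base change to the algebraic closure of `F`. -/
def IsSmallOver {ι : Type} [Fintype ι] [DecidableEq ι] {F : Type} [Field F] [CharZero F]
    (G H : AlgGroup ι F) : Prop :=
  (∀ (R : Type) [CommRing R] [Algebra F R], H.points R ≤ G.points R) ∧
    IsSmall (G.points (AlgebraicClosure F)) (H.points (AlgebraicClosure F))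

/-! ### The group `SO(1,4)` and its subgroups

Matrices of size five are written in blocks of sizes two and three. -/

/-- The index set of the coordinates `x₀, x₁ | x₂, x₃, x₄`. -/
abbrev Idx : Type := Fin 2 ⊕ Fin 3

/-- The Gram matrix of the quadratic form `2 x₀ x₁ + x₂² + x₃² + x₄²`. -/
def gram (R : Type) [CommRing R] : Matrix Idx Idx R := Matrix.fromBlocks !![0, 1; 1, 0] 0 0 1

/-- `SO(Q)(R)`: the matrices `g` of determinant one with `g B gᵀ = B`, where `B` is the Gram matrix
of `Q`. -/
def soPoints (R : Type) [CommRing R] : Subgroup (GL Idx R) where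
  carrier := {g | (g : Matrix Idx Idx R) * gram R * (g : Matrix Idx Idx R)ᵀ = gram R ∧
    (g : Matrix Idx Idx R).det = 1}
  one_mem' := by simp
  mul_mem' := by
    rintro a b ⟨ha, ha'⟩ ⟨hb, hb'⟩
    refine ⟨?_, by simp [ha', hb']⟩
    calc _ = (a : Matrix Idx Idx R) * ((b : Matrix Idx Idx R) * gram R *
          (b : Matrix Idx Idx R)ᵀ) * (a : Matrix Idx Idx R)ᵀ := by
            simp [Matrix.transpose_mul, Matrix.mul_assoc]
      _ = gram R := by rw [hb, ha]
  inv_mem' := by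
    rintro a ⟨ha, ha'⟩
    have h1 : ((a⁻¹ : GL Idx R) : Matrix Idx Idx R) * (a : Matrix Idx Idx R) = 1 := by
      rw [← Units.val_mul]; simp
    have h2 : (a : Matrix Idx Idx R)ᵀ * ((a⁻¹ : GL Idx R) : Matrix Idx Idx R)ᵀ = 1 := by
      rw [← Matrix.transpose_mul, h1, Matrix.transpose_one]
    constructor
    · calc _ = ((a⁻¹ : GL Idx R) : Matrix Idx Idx R) *
            ((a : Matrix Idx Idx R) * gram R * (a : Matrix Idx Idx R)ᵀ) *
            ((a⁻¹ : GL Idx R) : Matrix Idx Idx R)ᵀ := by rw [ha]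
        _ = (((a⁻¹ : GL Idx R) : Matrix Idx Idx R) * (a : Matrix Idx Idx R)) * gram R *
            ((a : Matrix Idx Idx R)ᵀ * ((a⁻¹ : GL Idx R) : Matrix Idx Idx R)ᵀ) := by
              simp only [Matrix.mul_assoc]
        _ = gram R := by rw [h1, h2, one_mul, mul_one]
    · have := congrArg Matrix.det h1
      rwa [Matrix.det_mul, ha', mul_one, Matrix.det_one] at this

/-- The group `SO(Q)` over a field `F`. -/
def soGroup (F : Type) [Field F] : AlgGroup Idx F where
  points R _ _ := soPoints R
  exists_equations := by
    let X := Matrix.mvPolynomialX Idx Idx F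
    refine ⟨{p | ∃ i j, p = (X * gram (MvPolynomial (Idx × Idx) F) * Xᵀ - gram (MvPolynomial (Idx × Idx) F)) i j} ∪
      {X.det - 1}, ?_⟩
    intro R _ _ g
    set φ := MvPolynomial.aeval (R := F) (fun ij : Idx × Idx => (g : Matrix Idx Idx R) ij.1 ij.2)
      with hφ
    have hX : X.map φ = (g : Matrix Idx Idx R) := by
      ext i j; simp [X, hφ]
    have hB : (gram (MvPolynomial (Idx × Idx) F)).map φ = gram R := by
      ext i j
      rcases i with i | i <;> rcases j with j | j
      · fin_cases i <;> fin_cases j <;> simp [gram]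
      · simp [gram]
      · simp [gram]
      · simp [gram, Matrix.one_apply, apply_ite φ]
    have h1 : ∀ i j, φ ((X * gram (MvPolynomial (Idx × Idx) F) * Xᵀ - gram (MvPolynomial (Idx × Idx) F)) i j) =
        ((g : Matrix Idx Idx R) * gram R * (g : Matrix Idx Idx R)ᵀ - gram R) i j := by
      intro i j
      rw [← hX, ← hB]
      simp [Matrix.mul_apply, Matrix.sub_apply]
    have h2 : φ (X.det - 1) = (g : Matrix Idx Idx R).det - 1 := by
      rw [← hX, map_sub, map_one, AlgHom.map_det]; rfl
    constructor
    · rintro ⟨ha, hb⟩ p (⟨i, j, rfl⟩ | rfl)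
      · rw [h1, ha, sub_self, Matrix.zero_apply]
      · rw [h2, hb, sub_self]
    · intro h
      refine ⟨?_, ?_⟩
      · rw [← sub_eq_zero]
        ext i j
        rw [← h1]
        exact h _ (Or.inl ⟨i, j, rfl⟩)
      · rw [← sub_eq_zero, ← h2]
        exact h _ (Or.inr rfl)

/-- The real Lie group `G = SO(Q)(ℝ)`, of signature `(1,4)`. -/
abbrev G : Subgroup (GL Idx ℝ) := soPoints ℝ

/-- `A`: the elements `diag(a, a⁻¹, 1, 1, 1)` with `a > 0`. -/
def A : Subgroup (GL Idx ℝ) where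
  carrier := {g | ∃ a : ℝ, 0 < a ∧
    (g : Matrix Idx Idx ℝ) = Matrix.fromBlocks (Matrix.diagonal ![a, a⁻¹]) 0 0 1}
  one_mem' := ⟨1, one_pos, by
    have : (![1, 1] : Fin 2 → ℝ) = 1 := by ext i; fin_cases i <;> rfl
    simp [this]⟩
  mul_mem' := by
    rintro g h ⟨a, ha, hg⟩ ⟨b, hb, hh⟩
    refine ⟨a * b, mul_pos ha hb, ?_⟩
    rw [Units.val_mul, hg, hh, Matrix.fromBlocks_multiply]
    congr 1
    · ext i j; fin_cases i <;> fin_cases j <;> simp [mul_comm]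
    all_goals simp
  inv_mem' := by
    rintro g ⟨a, ha, hg⟩
    refine ⟨a⁻¹, inv_pos.2 ha, ?_⟩
    have h : (g : Matrix Idx Idx ℝ) *
        Matrix.fromBlocks (Matrix.diagonal ![a⁻¹, a⁻¹⁻¹]) 0 0 1 = 1 := by
      rw [hg, Matrix.fromBlocks_multiply, ← Matrix.fromBlocks_one]
      congr 1
      · ext i j; fin_cases i <;> fin_cases j <;> simp [ha.ne']
      all_goals simp
    rw [Matrix.coe_units_inv, Matrix.inv_eq_right_inv h]

/-- `M ≅ {±1} × SO(3)`: the elements `diag(ε, ε, m)` with `ε = ±1` and `m ∈ SO(3)`; it is the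
compact factor of the centralizer of `A` in `G`. -/
def M : Subgroup (GL Idx ℝ) where
  carrier := {g | ∃ (ε : ℝ) (m : Matrix (Fin 3) (Fin 3) ℝ), (ε = 1 ∨ ε = -1) ∧
    m ∈ Matrix.specialOrthogonalGroup (Fin 3) ℝ ∧
    (g : Matrix Idx Idx ℝ) = Matrix.fromBlocks (ε • 1) 0 0 m}
  one_mem' := ⟨1, 1, Or.inl rfl, one_mem _, by simp⟩
  mul_mem' := by
    rintro g h ⟨a, m, ha, hm, hg⟩ ⟨b, n, hb, hn, hh⟩
    refine ⟨a * b, m * n, ?_, mul_mem hm hn, ?_⟩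
    · rcases ha with rfl | rfl <;> rcases hb with rfl | rfl <;> simp
    · rw [Units.val_mul, hg, hh, Matrix.fromBlocks_multiply]
      simp [smul_smul, mul_comm]
  inv_mem' := by
    rintro g ⟨a, m, ha, hm, hg⟩
    have hs : star m ∈ Matrix.specialOrthogonalGroup (Fin 3) ℝ :=
      (star (⟨m, hm⟩ : Matrix.specialOrthogonalGroup (Fin 3) ℝ)).2
    refine ⟨a, star m, ha, hs, ?_⟩
    have h : (g : Matrix Idx Idx ℝ) * Matrix.fromBlocks (a • 1) 0 0 (star m) = 1 := by
      have e : m * star m = 1 :=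
        (Matrix.mem_orthogonalGroup_iff _ _).1 (Matrix.mem_specialOrthogonalGroup_iff.1 hm).1
      rw [hg, Matrix.fromBlocks_multiply, ← Matrix.fromBlocks_one]
      rcases ha with rfl | rfl <;> simp [e]
    rw [Matrix.coe_units_inv, Matrix.inv_eq_right_inv h]

/-- The group `AM` (`A` and `M` commute, so the product set is the join). -/
def AM : Subgroup (GL Idx ℝ) := A ⊔ M

/-- The maximal compact subgroup `K = SO(5) ∩ G`. -/
def K : Subgroup (GL Idx ℝ) where
  carrier := {g | g ∈ G ∧ (g : Matrix Idx Idx ℝ) ∈ Matrix.specialOrthogonalGroup Idx ℝ}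
  one_mem' := ⟨one_mem _, one_mem _⟩
  mul_mem' := fun ha hb => ⟨mul_mem ha.1 hb.1, mul_mem ha.2 hb.2⟩
  inv_mem' := by
    rintro g ⟨hg, ho⟩
    refine ⟨inv_mem hg, ?_⟩
    have e : (g : Matrix Idx Idx ℝ) * star (g : Matrix Idx Idx ℝ) = 1 :=
      (Matrix.mem_orthogonalGroup_iff _ _).1 (Matrix.mem_specialOrthogonalGroup_iff.1 ho).1
    rw [Matrix.coe_units_inv, Matrix.inv_eq_right_inv e]
    exact (star (⟨_, ho⟩ : Matrix.specialOrthogonalGroup Idx ℝ)).2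

attribute [local instance] LieRing.ofAssociativeRing

/-- The connected Lie subgroup with Lie algebra `L`: the group generated by `exp L`. -/
def connectedLieSubgroup (L : LieSubalgebra ℝ (Matrix Idx Idx ℝ)) : Subgroup (GL Idx ℝ) :=
  Subgroup.closure {g | ∃ X ∈ L, (g : Matrix Idx Idx ℝ) = NormedSpace.exp X}

/-- `K₁` is a connected Lie subgroup isogenous to `SO(3) × SO(2)`, that is, its Lie algebra is
isomorphic to `𝔰𝔬(3) × 𝔰𝔬(2)`. -/
def IsConnectedIsogenousSO3SO2 (K₁ : Subgroup (GL Idx ℝ)) : Prop :=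
  ∃ L : LieSubalgebra ℝ (Matrix Idx Idx ℝ), K₁ = connectedLieSubgroup L ∧
    Nonempty (L ≃ₗ⁅ℝ⁆
      (LieAlgebra.Orthogonal.so (Fin 3) ℝ × LieAlgebra.Orthogonal.so (Fin 2) ℝ))

end SmallSubgroups

end

/-!
All subgroups in the statement are centralizers in `SO(Q)` of single elements `C` of its Lie algebra
(`centGroup C`). The matrix `boost = diag(1, -1, 0, 0, 0)` gives `AM`. A rational matrix `J`
(`complexStr`), a complex structure on the orthogonal complement of a negative vector with rational
coordinates, gives the group `H''`, and its real conjugates give the groups `H'`.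

*Smallness.* Over an algebraically closed field there is a matrix `P` that brings `Q` to the split
form `2 y₀ y₁ + 2 y₂ y₃ + y₄²` and `C` to a diagonal matrix. The centralizer `H` of `C` is then a
Levi subgroup `GL₁ × SO₃` or `GL₂`; it shares with `SO(Q)` the maximal torus diagonalized by `P`
(`splitTorus`), whose weights are `e₁, -e₁, e₂, -e₂, 0`. The group `H` has a single positive root
`β`, namely `e₂` or `e₁ - e₂`, so that `β ≤ |e₁| + |e₂|`. An element normalizing the torus permutes
its weights (`exists_perm_weight`), so the Weyl group of `H` preserves `|e₁| + |e₂|`, and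
`‖X‖_H ≤ (|e₁| + |e₂|) / 2`. On the other side, the half sum of the positive roots of `SO(Q)` is
`(3 e₁ + e₂) / 2`, and its Weyl group contains the sign changes and the exchange of `e₁` and `e₂`
(`exists_weyl_neg`, `exists_weyl_swap`), obtained from explicit products of root group elements; so
`‖X‖_G` is at least `(3 max + min) / 2` in terms of `|e₁|` and `|e₂|` (`le_rhoNorm_soPoints`), hence
at least `|e₁| + |e₂|`. Therefore `H` is tempered. The inequality is strict at `(e₁, e₂) = (1, 0)`,
for all Weyl translates, which is what smallness requires of a subgroup of full rank
(`isSmall_centPoints`).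

*Reductivity.* Let `u` lie in a normal unipotent subgroup of the centralizer of `C`. Then
`tr (h (u - 1)) = 0` for all `h` in the centralizer (`IsUnipotent.trace_mul_sub_one_eq_zero`,
which takes the place of Kolchin's theorem). Averaging against the characters of the torus separates the terms of
this trace (`entry_mul_entry_eq_zero`), and the exponentials of the root vectors then show that
every entry of `u - 1` vanishes (`isReductive_centPoints`).

*Subgroups of `K`.* The Lie algebra of `K` is `𝔰𝔬(4)`, acting on the positive definite part of `Q`,
identified with the quaternions; it is the sum of the left multiplications `L(a)` and the right
multiplications `R(b)` by imaginary quaternions (`exists_emb_of_skew`). A subalgebra isomorphic to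
`𝔰𝔬(3) ⊕ 𝔰𝔬(2)` has dimension four and a nonzero central element `Z = L(a) + R(b)`. If neither `a`
nor `b` vanished, the centralizer of `Z` would have dimension two; so `Z` is `L(a)` or `R(b)`, the
subalgebra is the whole centralizer of `Z`, and `Z` is conjugate under `K` to a multiple of the
complex structure `stdComplexStr = L(i)` (`eq_skewCent_of_central`). The centralizer of
`stdComplexStr` in `G` is the unitary group `U(2)`, generated by the exponentials of its Lie algebra
(`closure_exp_skewCent`), so it is the conjugate of the given connected subgroup. Finally the
element `diag(√2, 1/√2, 1, 1, 1)` of `A` conjugates `stdComplexStr` to the rational matrix `J`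
(`boost_mul_stdComplexStr`).
-/

noncomputable section
namespace SmallSubgroups

/-! ### Unipotent groups and traces -/

section TraceIdeal

variable {ι : Type} [Fintype ι] [DecidableEq ι] {K : Type} [Field K]

/-- In characteristic zero, a matrix all of whose positive powers have trace zero is nilpotent. -/
theorem isNilpotent_of_forall_trace_pow [CharZero K] (x : Matrix ι ι K)
    (h : ∀ k, (x ^ (k + 1)).trace = 0) : IsNilpotent x := by
  have htr : ∀ q : Polynomial K, (Polynomial.aeval x (q * Polynomial.X)).trace = 0 := by
    intro q
    induction q using Polynomial.induction_on' with
    | add p q hp hq => rw [add_mul, map_add, Matrix.trace_add, hp, hq, add_zero]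
    | monomial n a =>
      rw [map_mul, Polynomial.aeval_monomial, Polynomial.aeval_X, mul_assoc, ← pow_succ,
        ← Algebra.smul_def, Matrix.trace_smul, h, smul_zero]
  obtain ⟨q, hq, hdvd⟩ := Polynomial.exists_eq_pow_rootMultiplicity_mul_and_not_dvd
    x.charpoly x.charpoly_monic.ne_zero 0
  rw [Polynomial.C_0, sub_zero] at hq hdvd
  set a := Polynomial.rootMultiplicity 0 x.charpoly
  have hcop : IsCoprime (Polynomial.X ^ (a + 1) : Polynomial K) q :=
    ((Polynomial.irreducible_X.coprime_iff_not_dvd).2 hdvd).pow_left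
  obtain ⟨u, v, huv⟩ := hcop
  have hz : Polynomial.aeval x (Polynomial.X ^ a * q) = 0 := by
    rw [← hq]; exact Matrix.aeval_self_charpoly x
  -- `e` is the idempotent, polynomial in `x`, that projects to the subspace on which `x` is
  -- invertible; its rank is its trace, which vanishes as `X` divides the polynomial
  set e := Polynomial.aeval x (u * Polynomial.X ^ (a + 1)) with he
  have hev : e + Polynomial.aeval x (v * q) = 1 := by
    rw [he, ← map_add, huv, map_one]
  have hidem : e * e = e := by
    have h0 : e * Polynomial.aeval x (v * q) = 0 := by
      rw [he, ← map_mul, show u * Polynomial.X ^ (a + 1) * (v * q) =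
        (u * v * Polynomial.X) * (Polynomial.X ^ a * q) by ring, map_mul, hz, mul_zero]
    calc e * e = e * (e + Polynomial.aeval x (v * q)) := by rw [mul_add, h0, add_zero]
      _ = e := by rw [hev, mul_one]
  have he0 : e = 0 := by
    have ht : e.trace = 0 := by
      rw [he, pow_succ, ← mul_assoc]
      exact htr _
    have hid : IsIdempotentElem (Matrix.toLin' e) := by
      unfold IsIdempotentElem
      rw [Module.End.mul_eq_comp, ← Matrix.toLin'_mul, hidem]
    have := LinearMap.IsIdempotentElem.eq_zero_of_trace_eq_zero hid
      (by rw [Matrix.trace_toLin'_eq]; exact ht)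
    simpa using this
  refine ⟨a, ?_⟩
  rw [he0, zero_add] at hev
  calc x ^ a = x ^ a * Polynomial.aeval x (v * q) := by rw [hev, mul_one]
    _ = Polynomial.aeval x (v * (Polynomial.X ^ a * q)) := by
      rw [show v * (Polynomial.X ^ a * q) = Polynomial.X ^ a * (v * q) by ring,
        map_mul _ (Polynomial.X ^ a), map_pow, Polynomial.aeval_X]
    _ = 0 := by rw [map_mul, hz, mul_zero]

theorem trace_eq_card_of_isUnipotent {u : GL ι K}
    (h : IsNilpotent ((u : Matrix ι ι K) - 1)) :
    (u : Matrix ι ι K).trace = Fintype.card ι := by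
  have := (Matrix.isNilpotent_trace_of_isNilpotent h).eq_zero
  rwa [Matrix.trace_sub, Matrix.trace_one, sub_eq_zero] at this

/-- All products of `n` matrices of the form `u - 1`, with `u` in a unipotent group `U`, vanish for
some `n`.  This replaces Kolchin's theorem.  In the algebra `A` spanned by `U` one has
`tr (a (u - 1)) = 0` for all `a`, so every element of the left ideal generated by `u - 1` is
nilpotent; hence `u - 1` lies in the Jacobson radical of `A`, a nilpotent ideal. -/
theorem IsUnipotent.exists_prod_sub_one_eq_zero [CharZero K] {U : Subgroup (GL ι K)}
    (hU : IsUnipotent U) :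
    ∃ n : ℕ, ∀ u : ℕ → GL ι K, (∀ k, u k ∈ U) →
      ((List.range n).map fun k => (u k : Matrix ι ι K) - 1).prod = 0 := by
  let S : Set (Matrix ι ι K) := {x | ∃ u ∈ U, x = ((u : GL ι K) : Matrix ι ι K)}
  let A : Subalgebra K (Matrix ι ι K) := Algebra.adjoin K S
  have hspan : ∀ a ∈ A, a ∈ Submodule.span K S := by
    intro a ha
    have h1 : (Submonoid.closure S : Set (Matrix ι ι K)) = S := by
      apply le_antisymm _ Submonoid.subset_closure
      intro x hx
      refine Submonoid.closure_induction (motive := fun x _ => x ∈ S) (fun _ h => h)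
        ⟨1, U.one_mem, rfl⟩ ?_ hx
      rintro x y _ _ ⟨u, hu, rfl⟩ ⟨v, hv, rfl⟩
      exact ⟨u * v, U.mul_mem hu hv, rfl⟩
    have h2 := Algebra.adjoin_eq_span K S
    rw [h1] at h2
    rw [← h2]
    exact ha
  have hmem : ∀ u ∈ U, ((u : GL ι K) : Matrix ι ι K) ∈ A := fun u hu =>
    Algebra.subset_adjoin ⟨u, hu, rfl⟩
  have htr : ∀ u ∈ U, ∀ a ∈ A, (a * (((u : GL ι K) : Matrix ι ι K) - 1)).trace = 0 := by
    intro u hu a ha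
    refine Submodule.span_induction
      (p := fun a _ => (a * (((u : GL ι K) : Matrix ι ι K) - 1)).trace = 0) ?_ ?_ ?_ ?_ (hspan a ha)
    · rintro _ ⟨v, hv, rfl⟩
      rw [mul_sub, mul_one, Matrix.trace_sub, ← Units.val_mul,
        trace_eq_card_of_isUnipotent (hU _ (U.mul_mem hv hu)),
        trace_eq_card_of_isUnipotent (hU _ hv), sub_self]
    · simp
    · intro x y _ _ hx hy
      rw [add_mul, Matrix.trace_add, hx, hy, add_zero]
    · intro c x _ hx
      rw [smul_mul_assoc, Matrix.trace_smul, hx, smul_zero]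
  have : IsArtinianRing A := IsArtinianRing.of_finite K A
  obtain ⟨n, hn⟩ := IsArtinianRing.isNilpotent_jacobson_bot (R := A)
  have hjac : ∀ (u : GL ι K) (hu : u ∈ U), (⟨(u : Matrix ι ι K) - 1,
      A.sub_mem (hmem u hu) A.one_mem⟩ : A) ∈
      Ideal.jacobson (⊥ : Ideal A) := by
    intro u hu
    rw [Ideal.mem_jacobson_iff]
    intro y
    set x : A := ⟨(u : Matrix ι ι K) - 1, A.sub_mem (hmem u hu) A.one_mem⟩ with hx
    have hnil : IsNilpotent (y * x) := by
      have : IsNilpotent ((y * x : A) : Matrix ι ι K) := by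
        apply isNilpotent_of_forall_trace_pow
        intro k
        have e : ((y * x : A) : Matrix ι ι K) ^ (k + 1) =
            (((y * x) ^ k * y : A) : Matrix ι ι K) * ((u : Matrix ι ι K) - 1) := by
          rw [pow_succ]
          simp [hx, mul_assoc]
        rw [e]
        exact htr u hu _ (Subtype.property _)
      obtain ⟨m, hm⟩ := this
      exact ⟨m, by apply Subtype.ext; simpa using hm⟩
    obtain ⟨w, hw⟩ := hnil.isUnit_one_add
    refine ⟨(w⁻¹ : Aˣ), ?_⟩
    have : ((w⁻¹ : Aˣ) : A) * (1 + y * x) = 1 := by rw [← hw, Units.inv_mul]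
    rw [mul_add, mul_one, ← mul_assoc] at this
    rw [add_comm, this, sub_self]
    exact Submodule.zero_mem _
  refine ⟨n, fun u hu => ?_⟩
  have key : ∀ m : ℕ, ∃ z ∈ (Ideal.jacobson (⊥ : Ideal A)) ^ m, (z : Matrix ι ι K) =
      ((List.range m).map fun k => (u k : Matrix ι ι K) - 1).prod := by
    intro m
    induction m with
    | zero =>
      refine ⟨1, ?_, by simp⟩
      rw [Submodule.pow_zero, Submodule.one_eq_span]
      exact Submodule.mem_span_singleton_self 1
    | succ m ih =>
      obtain ⟨z, hz, hz'⟩ := ih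
      refine ⟨z * ⟨_, A.sub_mem (hmem _ (hu m)) A.one_mem⟩, ?_, ?_⟩
      · rw [Submodule.pow_succ]
        exact Submodule.mul_mem_mul hz (hjac _ (hu m))
      · rw [List.range_succ]
        simp [hz']
  obtain ⟨z, hz, hz'⟩ := key n
  rw [← hz']
  rw [hn] at hz
  have : z = 0 := by simpa using hz
  rw [this]; rfl

/-- If `h` normalizes a unipotent group `U`, then `h (u - 1)` is nilpotent for `u` in `U`: its
`m`-th power is the product of the `m` matrices `hᵏ u h⁻ᵏ - 1`, for `k = 1, …, m`, times `hᵐ`. -/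
theorem IsUnipotent.trace_mul_sub_one_eq_zero [CharZero K] {U : Subgroup (GL ι K)}
    (hU : IsUnipotent U) {h : GL ι K} (hn : ∀ u ∈ U, h * u * h⁻¹ ∈ U) {u : GL ι K} (hu : u ∈ U) :
    ((h : Matrix ι ι K) * ((u : Matrix ι ι K) - 1)).trace = 0 := by
  obtain ⟨n, hprod⟩ := hU.exists_prod_sub_one_eq_zero
  have hpow : ∀ k : ℕ, h ^ k * u * (h ^ k)⁻¹ ∈ U := by
    intro k
    induction k with
    | zero => simpa using hu
    | succ k ih =>
      have := hn _ ih
      simpa [pow_succ', mul_assoc] using this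
  have key : ∀ m : ℕ, ((h : Matrix ι ι K) * ((u : Matrix ι ι K) - 1)) ^ m =
      ((List.range m).map fun k => ((h ^ (k + 1) * u * (h ^ (k + 1))⁻¹ : GL ι K) :
        Matrix ι ι K) - 1).prod * ((h ^ m : GL ι K) : Matrix ι ι K) := by
    intro m
    induction m with
    | zero => simp
    | succ m ih =>
      rw [pow_succ, ih, List.range_succ, List.map_append, List.prod_append]
      simp only [List.map_cons, List.map_nil, List.prod_cons, List.prod_nil, mul_one, mul_assoc]
      congr 1
      rw [sub_mul, one_mul, mul_sub, mul_sub, ← Units.val_mul, ← Units.val_mul, ← Units.val_mul]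
      simp [pow_succ, mul_assoc]
  refine (Matrix.isNilpotent_trace_of_isNilpotent ⟨n, ?_⟩).eq_zero
  rw [key, hprod (fun k => h ^ (k + 1) * u * (h ^ (k + 1))⁻¹) (fun k => hpow _), zero_mul]

end TraceIdeal

end SmallSubgroups
end

noncomputable section
namespace SmallSubgroups

/-! ### Lie algebras and identity components of algebraic groups -/

section Tangent

variable {ι : Type} [Fintype ι] [DecidableEq ι] {K : Type} [Field K]

theorem evalAt_map {F : Type} [Field F] [Algebra F K] (g : GL ι K) (p : MvPolynomial (ι × ι) F) :
    evalAt g (MvPolynomial.map (algebraMap F K) p) =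
      MvPolynomial.aeval (fun ij : ι × ι => (g : Matrix ι ι K) ij.1 ij.2) p := by
  rw [evalAt, MvPolynomial.eval_map]
  rfl

theorem evalAt_eq_aeval (g : GL ι K) (p : MvPolynomial (ι × ι) K) :
    evalAt g p = MvPolynomial.aeval (fun ij : ι × ι => (g : Matrix ι ι K) ij.1 ij.2) p := rfl

/-- The first-order Taylor expansion of a polynomial at the identity matrix, in dual numbers. -/
theorem aeval_one_add_eps (X : Matrix ι ι K) (p : MvPolynomial (ι × ι) K) :
    MvPolynomial.aeval (fun ij : ι × ι =>
      (TrivSqZeroExt.inl ((1 : Matrix ι ι K) ij.1 ij.2) + TrivSqZeroExt.inr (X ij.1 ij.2) :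
        DualNumber K)) p =
      TrivSqZeroExt.inl (evalAt 1 p) +
        TrivSqZeroExt.inr (∑ i, ∑ j, X i j * evalAt 1 (MvPolynomial.pderiv (i, j) p)) := by
  induction p using MvPolynomial.induction_on with
  | C a =>
    simp [evalAt]
    rfl
  | add p q hp hq =>
    rw [map_add, hp, hq]
    ext <;> simp [evalAt, mul_add, Finset.sum_add_distrib]
  | mul_X p k hp =>
    rw [map_mul, hp, MvPolynomial.aeval_X]
    ext
    · simp [evalAt]
    · obtain ⟨a, b⟩ := k
      have h1 : ∀ i j,
          evalAt (1 : GL ι K) (MvPolynomial.pderiv (i, j) (p * MvPolynomial.X (a, b))) =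
          (1 : Matrix ι ι K) a b * evalAt 1 (MvPolynomial.pderiv (i, j) p) +
            evalAt 1 p * (if (i, j) = (a, b) then 1 else 0) := by
        intro i j
        rw [Derivation.leibniz, MvPolynomial.pderiv_X]
        simp only [evalAt, smul_eq_mul, map_add, map_mul, Pi.single_apply, MvPolynomial.eval_X,
          Units.val_one]
        rw [add_comm]
        congr 2
        by_cases h : (i, j) = (a, b)
        · simp [h]
        · rw [if_neg h, if_neg (fun h' => h h'.symm), map_zero]
      simp only [h1, mul_add, Finset.sum_add_distrib]
      have h2 : ∑ i, ∑ j, X i j * (evalAt (1 : GL ι K) p * (if (i, j) = (a, b) then 1 else 0)) =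
          X a b * evalAt 1 p := by
        rw [Finset.sum_eq_single a, Finset.sum_eq_single b]
        · simp
        · intro j _ hj; simp [hj]
        · simp
        · intro i _ hi; simp [hi]
        · simp
      rw [h2]
      simp only [mul_left_comm _ ((1 : Matrix ι ι K) a b), ← Finset.mul_sum]
      simp
      ring

/-- A tangent vector of a polynomial curve in `H` through the identity lies in the Lie algebra: the
equations of `H` vanish along the curve identically in the parameter `s`, which may then be
specialized to `ε`. -/
theorem mem_lieAlg_of_curve [Infinite K] {H : Subgroup (GL ι K)} {X Z : Matrix ι ι K}
    (h : ∀ s : K, ∃ g ∈ H, (g : Matrix ι ι K) = 1 + s • X + s ^ 2 • Z) : X ∈ lieAlg H := by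
  intro p hp
  let c : ι × ι → Polynomial K := fun ij => Polynomial.C ((1 : Matrix ι ι K) ij.1 ij.2) +
    Polynomial.X * Polynomial.C (X ij.1 ij.2) + Polynomial.X ^ 2 * Polynomial.C (Z ij.1 ij.2)
  have hq : MvPolynomial.aeval c p = 0 := by
    apply Polynomial.funext
    intro s
    obtain ⟨g, hg, hgs⟩ := h s
    have := hp g hg
    rw [Polynomial.eval_zero, ← this, evalAt_eq_aeval, hgs, ← Polynomial.coe_aeval_eq_eval]
    change ((Polynomial.aeval s).comp (MvPolynomial.aeval c)) p = _
    rw [MvPolynomial.comp_aeval]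
    congr 2
    funext ij
    simp [c]
    ring
  have h2 := congrArg (Polynomial.aeval (DualNumber.eps : DualNumber K)) hq
  rw [map_zero] at h2
  change ((Polynomial.aeval (DualNumber.eps : DualNumber K)).comp (MvPolynomial.aeval c)) p =
      0 at h2
  rw [MvPolynomial.comp_aeval] at h2
  have h3 : (fun ij => (Polynomial.aeval (DualNumber.eps : DualNumber K)) (c ij)) =
      (fun ij : ι × ι => (TrivSqZeroExt.inl ((1 : Matrix ι ι K) ij.1 ij.2) +
        TrivSqZeroExt.inr (X ij.1 ij.2) : DualNumber K)) := by
    funext ij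
    simp only [c, map_add, map_mul, Polynomial.aeval_C, Polynomial.aeval_X, pow_two,
      DualNumber.eps_mul_eps, zero_mul, add_zero, TrivSqZeroExt.algebraMap_eq_inl]
    ext <;> simp
  rw [h3, aeval_one_add_eps] at h2
  simpa using congrArg TrivSqZeroExt.snd h2

/-- A tangent vector at the identity gives a point over the dual numbers. -/
theorem exists_dualNumber_point_of_mem_lieAlg {F : Type} [Field F] [Algebra F K]
    (H : AlgGroup ι F) {X : Matrix ι ι K} (hX : X ∈ lieAlg (H.points K)) :
    ∃ g ∈ H.points (DualNumber K), ∀ i j, (g : Matrix ι ι (DualNumber K)) i j =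
      TrivSqZeroExt.inl ((1 : Matrix ι ι K) i j) + TrivSqZeroExt.inr (X i j) := by
  obtain ⟨I, hI⟩ := H.exists_equations
  let Y : Matrix ι ι (DualNumber K) := X.map TrivSqZeroExt.inr
  have hYY : Y * Y = 0 := by
    ext i j <;> simp [Y, Matrix.mul_apply]
  let g : GL ι (DualNumber K) := ⟨1 + Y, 1 - Y, by noncomm_ring; simp [hYY], by
    noncomm_ring; simp [hYY]⟩
  have hg : ∀ i j, (g : Matrix ι ι (DualNumber K)) i j =
      TrivSqZeroExt.inl ((1 : Matrix ι ι K) i j) + TrivSqZeroExt.inr (X i j) := by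
    intro i j
    simp [g, Y, Matrix.one_apply, apply_ite (TrivSqZeroExt.inl : K → DualNumber K)]
  refine ⟨g, ?_, hg⟩
  rw [hI]
  intro p hp
  have h0 : ∀ u ∈ H.points K, evalAt u (MvPolynomial.map (algebraMap F K) p) = 0 := by
    intro u hu
    rw [evalAt_map]
    exact (hI K u).1 hu p hp
  simp only [hg]
  rw [← MvPolynomial.aeval_map_algebraMap K, aeval_one_add_eps, hX _ h0]
  have : evalAt 1 (MvPolynomial.map (algebraMap F K) p) = 0 := h0 1 (one_mem _)
  simp [this]

/-- The linearization at the identity of the equation that preserves the form `B`. -/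
theorem dualNumber_form {X B : Matrix ι ι K}
    (h : (1 + X.map TrivSqZeroExt.inr : Matrix ι ι (DualNumber K)) * B.map TrivSqZeroExt.inl *
      (1 + X.map TrivSqZeroExt.inr : Matrix ι ι (DualNumber K))ᵀ = B.map TrivSqZeroExt.inl) :
    X * B + B * Xᵀ = 0 := by
  have e1 : (X.map TrivSqZeroExt.inr : Matrix ι ι (DualNumber K)) * B.map TrivSqZeroExt.inl =
      (X * B).map TrivSqZeroExt.inr := by
    ext i j <;> simp [Matrix.mul_apply, TrivSqZeroExt.snd_sum, TrivSqZeroExt.fst_sum, mul_comm]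
  have e2 : (B.map TrivSqZeroExt.inl : Matrix ι ι (DualNumber K)) *
      (X.map TrivSqZeroExt.inr : Matrix ι ι (DualNumber K))ᵀ =
      (B * Xᵀ).map TrivSqZeroExt.inr := by
    ext i j <;> simp [Matrix.mul_apply, TrivSqZeroExt.snd_sum, TrivSqZeroExt.fst_sum, mul_comm]
  have e3 : ((X * B).map TrivSqZeroExt.inr : Matrix ι ι (DualNumber K)) *
      (X.map TrivSqZeroExt.inr : Matrix ι ι (DualNumber K))ᵀ = 0 := by
    ext i j <;> simp [Matrix.mul_apply]
  rw [Matrix.transpose_add, Matrix.transpose_one, add_mul, one_mul, e1, add_mul, mul_add, mul_add,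
    mul_one, mul_one, e2, e3, add_zero, add_assoc, add_eq_left] at h
  ext i j
  simpa [add_comm] using congrArg TrivSqZeroExt.snd (congrFun (congrFun h i) j)

/-- The linearization at the identity of the equation that `g` commutes with `C`. -/
theorem dualNumber_comm {X C : Matrix ι ι K}
    (h : (1 + X.map TrivSqZeroExt.inr : Matrix ι ι (DualNumber K)) * C.map TrivSqZeroExt.inl =
      C.map TrivSqZeroExt.inl * (1 + X.map TrivSqZeroExt.inr : Matrix ι ι (DualNumber K))) :
    X * C = C * X := by
  have e1 : (X.map TrivSqZeroExt.inr : Matrix ι ι (DualNumber K)) * C.map TrivSqZeroExt.inl =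
      (X * C).map TrivSqZeroExt.inr := by
    ext i j <;> simp [Matrix.mul_apply, TrivSqZeroExt.snd_sum, TrivSqZeroExt.fst_sum, mul_comm]
  have e2 : (C.map TrivSqZeroExt.inl : Matrix ι ι (DualNumber K)) *
      (X.map TrivSqZeroExt.inr : Matrix ι ι (DualNumber K)) =
      (C * X).map TrivSqZeroExt.inr := by
    ext i j <;> simp [Matrix.mul_apply, TrivSqZeroExt.snd_sum, TrivSqZeroExt.fst_sum, mul_comm]
  rw [add_mul, one_mul, e1, mul_add, mul_one, e2, add_right_inj] at h
  ext i j
  simpa using congrArg TrivSqZeroExt.snd (congrFun (congrFun h i) j)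

theorem AlgGroup.isZariskiClosed_points {F : Type} [Field F] [Algebra F K] (H : AlgGroup ι F) :
    IsZariskiClosed (H.points K) := by
  obtain ⟨I, hI⟩ := H.exists_equations
  refine ⟨MvPolynomial.map (algebraMap F K) '' I, fun g => ?_⟩
  rw [hI, Set.forall_mem_image]
  refine forall₂_congr fun p _ => ?_
  rw [evalAt_map]

theorem identityComponent_le {G : Subgroup (GL ι K)} (hG : IsZariskiClosed G) :
    identityComponent G ≤ G :=
  sInf_le ⟨le_rfl, hG, by simp⟩

/-- Elements that have roots of every order in `G` lie in every subgroup of finite index. -/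
theorem mem_identityComponent_of_forall_pow {G : Subgroup (GL ι K)} {g : GL ι K}
    (h : ∀ n : ℕ, n ≠ 0 → ∃ b ∈ G, b ^ n = g) : g ∈ identityComponent G := by
  rw [identityComponent, Subgroup.mem_sInf]
  rintro U ⟨_, _, hU⟩
  obtain ⟨b, hb, rfl⟩ := h _ (Nat.factorial_ne_zero (U.relIndex G))
  have := Subgroup.pow_mem_of_index_ne_zero_of_dvd (H := U.subgroupOf G) hU ⟨b, hb⟩
    (n := (U.relIndex G).factorial) (fun m hm hm' => Nat.dvd_factorial hm hm')
  simpa [Subgroup.mem_subgroupOf] using this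

theorem isZariskiConnected_of_forall_pow {G : Subgroup (GL ι K)} (hG : IsZariskiClosed G)
    (h : ∀ g ∈ G, ∀ n : ℕ, n ≠ 0 → ∃ b ∈ G, b ^ n = g) : IsZariskiConnected G :=
  le_antisymm (identityComponent_le hG) fun g hg => mem_identityComponent_of_forall_pow (h g hg)

end Tangent

/-! ### Exponentials of nilpotent matrices -/

section NilpotentExponential

variable {ι : Type} [Fintype ι] [DecidableEq ι] {K : Type} [Field K]

/-- The exponential of a matrix `X` with `X ^ 3 = 0`. -/
def nilExp (X : Matrix ι ι K) : Matrix ι ι K := 1 + X + (1 / 2 : K) • (X * X)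

theorem nilExp_smul_mul [CharZero K] {X : Matrix ι ι K} (hX : X * X * X = 0) (s t : K) :
    nilExp (s • X) * nilExp (t • X) = nilExp ((s + t) • X) := by
  have h4 : X * X * (X * X) = 0 := by rw [← mul_assoc, hX, zero_mul]
  have h3 : X * (X * X) = 0 := by rw [← mul_assoc, hX]
  simp only [nilExp, mul_add, add_mul, one_mul, mul_one, smul_mul_assoc, mul_smul_comm, smul_smul,
    hX, h4, h3, smul_zero, add_zero]
  module

theorem nilExp_zero : nilExp (0 : Matrix ι ι K) = 1 := by simp [nilExp]

/-- `nilExp X` as an invertible matrix. -/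
def nilExpGL [CharZero K] (X : Matrix ι ι K) (hX : X * X * X = 0) : GL ι K where
  val := nilExp X
  inv := nilExp (-X)
  val_inv := by simpa [nilExp_zero] using nilExp_smul_mul hX 1 (-1)
  inv_val := by simpa [nilExp_zero] using nilExp_smul_mul hX (-1) 1

theorem smul_cube_eq_zero {X : Matrix ι ι K} (hX : X * X * X = 0) (s : K) :
    (s • X) * (s • X) * (s • X) = 0 := by
  simp [hX]

theorem nilExpGL_smul_pow [CharZero K] {X : Matrix ι ι K} (hX : X * X * X = 0) (s : K) (n : ℕ) :
    nilExpGL (s • X) (smul_cube_eq_zero hX s) ^ n =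
      nilExpGL ((n * s) • X) (smul_cube_eq_zero hX _) := by
  induction n with
  | zero => ext1; simp [nilExpGL, nilExp_zero]
  | succ n ih =>
    rw [pow_succ, ih]
    ext1
    simp only [Units.val_mul, nilExpGL]
    rw [nilExp_smul_mul hX]
    push_cast
    congr 2
    ring

end NilpotentExponential

/-! ### Centralizers in the orthogonal group -/

section Centralizer

/-- The centralizer in `SO(Q)(R)` of a matrix `C`. -/
def centPoints {R : Type} [CommRing R] (C : Matrix Idx Idx R) : Subgroup (GL Idx R) where
  carrier := {g | g ∈ soPoints R ∧ (g : Matrix Idx Idx R) * C = C * g}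
  one_mem' := ⟨one_mem _, by simp⟩
  mul_mem' := by
    rintro a b ⟨ha, ha'⟩ ⟨hb, hb'⟩
    refine ⟨mul_mem ha hb, ?_⟩
    rw [Units.val_mul, mul_assoc, hb', ← mul_assoc, ha', mul_assoc]
  inv_mem' := by
    rintro a ⟨ha, ha'⟩
    refine ⟨inv_mem ha, ?_⟩
    calc ((a⁻¹ : GL Idx R) : Matrix Idx Idx R) * C
        = (a⁻¹ : GL Idx R) * (C * a) * (a⁻¹ : GL Idx R) := by simp [mul_assoc]
      _ = C * (a⁻¹ : GL Idx R) := by rw [← ha']; simp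

theorem mem_centPoints {R : Type} [CommRing R] {C : Matrix Idx Idx R} {g : GL Idx R} :
    g ∈ centPoints C ↔ g ∈ soPoints R ∧ (g : Matrix Idx Idx R) * C = C * g := Iff.rfl

theorem centPoints_le {R : Type} [CommRing R] (C : Matrix Idx Idx R) :
    centPoints C ≤ soPoints R := fun _ h => h.1

theorem centPoints_zero (R : Type) [CommRing R] :
    centPoints (0 : Matrix Idx Idx R) = soPoints R := by
  ext g; simp [mem_centPoints]

/-- The centralizer in `SO(Q)` of a matrix over `F`, as an algebraic group over `F`. -/
def centGroup {F : Type} [Field F] (C : Matrix Idx Idx F) : AlgGroup Idx F where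
  points R _ _ := centPoints (C.map (algebraMap F R))
  exists_equations := by
    obtain ⟨I, hI⟩ := (soGroup F).exists_equations
    let X := Matrix.mvPolynomialX Idx Idx F
    let D := C.map (algebraMap F (MvPolynomial (Idx × Idx) F))
    refine ⟨I ∪ {p | ∃ i j, p = (X * D - D * X) i j}, ?_⟩
    intro R _ _ g
    set φ := MvPolynomial.aeval (R := F) (fun ij : Idx × Idx => (g : Matrix Idx Idx R) ij.1 ij.2)
      with hφ
    have hp : ∀ i j, φ ((X * D - D * X) i j) =
        ((g : Matrix Idx Idx R) * C.map (algebraMap F R) - C.map (algebraMap F R) * g) i j := by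
      intro i j
      simp [Matrix.mul_apply, X, D, hφ]
    rw [mem_centPoints]
    constructor
    · rintro ⟨h1, h2⟩ p (hp1 | ⟨i, j, rfl⟩)
      · exact (hI R g).1 h1 p hp1
      · rw [hp, h2, sub_self, Matrix.zero_apply]
    · intro h
      refine ⟨(hI R g).2 fun p hp1 => h p (Or.inl hp1), ?_⟩
      rw [← sub_eq_zero]
      ext i j
      rw [← hp]
      exact h _ (Or.inr ⟨i, j, rfl⟩)

variable {K : Type} [Field K]

theorem isZariskiClosed_centPoints (C : Matrix Idx Idx K) : IsZariskiClosed (centPoints C) := by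
  have := (centGroup C).isZariskiClosed_points (K := K)
  simpa [centGroup] using this

theorem gram_mul_gram (R : Type) [CommRing R] : gram R * gram R = 1 := by
  rw [gram, Matrix.fromBlocks_multiply, ← Matrix.fromBlocks_one]
  congr 1
  · ext i j; fin_cases i <;> fin_cases j <;> simp
  all_goals simp

theorem gram_transpose (R : Type) [CommRing R] : (gram R)ᵀ = gram R := by
  rw [gram, Matrix.fromBlocks_transpose]
  congr 1
  · ext i j; fin_cases i <;> fin_cases j <;> simp
  all_goals simp

/-- The Lie algebra of the centralizer of `C`, defined by all polynomials that vanish on the group,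
satisfies the linear equations expected of it. -/
theorem of_mem_lieAlg_centPoints {C : Matrix Idx Idx K} {X : Matrix Idx Idx K}
    (hX : X ∈ lieAlg (centPoints C)) : X * gram K + gram K * Xᵀ = 0 ∧ X * C = C * X := by
  have hX' : X ∈ lieAlg ((centGroup C).points K) := by simpa [centGroup] using hX
  obtain ⟨g, ⟨⟨hg1, -⟩, hg2⟩, hg⟩ := exists_dualNumber_point_of_mem_lieAlg (centGroup C) hX'
  have hY : (g : Matrix Idx Idx (DualNumber K)) = 1 + X.map TrivSqZeroExt.inr := by
    ext1 i j
    rw [hg]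
    simp [Matrix.one_apply, apply_ite (TrivSqZeroExt.inl : K → DualNumber K)]
  have hB : gram (DualNumber K) = (gram K).map TrivSqZeroExt.inl := by
    ext1 i j
    rcases i with i | i <;> rcases j with j | j
    · fin_cases i <;> fin_cases j <;> simp [gram]
    · simp [gram]
    · simp [gram]
    · simp [gram, Matrix.one_apply, apply_ite (TrivSqZeroExt.inl : K → DualNumber K)]
  rw [hY, hB] at hg1
  rw [hY, TrivSqZeroExt.algebraMap_eq_inl] at hg2
  exact ⟨dualNumber_form hg1, dualNumber_comm hg2⟩

variable [CharZero K]

/-- Exponentials of nilpotent matrices `X` of the Lie algebra of `SO(Q)` lie in `SO(Q)`; the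
determinant is one as `exp X` is the square of the orthogonal matrix `exp (X / 2)`. -/
theorem nilExpGL_mem_centPoints {C : Matrix Idx Idx K} {X : Matrix Idx Idx K}
    (h3 : X * X * X = 0) (hB : X * gram K + gram K * Xᵀ = 0) (hC : X * C = C * X) :
    nilExpGL X h3 ∈ centPoints C := by
  have hform : ∀ s : K, nilExp (s • X) * gram K * (nilExp (s • X))ᵀ = gram K := by
    intro s
    have h1 : gram K * Xᵀ = -(X * gram K) := by rw [eq_neg_iff_add_eq_zero, add_comm, hB]
    have h2 : gram K * (nilExp (s • X))ᵀ = nilExp ((-s) • X) * gram K := by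
      have h4 : gram K * (Xᵀ * Xᵀ) = X * X * gram K := by
        rw [← mul_assoc, h1, neg_mul, mul_assoc, h1, mul_neg, neg_neg, mul_assoc]
      simp only [nilExp, Matrix.transpose_add, Matrix.transpose_one, Matrix.transpose_smul,
        Matrix.transpose_mul, mul_add, add_mul, mul_one, one_mul, mul_smul_comm, smul_mul_assoc,
        h1, h4]
      module
    rw [mul_assoc, h2, ← mul_assoc, nilExp_smul_mul h3, add_neg_cancel, zero_smul, nilExp_zero,
      one_mul]
  have hB0 : (gram K).det ≠ 0 := by
    have := congrArg Matrix.det (gram_mul_gram K)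
    rw [Matrix.det_mul, Matrix.det_one] at this
    exact left_ne_zero_of_mul_eq_one this
  refine ⟨⟨by simpa [nilExpGL] using hform 1, ?_⟩, ?_⟩
  · have h1 := nilExp_smul_mul h3 (1 / 2) (1 / 2)
    rw [show (1 / 2 : K) + 1 / 2 = 1 by ring, one_smul] at h1
    change (nilExp X).det = 1
    rw [← h1, Matrix.det_mul]
    have h2 := congrArg Matrix.det (hform (1 / 2))
    rw [Matrix.det_mul, Matrix.det_mul, Matrix.det_transpose] at h2
    apply mul_right_cancel₀ hB0
    linear_combination h2
  · change nilExp X * C = C * nilExp X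
    have : X * X * C = C * (X * X) := by rw [mul_assoc, hC, ← mul_assoc, hC, mul_assoc]
    simp only [nilExp, add_mul, mul_add, one_mul, mul_one, smul_mul_assoc, mul_smul_comm, hC, this]

theorem nilExpGL_mem_identityComponent {X : Matrix Idx Idx K} {C : Matrix Idx Idx K}
    (h3 : X * X * X = 0) (hB : X * gram K + gram K * Xᵀ = 0) (hC : X * C = C * X) :
    nilExpGL X h3 ∈ identityComponent (centPoints C) := by
  refine mem_identityComponent_of_forall_pow fun n hn => ?_
  refine ⟨nilExpGL ((n : K)⁻¹ • X) (smul_cube_eq_zero h3 _),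
    nilExpGL_mem_centPoints _ ?_ ?_, ?_⟩
  · rw [smul_mul_assoc, Matrix.transpose_smul, mul_smul_comm, ← smul_add, hB, smul_zero]
  · rw [smul_mul_assoc, mul_smul_comm, hC]
  · rw [nilExpGL_smul_pow h3]
    ext1
    simp [nilExpGL, hn]

/-- A partial converse of `of_mem_lieAlg_centPoints`, for nilpotent matrices. -/
theorem mem_lieAlg_centPoints {X : Matrix Idx Idx K} {C : Matrix Idx Idx K}
    (h3 : X * X * X = 0) (hB : X * gram K + gram K * Xᵀ = 0) (hC : X * C = C * X) :
    X ∈ lieAlg (centPoints C) := by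
  refine mem_lieAlg_of_curve (Z := (1 / 2 : K) • (X * X)) fun s =>
    ⟨nilExpGL (s • X) (smul_cube_eq_zero h3 _), nilExpGL_mem_centPoints _ ?_ ?_, ?_⟩
  · rw [smul_mul_assoc, Matrix.transpose_smul, mul_smul_comm, ← smul_add, hB, smul_zero]
  · rw [smul_mul_assoc, mul_smul_comm, hC]
  · change 1 + s • X + (1 / 2 : K) • (s • X * s • X) = _
    rw [smul_mul_smul_comm]
    module

end Centralizer

end SmallSubgroups
end

noncomputable section
namespace SmallSubgroups

/-! ### Characters of the multiplicative group -/

section Characters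

variable {K : Type} [Field K]

theorem exists_polynomial_of_mem_regularGm {f : Kˣ → K} (hf : f ∈ regularGm K) :
    ∃ (p : Polynomial K) (N : ℕ), ∀ z : Kˣ, f z * (z : K) ^ N = p.eval (z : K) := by
  refine Algebra.adjoin_induction
    (p := fun f _ => ∃ (p : Polynomial K) (N : ℕ), ∀ z : Kˣ, f z * (z : K) ^ N = p.eval (z : K))
    ?_ ?_ ?_ ?_ hf
  · rintro x (rfl | rfl)
    · exact ⟨Polynomial.X, 0, fun z => by simp⟩
    · exact ⟨1, 1, fun z => by simp⟩
  · intro r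
    exact ⟨Polynomial.C r, 0, fun z => by simp⟩
  · rintro x y _ _ ⟨p, N, hp⟩ ⟨q, M, hq⟩
    refine ⟨p * Polynomial.X ^ M + q * Polynomial.X ^ N, N + M, fun z => ?_⟩
    rw [Pi.add_apply, Polynomial.eval_add, Polynomial.eval_mul, Polynomial.eval_mul, ← hp, ← hq]
    simp only [Polynomial.eval_pow, Polynomial.eval_X]
    ring
  · rintro x y _ _ ⟨p, N, hp⟩ ⟨q, M, hq⟩
    refine ⟨p * q, N + M, fun z => ?_⟩
    rw [Pi.mul_apply, Polynomial.eval_mul, ← hp, ← hq]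
    ring

/-- The algebraic characters of the multiplicative group are the powers. -/
theorem exists_zpow_of_regular [Infinite K] (f : Kˣ →* Kˣ)
    (hf : (fun z => ((f z : Kˣ) : K)) ∈ regularGm K) : ∃ m : ℤ, ∀ z, f z = z ^ m := by
  -- `f = p / zᴺ` and `f⁻¹ = q / zᴹ` with `p q = zᴺ⁺ᴹ`, so `p` is a monomial
  obtain ⟨p, N, hp⟩ := exists_polynomial_of_mem_regularGm hf
  obtain ⟨q, M, hq⟩ := exists_polynomial_of_mem_regularGm (regularGm_inv hf)
  have hpq : p * q = Polynomial.X ^ (N + M) := by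
    apply Polynomial.eq_of_infinite_eval_eq
    have : (Set.range (fun z : Kˣ => (z : K))).Infinite := by
      have h0 : Set.range (fun z : Kˣ => (z : K)) = {0}ᶜ := by
        ext x
        simp only [Set.mem_range, Set.mem_compl_iff, Set.mem_singleton_iff]
        exact ⟨by rintro ⟨z, rfl⟩; exact z.ne_zero, fun h => ⟨Units.mk0 x h, rfl⟩⟩
      rw [h0]
      exact (Set.finite_singleton 0).infinite_compl
    refine this.mono ?_
    rintro _ ⟨z, rfl⟩
    simp only [Set.mem_ofPred_eq, Polynomial.eval_mul, Polynomial.eval_pow, Polynomial.eval_X]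
    rw [← hp, ← hq, map_inv]
    have : ((f z : Kˣ) : K) ≠ 0 := (f z).ne_zero
    simp only [Units.val_inv_eq_inv_val]
    field_simp
    ring
  obtain ⟨k, -, hk⟩ := (dvd_prime_pow Polynomial.prime_X _).1 (Dvd.intro _ hpq)
  obtain ⟨u, hu⟩ := hk.symm
  obtain ⟨c, hc, hcu⟩ := Polynomial.isUnit_iff.1 u.isUnit
  rw [← hcu] at hu
  have hval : ∀ z : Kˣ, ((f z : Kˣ) : K) * (z : K) ^ N = c * (z : K) ^ k := by
    intro z
    rw [hp, ← hu, Polynomial.eval_mul, Polynomial.eval_pow, Polynomial.eval_X, Polynomial.eval_C,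
      mul_comm]
  have hc1 : c = 1 := by simpa using (hval 1).symm
  refine ⟨(k : ℤ) - N, fun z => ?_⟩
  rw [zpow_sub, eq_mul_inv_iff_mul_eq]
  ext
  simpa [hc1] using hval z

theorem zpow_two_injective [CharZero K] {m n : ℤ} (h : ∀ z : Kˣ, z ^ m = z ^ n) : m = n := by
  have h2 := congrArg (Units.val) (h (Units.mk0 (2 : K) two_ne_zero))
  simp only [Units.val_zpow_eq_zpow_val, Units.val_mk0] at h2
  have h3 : ((2 : ℚ) ^ m : ℚ) = 2 ^ n := by
    apply Rat.cast_injective (α := K)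
    push_cast
    exact h2
  exact zpow_right_injective₀ (by norm_num) (by norm_num) h3

end Characters

/-! ### Weights of a diagonalized torus -/

section Weights

variable {ι : Type} [Fintype ι] [DecidableEq ι] {K : Type} [Field K]

/-- The `i`-th diagonal entry of `P t P⁻¹`, as a character of a torus that `P` diagonalizes. -/
def diagChar (T : AlgTorus ι K) (P : GL ι K)
    (hT : ∀ t ∈ T.carrier, ((P * t * P⁻¹ : GL ι K) : Matrix ι ι K).IsDiag) (i : ι) :
    T.carrier →* Kˣ :=
  MonoidHom.toHomUnits
    { toFun := fun t => ((P * t * P⁻¹ : GL ι K) : Matrix ι ι K) i i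
      map_one' := by simp
      map_mul' := by
        intro s t
        have h : P * ((s * t : T.carrier) : GL ι K) * P⁻¹ = (P * s * P⁻¹) * (P * t * P⁻¹) := by
          simp [mul_assoc]
        rw [h, Units.val_mul, Matrix.mul_apply, Finset.sum_eq_single i]
        · intro j _ hj
          rw [hT s s.2 hj.symm, zero_mul]
        · simp }

theorem diagChar_apply {T : AlgTorus ι K} {P : GL ι K}
    (hT : ∀ t ∈ T.carrier, ((P * t * P⁻¹ : GL ι K) : Matrix ι ι K).IsDiag) (i : ι)
    (t : T.carrier) :
    (diagChar T P hT i t : K) = ((P * t * P⁻¹ : GL ι K) : Matrix ι ι K) i i := rfl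

theorem conj_eq_diagonal {T : AlgTorus ι K} {P : GL ι K}
    (hT : ∀ t ∈ T.carrier, ((P * t * P⁻¹ : GL ι K) : Matrix ι ι K).IsDiag) (t : T.carrier) :
    ((P * t * P⁻¹ : GL ι K) : Matrix ι ι K) =
      Matrix.diagonal fun i => (diagChar T P hT i t : K) :=
  ((Matrix.isDiag_iff_diagonal_diag _).1 (hT t t.2)).symm

/-- Linear maps on `X_*(T) ⊗ ℝ` are determined by their values on cocharacters. -/
theorem realCochar_hom_ext {V : Type*} [AddCommGroup V] [Module ℝ V] {T : AlgTorus ι K}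
    {f g : RealCochar T →ₗ[ℝ] V} (h : ∀ l : Cochar T, f (1 ⊗ₜ[ℤ] l) = g (1 ⊗ₜ[ℤ] l)) : f = g := by
  ext l
  simpa using h l

variable [CharZero K]

theorem exists_weight {T : AlgTorus ι K} {P : GL ι K}
    (hT : ∀ t ∈ T.carrier, ((P * t * P⁻¹ : GL ι K) : Matrix ι ι K).IsDiag) (i : ι)
    (l : Cochar T) : ∃ m : ℤ, ∀ z : Kˣ, diagChar T P hT i (l.eval z) = z ^ m := by
  have := exists_zpow_of_regular ((diagChar T P hT i).comp l.toMul.1) ?_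
  · exact this
  · have h : IsRegularMap (fun z : Kˣ => (P : Matrix ι ι K) *
        ((l.toMul.1 z : GL ι K) : Matrix ι ι K) * ((P⁻¹ : GL ι K) : Matrix ι ι K)) :=
      ((IsRegularMap.const _).mul l.toMul.2).mul (IsRegularMap.const _)
    exact h i i

/-- The integral weight `l ↦ ⟨χ_i, l⟩` of the `i`-th diagonal character. -/
def intWeight (T : AlgTorus ι K) (P : GL ι K)
    (hT : ∀ t ∈ T.carrier, ((P * t * P⁻¹ : GL ι K) : Matrix ι ι K).IsDiag) (i : ι) :
    Cochar T →+ ℤ where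
  toFun l := (exists_weight hT i l).choose
  map_zero' := by
    apply zpow_two_injective (K := K)
    intro z
    rw [← (exists_weight hT i 0).choose_spec z, zpow_zero]
    exact map_one _
  map_add' a b := by
    apply zpow_two_injective (K := K)
    intro z
    rw [zpow_add, ← (exists_weight hT i _).choose_spec z, ← (exists_weight hT i _).choose_spec z,
      ← (exists_weight hT i _).choose_spec z, ← map_mul]
    rfl

/-- The weight of the `i`-th diagonal character as a functional on `X_*(T) ⊗ ℝ`. -/
def weight (T : AlgTorus ι K) (P : GL ι K)
    (hT : ∀ t ∈ T.carrier, ((P * t * P⁻¹ : GL ι K) : Matrix ι ι K).IsDiag) (i : ι) :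
    Module.Dual ℝ (RealCochar T) :=
  (TensorProduct.AlgebraTensorModule.rid ℤ ℝ ℝ).toLinearMap ∘ₗ
    (intWeight T P hT i).toIntLinearMap.baseChange ℝ

theorem diagChar_eval {T : AlgTorus ι K} {P : GL ι K}
    (hT : ∀ t ∈ T.carrier, ((P * t * P⁻¹ : GL ι K) : Matrix ι ι K).IsDiag) (i : ι)
    (l : Cochar T) (z : Kˣ) : diagChar T P hT i (l.eval z) = z ^ intWeight T P hT i l :=
  (exists_weight hT i l).choose_spec z

theorem weight_tmul {T : AlgTorus ι K} {P : GL ι K}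
    (hT : ∀ t ∈ T.carrier, ((P * t * P⁻¹ : GL ι K) : Matrix ι ι K).IsDiag) (i : ι)
    (l : Cochar T) : weight T P hT i (1 ⊗ₜ[ℤ] l) = intWeight T P hT i l := by
  simp [weight]

theorem IsCharFunctional.unique {T : AlgTorus ι K} {χ : T.carrier →* Kˣ}
    {α β : Module.Dual ℝ (RealCochar T)} (hα : IsCharFunctional χ α) (hβ : IsCharFunctional χ β) :
    α = β := by
  apply realCochar_hom_ext
  intro l
  obtain ⟨m, hm, hm'⟩ := hα l
  obtain ⟨n, hn, hn'⟩ := hβ l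
  rw [hm', hn', zpow_two_injective (K := K) (m := m) (n := n) fun z => by rw [← hm, ← hn]]

theorem isCharFunctional_weight_sub {T : AlgTorus ι K} {P : GL ι K}
    (hT : ∀ t ∈ T.carrier, ((P * t * P⁻¹ : GL ι K) : Matrix ι ι K).IsDiag) (i j : ι) :
    IsCharFunctional (diagChar T P hT i / diagChar T P hT j)
      (weight T P hT i - weight T P hT j) :=
  fun l => ⟨intWeight T P hT i l - intWeight T P hT j l, fun z => by
    rw [zpow_sub, ← div_eq_mul_inv, MonoidHom.div_apply, diagChar_eval, diagChar_eval], by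
    rw [LinearMap.sub_apply, weight_tmul, weight_tmul]; push_cast; rfl⟩

/-- Inverse diagonal characters have opposite weights. -/
theorem weight_eq_neg {T : AlgTorus ι K} {P : GL ι K}
    (hT : ∀ t ∈ T.carrier, ((P * t * P⁻¹ : GL ι K) : Matrix ι ι K).IsDiag) {i j : ι}
    (h : ∀ t, diagChar T P hT i t = (diagChar T P hT j t)⁻¹) :
    weight T P hT i = -weight T P hT j := by
  apply realCochar_hom_ext
  intro l
  rw [LinearMap.neg_apply, weight_tmul, weight_tmul]
  rw [zpow_two_injective (K := K) (m := intWeight T P hT i l)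
    (n := -intWeight T P hT j l) fun z => by
    rw [← diagChar_eval, h, diagChar_eval, zpow_neg]]
  push_cast
  rfl

theorem weight_comp_realConj {T : AlgTorus ι K} {P : GL ι K}
    (hT : ∀ t ∈ T.carrier, ((P * t * P⁻¹ : GL ι K) : Matrix ι ι K).IsDiag) {n : GL ι K}
    (hn : ∀ t ∈ T.carrier, n * t * n⁻¹ ∈ T.carrier) {i j : ι}
    (h : ∀ t : T.carrier, diagChar T P hT i ⟨n * t * n⁻¹, hn t t.2⟩ = diagChar T P hT j t)
    (X : RealCochar T) : weight T P hT i (realConj n hn X) = weight T P hT j X := by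
  suffices weight T P hT i ∘ₗ realConj n hn = weight T P hT j from
    LinearMap.congr_fun this X
  apply realCochar_hom_ext
  intro l
  rw [LinearMap.comp_apply, realConj, LinearMap.baseChange_tmul, weight_tmul, weight_tmul]
  congr 1
  apply zpow_two_injective (K := K)
  intro z
  rw [← diagChar_eval, ← diagChar_eval, ← h]
  rfl

/-- An element normalizing a diagonalized torus permutes the diagonal characters, hence their
weights: by the Leibniz formula some product of entries `m i (σ i)` of the conjugated matrix is
nonzero, and such an entry carries one character to another. -/
theorem exists_perm_weight {T : AlgTorus ι K} {P : GL ι K}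
    (hT : ∀ t ∈ T.carrier, ((P * t * P⁻¹ : GL ι K) : Matrix ι ι K).IsDiag) {n : GL ι K}
    (hn : ∀ t ∈ T.carrier, n * t * n⁻¹ ∈ T.carrier) :
    ∃ σ : Equiv.Perm ι, ∀ i X, weight T P hT i (realConj n hn X) = weight T P hT (σ i) X := by
  set m : Matrix ι ι K := ((P * n * P⁻¹ : GL ι K) : Matrix ι ι K) with hm
  have hdet : m.det ≠ 0 := by
    have := (P * n * P⁻¹).isUnit
    exact ((Matrix.isUnit_iff_isUnit_det _).1 this).ne_zero
  rw [Matrix.det_apply'] at hdet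
  obtain ⟨σ, -, hσ⟩ := Finset.exists_ne_zero_of_sum_ne_zero hdet
  have hσ' : ∀ i, m (σ i) i ≠ 0 := fun i =>
    Finset.prod_ne_zero_iff.1 (right_ne_zero_of_mul hσ) i (Finset.mem_univ i)
  refine ⟨σ.symm, fun i X => weight_comp_realConj hT hn (fun t => ?_) X⟩
  have h1 : m * ((P * t * P⁻¹ : GL ι K) : Matrix ι ι K) =
      ((P * (n * t * n⁻¹) * P⁻¹ : GL ι K) : Matrix ι ι K) * m := by
    rw [hm, ← Units.val_mul, ← Units.val_mul]
    congr 1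
    group
  have h2 := congrFun (congrFun h1 i) (σ.symm i)
  rw [conj_eq_diagonal hT t] at h2
  have h3 := conj_eq_diagonal hT ⟨n * t * n⁻¹, hn t t.2⟩
  simp only at h3
  rw [h3, Matrix.mul_diagonal, Matrix.diagonal_mul, mul_comm] at h2
  have h4 := hσ' (σ.symm i)
  rw [Equiv.apply_symm_apply] at h4
  exact Units.ext (mul_right_cancel₀ h4 h2).symm

end Weights

end SmallSubgroups
end

noncomputable section
namespace SmallSubgroups

/-! ### The split form and its root vectors -/

section SplitForm

/-- The involution of the coordinates that pairs the hyperbolic partners of the split form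
`2 y₀ y₁ + 2 y₂ y₃ + y₄²`. -/
def bar : Equiv.Perm Idx := Equiv.sumCongr (Equiv.swap 0 1) (Equiv.swap 0 1)

theorem bar_bar (i : Idx) : bar (bar i) = i := by revert i; decide

theorem eq_bar_iff {i j : Idx} : i = bar j ↔ j = bar i := by revert i j; decide

/-- The Gram matrix of the split form `2 y₀ y₁ + 2 y₂ y₃ + y₄²`. -/
def splitGram (K : Type) [Field K] : Matrix Idx Idx K := fun i j => if j = bar i then 1 else 0

variable {K : Type} [Field K]

theorem mul_splitGram_apply (Y : Matrix Idx Idx K) (i j : Idx) :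
    (Y * splitGram K) i j = Y i (bar j) := by
  simp [Matrix.mul_apply, splitGram, eq_bar_iff (i := j)]

variable {P : GL Idx K}

theorem conj_form (hP : (P : Matrix Idx Idx K) * gram K * (P : Matrix Idx Idx K)ᵀ = splitGram K)
    (g : Matrix Idx Idx K) :
    (P * g * (P⁻¹ : GL Idx K) : Matrix Idx Idx K) * splitGram K =
      P * (g * gram K) * (P : Matrix Idx Idx K)ᵀ := by
  rw [← hP]
  simp only [mul_assoc]
  rw [← mul_assoc ((P⁻¹ : GL Idx K) : Matrix Idx Idx K), Units.inv_mul, one_mul]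

theorem transpose_mul_inv_transpose :
    (P : Matrix Idx Idx K)ᵀ * ((P⁻¹ : GL Idx K) : Matrix Idx Idx K)ᵀ = 1 := by
  rw [← Matrix.transpose_mul, Units.inv_mul, Matrix.transpose_one]

theorem conj_cancel {A B : Matrix Idx Idx K}
    (h : P * A * (P : Matrix Idx Idx K)ᵀ = P * B * (P : Matrix Idx Idx K)ᵀ) : A = B := by
  have h2 := congrArg (fun M => ((P⁻¹ : GL Idx K) : Matrix Idx Idx K) * M *
    ((P⁻¹ : GL Idx K) : Matrix Idx Idx K)ᵀ) h
  simp only [mul_assoc, transpose_mul_inv_transpose, mul_one] at h2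
  rwa [← mul_assoc, ← mul_assoc, Units.inv_mul, one_mul, one_mul] at h2

theorem mem_soPoints_iff_conj
    (hP : (P : Matrix Idx Idx K) * gram K * (P : Matrix Idx Idx K)ᵀ = splitGram K)
    (g : GL Idx K) : g ∈ soPoints K ↔
      ((P * g * P⁻¹ : GL Idx K) : Matrix Idx Idx K) * splitGram K *
        ((P * g * P⁻¹ : GL Idx K) : Matrix Idx Idx K)ᵀ = splitGram K ∧
      ((P * g * P⁻¹ : GL Idx K) : Matrix Idx Idx K).det = 1 := by
  have h1 : ((P * g * P⁻¹ : GL Idx K) : Matrix Idx Idx K) * splitGram K *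
      ((P * g * P⁻¹ : GL Idx K) : Matrix Idx Idx K)ᵀ =
      P * ((g : Matrix Idx Idx K) * gram K * (g : Matrix Idx Idx K)ᵀ) *
        (P : Matrix Idx Idx K)ᵀ := by
    rw [Units.val_mul, Units.val_mul, conj_form hP]
    simp only [Matrix.transpose_mul, mul_assoc]
    rw [← mul_assoc (P : Matrix Idx Idx K)ᵀ, transpose_mul_inv_transpose, one_mul]
  have h2 : ((P * g * P⁻¹ : GL Idx K) : Matrix Idx Idx K).det = (g : Matrix Idx Idx K).det := by
    rw [Units.val_mul, Units.val_mul, Matrix.det_mul, Matrix.det_mul, mul_right_comm,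
      ← Matrix.det_mul, Units.mul_inv, Matrix.det_one, one_mul]
  rw [h1, h2, ← hP]
  exact and_congr_left fun _ => ⟨fun h => by rw [h], conj_cancel⟩

theorem comm_iff_conj {C D X : Matrix Idx Idx K} (hC : (P : Matrix Idx Idx K) * C = D * P) :
    X * C = C * X ↔ (P * X * (P⁻¹ : GL Idx K) : Matrix Idx Idx K) * D =
      D * (P * X * (P⁻¹ : GL Idx K) : Matrix Idx Idx K) := by
  have hD : D = P * C * (P⁻¹ : GL Idx K) := by rw [hC, mul_assoc, Units.mul_inv, mul_one]
  have h1 : (P * X * (P⁻¹ : GL Idx K) : Matrix Idx Idx K) * D =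
      P * (X * C) * (P⁻¹ : GL Idx K) := by
    rw [hD]; simp only [mul_assoc]
    rw [← mul_assoc ((P⁻¹ : GL Idx K) : Matrix Idx Idx K), Units.inv_mul, one_mul]
  have h2 : D * (P * X * (P⁻¹ : GL Idx K) : Matrix Idx Idx K) =
      P * (C * X) * (P⁻¹ : GL Idx K) := by
    rw [hD]; simp only [mul_assoc]
    rw [← mul_assoc ((P⁻¹ : GL Idx K) : Matrix Idx Idx K), Units.inv_mul, one_mul]
  rw [h1, h2]
  refine ⟨fun h => by rw [h], fun h => ?_⟩
  have h3 := congrArg (fun M => ((P⁻¹ : GL Idx K) : Matrix Idx Idx K) * M * P) h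
  simpa [mul_assoc] using h3

theorem mem_centPoints_iff_conj {C D : Matrix Idx Idx K}
    (hC : (P : Matrix Idx Idx K) * C = D * P) (g : GL Idx K) :
    g ∈ centPoints C ↔ g ∈ soPoints K ∧
      ((P * g * P⁻¹ : GL Idx K) : Matrix Idx Idx K) * D =
        D * ((P * g * P⁻¹ : GL Idx K) : Matrix Idx Idx K) := by
  rw [mem_centPoints, comm_iff_conj hC]
  rfl

theorem lie_form_conj
    (hP : (P : Matrix Idx Idx K) * gram K * (P : Matrix Idx Idx K)ᵀ = splitGram K)
    (X : Matrix Idx Idx K) : X * gram K + gram K * Xᵀ = 0 ↔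
      ∀ i j, (P * X * (P⁻¹ : GL Idx K) : Matrix Idx Idx K) i (bar j) =
        -(P * X * (P⁻¹ : GL Idx K) : Matrix Idx Idx K) j (bar i) := by
  set Y := (P * X * (P⁻¹ : GL Idx K) : Matrix Idx Idx K) with hY
  have hS : (splitGram K)ᵀ = splitGram K := by
    rw [← hP]; simp only [Matrix.transpose_mul, Matrix.transpose_transpose, gram_transpose,
      mul_assoc]
  have h1 : Y * splitGram K + (Y * splitGram K)ᵀ =
      P * (X * gram K + gram K * Xᵀ) * (P : Matrix Idx Idx K)ᵀ := by
    rw [hY, conj_form hP]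
    simp only [Matrix.transpose_mul, Matrix.transpose_transpose, gram_transpose, mul_add, add_mul,
      mul_assoc]
  have h2 : X * gram K + gram K * Xᵀ = 0 ↔ Y * splitGram K + (Y * splitGram K)ᵀ = 0 := by
    rw [h1]
    refine ⟨fun h => by rw [h, mul_zero, zero_mul], fun h => conj_cancel (P := P) ?_⟩
    rw [h, mul_zero, zero_mul]
  rw [h2, ← Matrix.ext_iff]
  refine forall₂_congr fun i j => ?_
  rw [Matrix.add_apply, Matrix.transpose_apply, mul_splitGram_apply, mul_splitGram_apply,
    Matrix.zero_apply, eq_neg_iff_add_eq_zero]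

end SplitForm

section RootVectors

variable {K : Type} [Field K]

/-- The element `E_{i,j} - E_{bar j, bar i}` of the Lie algebra of the split orthogonal group. -/
def splitRootVec (K : Type) [Field K] (i j : Idx) : Matrix Idx Idx K :=
  Matrix.single i j 1 - Matrix.single (bar j) (bar i) 1

theorem splitRootVec_apply_self {i j : Idx} (h : j ≠ bar i) : splitRootVec K i j i j = 1 := by
  rw [splitRootVec, Matrix.sub_apply, Matrix.single_apply_same, Matrix.single_apply, if_neg,
      sub_zero]
  rintro ⟨_, h2⟩
  exact h h2.symm

theorem splitRootVec_mul_self {i j : Idx} (hij : i ≠ j) :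
    splitRootVec K i j * splitRootVec K i j =
      -(if j = bar j then Matrix.single i (bar i) 1 else 0) -
        (if i = bar i then Matrix.single (bar j) j 1 else 0) := by
  rw [splitRootVec, sub_mul, mul_sub, mul_sub]
  have h1 : Matrix.single i j (1 : K) * Matrix.single i j 1 = 0 :=
    Matrix.single_mul_single_of_ne _ _ _ _ hij.symm _
  have h2 : Matrix.single (bar j) (bar i) (1 : K) * Matrix.single (bar j) (bar i) 1 = 0 :=
    Matrix.single_mul_single_of_ne _ _ _ _ (bar.injective.ne hij) _
  have h3 : Matrix.single i j (1 : K) * Matrix.single (bar j) (bar i) 1 =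
      if j = bar j then Matrix.single i (bar i) 1 else 0 := by
    split_ifs with h
    · rw [← h, Matrix.single_mul_single_same, mul_one]
    · exact Matrix.single_mul_single_of_ne _ _ _ _ h _
  have h4 : Matrix.single (bar j) (bar i) (1 : K) * Matrix.single i j 1 =
      if i = bar i then Matrix.single (bar j) j 1 else 0 := by
    split_ifs with h
    · rw [← h, Matrix.single_mul_single_same, mul_one]
    · exact Matrix.single_mul_single_of_ne _ _ _ _ (Ne.symm h) _
  rw [h1, h2, h3, h4]
  abel

theorem splitRootVec_cube {i j : Idx} (hij : i ≠ j) (hj : j ≠ bar i) :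
    splitRootVec K i j * splitRootVec K i j * splitRootVec K i j = 0 := by
  rw [splitRootVec_mul_self hij, splitRootVec]
  have hj' : bar j ≠ i := fun h => hj (by rw [← h, bar_bar])
  have hji : bar j ≠ bar i := bar.injective.ne hij.symm
  have a1 : ∀ a b : Idx, Matrix.single a (bar i) (1 : K) * Matrix.single (bar j) b 1 = 0 :=
    fun a b => Matrix.single_mul_single_of_ne _ _ _ _ hji.symm _
  have a2 : ∀ a b : Idx, Matrix.single a j (1 : K) * Matrix.single i b 1 = 0 :=
    fun a b => Matrix.single_mul_single_of_ne _ _ _ _ hij.symm _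
  have a3 : i ≠ bar i → ∀ a b : Idx, Matrix.single a (bar i) (1 : K) * Matrix.single i b 1 = 0 :=
    fun h a b => Matrix.single_mul_single_of_ne _ _ _ _ h.symm _
  have a4 : j ≠ bar j → ∀ a b : Idx, Matrix.single a j (1 : K) * Matrix.single (bar j) b 1 = 0 :=
    fun h a b => Matrix.single_mul_single_of_ne _ _ _ _ h _
  by_cases h1 : j = bar j <;> by_cases h2 : i = bar i
  · exfalso
    have : ∀ a b : Idx, a = bar a → b = bar b → a = b := by decide
    exact hij (this _ _ h2 h1)
  · simp only [if_pos h1, if_neg h2, sub_zero, neg_mul, mul_sub, a1, a3 h2]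
    simp
  · simp only [if_neg h1, if_pos h2, neg_zero, zero_sub, neg_mul, mul_sub, a2, a4 h1]
  · simp [h1, h2]

variable (P : GL Idx K)

/-- The root vectors of `SO(Q)` for a matrix `P` that splits `Q`. -/
def rootVec (i j : Idx) : Matrix Idx Idx K :=
  (P⁻¹ : GL Idx K) * splitRootVec K i j * P

theorem conj_rootVec (i j : Idx) :
    (P * rootVec P i j * (P⁻¹ : GL Idx K) : Matrix Idx Idx K) = splitRootVec K i j := by
  simp [rootVec, mul_assoc]

theorem rootVec_cube {i j : Idx} (hij : i ≠ j) (hj : j ≠ bar i) :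
    rootVec P i j * rootVec P i j * rootVec P i j = 0 := by
  have : rootVec P i j * rootVec P i j * rootVec P i j = (P⁻¹ : GL Idx K) *
      (splitRootVec K i j * splitRootVec K i j * splitRootVec K i j) * P := by
    simp only [rootVec, mul_assoc]
    rw [← mul_assoc (P : Matrix Idx Idx K), Units.mul_inv, one_mul,
      ← mul_assoc (P : Matrix Idx Idx K), Units.mul_inv, one_mul]
  rw [this, splitRootVec_cube hij hj, mul_zero, zero_mul]

variable {P}

theorem rootVec_form
    (hP : (P : Matrix Idx Idx K) * gram K * (P : Matrix Idx Idx K)ᵀ = splitGram K) (i j : Idx) :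
    rootVec P i j * gram K + gram K * (rootVec P i j)ᵀ = 0 := by
  rw [lie_form_conj hP, conj_rootVec]
  intro a b
  simp only [splitRootVec, Matrix.sub_apply, Matrix.single_apply]
  have h1 : (bar j = a ∧ bar i = bar b) ↔ (i = b ∧ j = bar a) := by
    rw [bar.injective.eq_iff, and_comm, eq_comm (a := bar j), eq_bar_iff]
  have h2 : (bar j = b ∧ bar i = bar a) ↔ (i = a ∧ j = bar b) := by
    rw [bar.injective.eq_iff, and_comm, eq_comm (a := bar j), eq_bar_iff]
  simp only [h1, h2]
  ring

theorem rootVec_comm {C : Matrix Idx Idx K} {c : Idx → K}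
    (hC : (P : Matrix Idx Idx K) * C = Matrix.diagonal c * P) (hc : ∀ i, c (bar i) = -c i)
    {i j : Idx} (hij : c i = c j) : rootVec P i j * C = C * rootVec P i j := by
  rw [comm_iff_conj hC, conj_rootVec]
  ext a b
  rw [Matrix.mul_diagonal, Matrix.diagonal_mul]
  simp only [splitRootVec, Matrix.sub_apply, Matrix.single_apply]
  by_cases h1 : i = a ∧ j = b <;> by_cases h2 : bar j = a ∧ bar i = b
  · rw [← h1.1, ← h1.2, hij]; ring
  · rw [← h1.1, ← h1.2, hij]; ring
  · rw [← h2.1, ← h2.2, hc, hc, hij]; ring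
  · rw [if_neg h1, if_neg h2]; ring

end RootVectors

end SmallSubgroups
end

noncomputable section
namespace SmallSubgroups

/-! ### The split maximal torus -/

section SplitTorus

theorem forall_idx {p : Idx → Prop} : (∀ i, p i) ↔
    p (Sum.inl 0) ∧ p (Sum.inl 1) ∧ p (Sum.inr 0) ∧ p (Sum.inr 1) ∧ p (Sum.inr 2) := by
  simp [Sum.forall, Fin.forall_fin_succ, and_assoc]

theorem sum_idx {M : Type*} [AddCommMonoid M] (f : Idx → M) : ∑ i, f i =
    f (Sum.inl 0) + f (Sum.inl 1) + f (Sum.inr 0) + f (Sum.inr 1) + f (Sum.inr 2) := by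
  simp [Fintype.sum_sum_type, Fin.sum_univ_succ, add_assoc]

theorem prod_idx {M : Type*} [CommMonoid M] (f : Idx → M) : ∏ i, f i =
    f (Sum.inl 0) * f (Sum.inl 1) * f (Sum.inr 0) * f (Sum.inr 1) * f (Sum.inr 2) := by
  simp [Fintype.prod_sum_type, Fin.prod_univ_succ, mul_assoc]

theorem bar_inl_zero : bar (Sum.inl 0) = Sum.inl 1 := by decide
theorem bar_inl_one : bar (Sum.inl 1) = Sum.inl 0 := by decide
theorem bar_inr_zero : bar (Sum.inr 0) = Sum.inr 1 := by decide
theorem bar_inr_one : bar (Sum.inr 1) = Sum.inr 0 := by decide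
theorem bar_inr_two : bar (Sum.inr 2) = Sum.inr 2 := by decide

variable {K : Type} [Field K]

/-- The diagonal entries `(a, a⁻¹, b, b⁻¹, 1)`. -/
def torusDiag : Kˣ × Kˣ →* (Idx → Kˣ) where
  toFun z := Sum.elim ![z.1, z.1⁻¹] ![z.2, z.2⁻¹, 1]
  map_one' := by
    funext i
    revert i
    rw [forall_idx]
    simp
  map_mul' z w := by
    funext i
    revert i
    rw [forall_idx]
    simp [mul_comm]

theorem torusDiag_bar (z : Kˣ × Kˣ) (i : Idx) : torusDiag z (bar i) = (torusDiag z i)⁻¹ := by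
  revert i
  rw [forall_idx]
  simp [torusDiag, bar_inl_zero, bar_inl_one, bar_inr_zero, bar_inr_one, bar_inr_two]

/-- The invertible diagonal matrix with the given diagonal entries. -/
def diagGL : (Idx → Kˣ) →* GL Idx K :=
  (Units.map (Matrix.diagonalRingHom Idx K).toMonoidHom).comp MulEquiv.piUnits.symm.toMonoidHom

theorem coe_diagGL (d : Idx → Kˣ) :
    (diagGL d : Matrix Idx Idx K) = Matrix.diagonal fun i => (d i : K) := rfl

/-- The element `P⁻¹ diag(a, a⁻¹, b, b⁻¹, 1) P` of the split torus. -/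
def torusElt (P : GL Idx K) : Kˣ × Kˣ →* GL Idx K :=
  (MulAut.conj P⁻¹).toMonoidHom.comp (diagGL.comp torusDiag)

theorem torusElt_apply (P : GL Idx K) (z : Kˣ × Kˣ) :
    torusElt P z = P⁻¹ * diagGL (torusDiag z) * P := by
  simp [torusElt]

theorem conj_torusElt (P : GL Idx K) (z : Kˣ × Kˣ) :
    P * torusElt P z * P⁻¹ = diagGL (torusDiag z) := by
  simp [torusElt_apply, mul_assoc]

/-- The diagonal entries `(1, -1, 2, -2, 0)`, distinct and with `c (bar i) = -c i`. -/
def regularDiag (K : Type) [Field K] : Idx → K := Sum.elim ![1, -1] ![2, -2, 0]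

variable [CharZero K]

theorem regularDiag_injective : Function.Injective (regularDiag K) := by
  have h : regularDiag K = (fun m : ℤ => (m : K)) ∘ Sum.elim ![1, -1] ![2, -2, 0] := by
    funext i; revert i; rw [forall_idx]; simp [regularDiag]
  rw [h]
  exact Int.cast_injective.comp (by decide)

theorem torusDiag_two_three_injective :
    Function.Injective fun i : Idx =>
      ((torusDiag (Units.mk0 (2 : K) two_ne_zero, Units.mk0 (3 : K) three_ne_zero) i : Kˣ) : K) := by
  have h : (fun i : Idx =>
      ((torusDiag (Units.mk0 (2 : K) two_ne_zero, Units.mk0 (3 : K) three_ne_zero) i : Kˣ) : K)) =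
      (fun m : ℚ => (m : K)) ∘ Sum.elim ![2, 2⁻¹] ![3, 3⁻¹, 1] := by
    funext i; revert i; rw [forall_idx]; simp [torusDiag]
  rw [h]
  refine Rat.cast_injective.comp ?_
  intro i j
  revert i j
  simp [Fin.forall_fin_succ]
  norm_num

/-- The diagonal characters of the split torus are linearly independent (Dedekind). -/
theorem eq_zero_of_sum_torusDiag {F : Idx → K}
    (h : ∀ z : Kˣ × Kˣ, ∑ i, (torusDiag z i : K) * F i = 0) : F = 0 := by
  let χ : Idx → (Kˣ × Kˣ →* K) := fun i =>
    (Units.coeHom K).comp ((Pi.evalMonoidHom (fun _ : Idx => Kˣ) i).comp torusDiag)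
  have hχ : Function.Injective χ := by
    intro i j hij
    exact torusDiag_two_three_injective (K := K) (DFunLike.congr_fun hij _)
  have hli := (linearIndependent_monoidHom (Kˣ × Kˣ) K).comp χ hχ
  rw [Fintype.linearIndependent_iff] at hli
  funext i
  refine hli F ?_ i
  funext z
  simpa [χ, mul_comm] using h z

/-- A matrix commuting with a diagonal matrix with distinct entries is diagonal. -/
theorem isDiag_of_comm {c : Idx → K} (hc : Function.Injective c) {m : Matrix Idx Idx K}
    (h : m * Matrix.diagonal c = Matrix.diagonal c * m) : m.IsDiag := by
  intro i j hij
  have := congrFun (congrFun h i) j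
  rw [Matrix.mul_diagonal, Matrix.diagonal_mul, mul_comm, ← sub_eq_zero, ← sub_mul] at this
  exact (mul_eq_zero.1 this).resolve_left (sub_ne_zero.2 (hc.ne hij.symm))

variable {P : GL Idx K}

theorem torusElt_mem_soPoints
    (hP : (P : Matrix Idx Idx K) * gram K * (P : Matrix Idx Idx K)ᵀ = splitGram K)
    (z : Kˣ × Kˣ) : torusElt P z ∈ soPoints K := by
  rw [mem_soPoints_iff_conj hP, conj_torusElt, coe_diagGL]
  constructor
  · ext i j
    rw [Matrix.diagonal_transpose, Matrix.mul_diagonal, Matrix.diagonal_mul, splitGram]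
    split_ifs with h
    · subst h; simp [torusDiag_bar]
    · simp
  · rw [Matrix.det_diagonal, prod_idx]
    simp [torusDiag]

theorem torusElt_comm {C : Matrix Idx Idx K} {c : Idx → K}
    (hC : (P : Matrix Idx Idx K) * C = Matrix.diagonal c * P) (z : Kˣ × Kˣ) :
    (torusElt P z : Matrix Idx Idx K) * C = C * torusElt P z := by
  rw [comm_iff_conj hC, ← Units.val_mul, ← Units.val_mul, conj_torusElt, coe_diagGL,
    Matrix.diagonal_mul_diagonal, Matrix.diagonal_mul_diagonal]
  simp only [mul_comm]

theorem exists_torusElt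
    (hP : (P : Matrix Idx Idx K) * gram K * (P : Matrix Idx Idx K)ᵀ = splitGram K)
    {g : GL Idx K} (hg : g ∈ soPoints K)
    (hd : ((P * g * P⁻¹ : GL Idx K) : Matrix Idx Idx K).IsDiag) : ∃ z, g = torusElt P z := by
  rw [mem_soPoints_iff_conj hP] at hg
  obtain ⟨h1, h2⟩ := hg
  rw [← (Matrix.isDiag_iff_diagonal_diag _).1 hd] at h1 h2
  set d := ((P * g * P⁻¹ : GL Idx K) : Matrix Idx Idx K).diag with hdef
  have h3 : ∀ i, d i * d (bar i) = 1 := by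
    intro i
    have := congrFun (congrFun h1 i) (bar i)
    rw [Matrix.diagonal_transpose, Matrix.mul_diagonal, Matrix.diagonal_mul] at this
    simpa [splitGram] using this
  rw [Matrix.det_diagonal, prod_idx] at h2
  have e0 := h3 (Sum.inl 0)
  have e1 := h3 (Sum.inr 0)
  rw [bar_inl_zero] at e0
  rw [bar_inr_zero] at e1
  rw [e0, one_mul, e1, one_mul] at h2
  refine ⟨(⟨d (Sum.inl 0), d (Sum.inl 1), e0, by rw [mul_comm, e0]⟩,
    ⟨d (Sum.inr 0), d (Sum.inr 1), e1, by rw [mul_comm, e1]⟩), ?_⟩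
  have h4 : P * g * P⁻¹ = diagGL (torusDiag (⟨d (Sum.inl 0), d (Sum.inl 1), e0,
      by rw [mul_comm, e0]⟩,
    ⟨d (Sum.inr 0), d (Sum.inr 1), e1, by rw [mul_comm, e1]⟩)) := by
    ext1
    rw [coe_diagGL, ← (Matrix.isDiag_iff_diagonal_diag _).1 hd, ← hdef]
    congr 1
    funext i
    revert i
    rw [forall_idx]
    exact ⟨rfl, rfl, rfl, rfl, h2⟩
  rw [torusElt_apply, ← h4]
  group

/-- The element of the Lie algebra whose centralizer is the torus diagonalized by `P`. -/
def regularElt (P : GL Idx K) : Matrix Idx Idx K :=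
  (P⁻¹ : GL Idx K) * Matrix.diagonal (regularDiag K) * P

theorem mul_regularElt (P : GL Idx K) :
    (P : Matrix Idx Idx K) * regularElt P = Matrix.diagonal (regularDiag K) * P := by
  rw [regularElt, ← mul_assoc, ← mul_assoc, Units.mul_inv, one_mul]

theorem isDiag_of_mem_centPoints_regularElt {g : GL Idx K} (hg : g ∈ centPoints (regularElt P)) :
    ((P * g * P⁻¹ : GL Idx K) : Matrix Idx Idx K).IsDiag :=
  isDiag_of_comm regularDiag_injective ((mem_centPoints_iff_conj (mul_regularElt P) g).1 hg).2

theorem mem_centPoints_regularElt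
    (hP : (P : Matrix Idx Idx K) * gram K * (P : Matrix Idx Idx K)ᵀ = splitGram K)
    {g : GL Idx K} : g ∈ centPoints (regularElt P) ↔ ∃ z, g = torusElt P z := by
  constructor
  · exact fun hg => exists_torusElt hP hg.1 (isDiag_of_mem_centPoints_regularElt hg)
  · rintro ⟨z, rfl⟩
    exact ⟨torusElt_mem_soPoints hP z, torusElt_comm (mul_regularElt P) z⟩

variable [IsAlgClosed K]

/-- The maximal torus of `SO(Q)` diagonalized by `P`. -/
def splitTorus (P : GL Idx K)
    (hP : (P : Matrix Idx Idx K) * gram K * (P : Matrix Idx Idx K)ᵀ = splitGram K) :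
    AlgTorus Idx K where
  carrier := centPoints (regularElt P)
  closed := isZariskiClosed_centPoints _
  connected := by
    refine isZariskiConnected_of_forall_pow (isZariskiClosed_centPoints _) ?_
    intro g hg n hn
    obtain ⟨⟨a, b⟩, rfl⟩ := (mem_centPoints_regularElt hP).1 hg
    have hroot : ∀ a : Kˣ, ∃ x : Kˣ, x ^ n = a := by
      intro a
      obtain ⟨x, hx⟩ := IsAlgClosed.exists_pow_nat_eq (a : K) (Nat.pos_of_ne_zero hn)
      have hx0 : x ≠ 0 := by
        rintro rfl
        rw [zero_pow hn] at hx
        exact a.ne_zero hx.symm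
      exact ⟨Units.mk0 x hx0, Units.ext (by simpa using hx)⟩
    obtain ⟨x, rfl⟩ := hroot a
    obtain ⟨y, rfl⟩ := hroot b
    exact ⟨torusElt P (x, y), (mem_centPoints_regularElt hP).2 ⟨_, rfl⟩, by rw [← map_pow]; rfl⟩
  diagonalizable := ⟨P, fun _ ht => isDiag_of_mem_centPoints_regularElt ht⟩

variable (hP : (P : Matrix Idx Idx K) * gram K * (P : Matrix Idx Idx K)ᵀ = splitGram K)

theorem mem_splitTorus {g : GL Idx K} :
    g ∈ (splitTorus P hP).carrier ↔ ∃ z, g = torusElt P z := mem_centPoints_regularElt hP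

theorem splitTorus_isDiag : ∀ t ∈ (splitTorus P hP).carrier,
    ((P * t * P⁻¹ : GL Idx K) : Matrix Idx Idx K).IsDiag :=
  fun _ ht => isDiag_of_mem_centPoints_regularElt ht

theorem splitTorus_le {C : Matrix Idx Idx K} {c : Idx → K}
    (hC : (P : Matrix Idx Idx K) * C = Matrix.diagonal c * P) :
    (splitTorus P hP).carrier ≤ centPoints C := by
  intro t ht
  obtain ⟨z, rfl⟩ := (mem_splitTorus hP).1 ht
  exact ⟨torusElt_mem_soPoints hP z, torusElt_comm hC z⟩

/-- The split torus is maximal in the centralizer of each matrix that `P` diagonalizes, as it is its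
own centralizer in `SO(Q)`. -/
theorem isMaximalTorus_splitTorus {C : Matrix Idx Idx K} {c : Idx → K}
    (hC : (P : Matrix Idx Idx K) * C = Matrix.diagonal c * P) :
    IsMaximalTorus (splitTorus P hP) (centPoints C) := by
  refine ⟨splitTorus_le hP hC, fun T' hT' hle => le_antisymm (fun g hg => ?_) hle⟩
  refine (mem_splitTorus hP).2 (exists_torusElt hP (centPoints_le _ (hT' hg)) ?_)
  -- `g` commutes with an element of the torus that has distinct eigenvalues
  set t := torusElt P (Units.mk0 (2 : K) two_ne_zero, Units.mk0 (3 : K) three_ne_zero) with ht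
  have htT : t ∈ T'.carrier := hle ((mem_splitTorus hP).2 ⟨_, rfl⟩)
  have hcomm : g * t = t * g := congrArg Subtype.val (T'.comm ⟨g, hg⟩ ⟨t, htT⟩)
  refine isDiag_of_comm (torusDiag_two_three_injective (K := K)) ?_
  rw [← coe_diagGL, ← conj_torusElt P, ← ht, ← Units.val_mul, ← Units.val_mul]
  congr 1
  calc P * g * P⁻¹ * (P * t * P⁻¹) = P * (g * t) * P⁻¹ := by group
    _ = P * t * P⁻¹ * (P * g * P⁻¹) := by rw [hcomm]; group

end SplitTorus

end SmallSubgroups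
end

noncomputable section
set_option linter.unusedSectionVars false
namespace SmallSubgroups

/-! ### Reductivity of centralizers -/

section Reductive

variable {K : Type} [Field K] [CharZero K] {P : GL Idx K}

/-- Averaging over the torus on both sides: if the trace form against `N` vanishes on the
centralizer of `C`, so do the individual terms of `tr ((P h P⁻¹) (P N P⁻¹))`. -/
theorem entry_mul_entry_eq_zero
    (hP : (P : Matrix Idx Idx K) * gram K * (P : Matrix Idx Idx K)ᵀ = splitGram K)
    {C N : Matrix Idx Idx K} {c : Idx → K}
    (hC : (P : Matrix Idx Idx K) * C = Matrix.diagonal c * P)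
    (hN : ∀ h ∈ centPoints C, ((h : Matrix Idx Idx K) * N).trace = 0) {x : GL Idx K}
    (hx : x ∈ centPoints C) (i j : Idx) :
    ((P * x * P⁻¹ : GL Idx K) : Matrix Idx Idx K) i j *
      (P * N * (P⁻¹ : GL Idx K) : Matrix Idx Idx K) j i = 0 := by
  set m := ((P * x * P⁻¹ : GL Idx K) : Matrix Idx Idx K) with hm
  set N' := (P * N * (P⁻¹ : GL Idx K) : Matrix Idx Idx K) with hN'
  have ht : ∀ z, torusElt P z ∈ centPoints C := fun z =>
    ⟨torusElt_mem_soPoints hP z, torusElt_comm hC z⟩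
  have h1 : ∀ z w : Kˣ × Kˣ, ∑ i, (torusDiag z i : K) *
      ∑ j, (torusDiag w j : K) * (m i j * N' j i) = 0 := by
    intro z w
    have h2 := hN _ (mul_mem (mul_mem (ht z) hx) (ht w))
    have h3 : (((torusElt P z * x * torusElt P w : GL Idx K) : Matrix Idx Idx K) * N).trace =
        (Matrix.diagonal (fun i => (torusDiag z i : K)) * m *
          Matrix.diagonal (fun i => (torusDiag w i : K)) * N').trace := by
      have e1 : Matrix.diagonal (fun i => (torusDiag z i : K)) * m *
          Matrix.diagonal (fun i => (torusDiag w i : K)) * N' =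
          P * (((torusElt P z * x * torusElt P w : GL Idx K) : Matrix Idx Idx K) * N) *
            (P⁻¹ : GL Idx K) := by
        rw [← coe_diagGL, ← coe_diagGL, ← conj_torusElt P, ← conj_torusElt P, hm, hN']
        simp [mul_assoc]
      rw [e1, Matrix.trace_units_conj]
    rw [h3] at h2
    rw [← h2, Matrix.trace]
    refine Finset.sum_congr rfl fun i _ => ?_
    rw [Matrix.diag_apply, Matrix.mul_apply, Finset.mul_sum]
    refine Finset.sum_congr rfl fun j _ => ?_
    rw [Matrix.mul_diagonal, Matrix.diagonal_mul]
    ring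
  have h4 : ∀ w : Kˣ × Kˣ, (fun i => ∑ j, (torusDiag w j : K) * (m i j * N' j i)) = 0 :=
    fun w => eq_zero_of_sum_torusDiag fun z => h1 z w
  have h5 := eq_zero_of_sum_torusDiag (F := fun j => m i j * N' j i) fun w =>
    congrFun (h4 w) i
  exact congrFun h5 j

theorem conj_nilExpGL_rootVec {i j : Idx} (hij : i ≠ j) (hj : j ≠ bar i) :
    ((P * nilExpGL (rootVec P i j) (rootVec_cube P hij hj) * P⁻¹ : GL Idx K) : Matrix Idx Idx K) =
      nilExp (splitRootVec K i j) := by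
  have h1 : splitRootVec K i j * splitRootVec K i j =
      P * (rootVec P i j * rootVec P i j) * (P⁻¹ : GL Idx K) := by
    rw [← conj_rootVec P]
    simp only [mul_assoc]
    rw [← mul_assoc ((P⁻¹ : GL Idx K) : Matrix Idx Idx K), Units.inv_mul, one_mul]
  change (P : Matrix Idx Idx K) * nilExp (rootVec P i j) * (P⁻¹ : GL Idx K) = _
  simp only [nilExp, h1, mul_add, add_mul, mul_one, Units.mul_inv, conj_rootVec, mul_smul_comm,
    smul_mul_assoc]

/-- The centralizer in `SO(Q)` of a diagonalizable element of its Lie algebra is reductive. For `u`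
in a normal unipotent subgroup and `N = u - 1`, each product of an entry `(i, j)` of a group element
and the entry `(j, i)` of `N` vanishes, in the coordinates given by `P`. The entries `(j, i)` of `N`
with `c i ≠ c j` are zero as `u` commutes with `C`, and for the others some element of the group has
a nonzero entry at `(i, j)`: the identity, or the exponential of a root vector. -/
theorem isReductive_centPoints
    (hP : (P : Matrix Idx Idx K) * gram K * (P : Matrix Idx Idx K)ᵀ = splitGram K)
    {C : Matrix Idx Idx K} {c : Idx → K}
    (hC : (P : Matrix Idx Idx K) * C = Matrix.diagonal c * P) (hc : ∀ i, c (bar i) = -c i) :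
    IsReductive (centPoints C) := by
  refine ⟨isZariskiClosed_centPoints C, fun U hUH _ _ hnorm hU => ?_⟩
  rw [eq_bot_iff]
  intro u hu
  have htr : ∀ h ∈ centPoints C, ((h : Matrix Idx Idx K) * ((u : Matrix Idx Idx K) - 1)).trace =
      0 :=
    fun h hh => hU.trace_mul_sub_one_eq_zero (hnorm h hh) hu
  have hentry := fun {x : GL Idx K} (hx : x ∈ centPoints C) =>
    entry_mul_entry_eq_zero hP hC htr hx
  set N' := (P * ((u : Matrix Idx Idx K) - 1) * (P⁻¹ : GL Idx K) : Matrix Idx Idx K) with hN'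
  have hNc : N' * Matrix.diagonal c = Matrix.diagonal c * N' := by
    rw [hN', ← comm_iff_conj hC, sub_mul, mul_sub, one_mul, mul_one, (hUH hu).2]
  have hNc' : ∀ i j, c i ≠ c j → N' j i = 0 := by
    intro i j hij
    have := congrFun (congrFun hNc j) i
    rw [Matrix.mul_diagonal, Matrix.diagonal_mul, mul_comm, ← sub_eq_zero, ← sub_mul] at this
    exact (mul_eq_zero.1 this).resolve_left (sub_ne_zero.2 hij)
  have hroot : ∀ i j, i ≠ j → j ≠ bar i → c i = c j → ∀ a b,
      nilExp (splitRootVec K i j) a b * N' b a = 0 := by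
    intro i j hij hj hcij a b
    rw [← conj_nilExpGL_rootVec (P := P) hij hj]
    exact hentry (nilExpGL_mem_centPoints _ (rootVec_form hP i j) (rootVec_comm hC hc hcij)) a b
  have hzero : N' = 0 := by
    ext j i
    rw [Matrix.zero_apply]
    by_cases hcij : c i = c j
    swap
    · exact hNc' i j hcij
    by_cases hij : i = j
    · subst hij
      simpa using hentry (one_mem _) i i
    by_cases hj : j = bar i
    · subst hj
      -- the entry `(i, bar i)` is reached through the square of the root vector `(i, inr 2)`
      have h2 : Sum.inr 2 ≠ bar i := by
        intro h
        rw [eq_bar_iff, bar_inr_two] at h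
        rw [h, bar_inr_two] at hij
        exact hij rfl
      have hi2 : i ≠ Sum.inr 2 := by
        intro h
        rw [h, bar_inr_two] at hij
        exact hij rfl
      have hc2 : c i = c (Sum.inr 2) := by
        have h3 := hc (Sum.inr 2)
        rw [bar_inr_two] at h3
        rw [hc] at hcij
        rw [self_eq_neg.1 h3, self_eq_neg.1 hcij]
      have h4 := hroot i (Sum.inr 2) hi2 h2 hc2 i (bar i)
      have h5 : nilExp (splitRootVec K i (Sum.inr 2)) i (bar i) = -(1 / 2) := by
        rw [nilExp, splitRootVec_mul_self hi2, if_pos bar_inr_two.symm, if_neg hij]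
        simp [splitRootVec, Matrix.one_apply_ne hij, h2, hi2.symm, bar_inr_two]
      rw [h5] at h4
      simpa using h4
    · have h4 := hroot i j hij hj hcij i j
      have h5 : nilExp (splitRootVec K i j) i j = 1 := by
        have h6 : bar j ≠ i := fun h => hj (by rw [← h, bar_bar])
        rw [nilExp, splitRootVec_mul_self hij, Matrix.add_apply, Matrix.add_apply,
          splitRootVec_apply_self hj, Matrix.one_apply_ne hij]
        have h7 : (if j = bar j then Matrix.single i (bar i) (1 : K) else 0) i j = 0 := by
          split_ifs <;> simp [Ne.symm hj]
        have h8 : (if i = bar i then Matrix.single (bar j) j (1 : K) else 0) i j = 0 := by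
          split_ifs <;> simp [h6]
        rw [Matrix.smul_apply, Matrix.sub_apply, Matrix.neg_apply, h7, h8]
        simp
      rw [h5, one_mul] at h4
      exact h4
  have hu1 : (u : Matrix Idx Idx K) - 1 = 0 := by
    have := congrArg (fun M => ((P⁻¹ : GL Idx K) : Matrix Idx Idx K) * M * P) hzero
    rw [hN'] at this
    simpa [mul_assoc] using this
  exact Subgroup.mem_bot.2 (Units.ext (sub_eq_zero.1 hu1))

end Reductive

/-! ### Roots of centralizers -/

section Roots

variable {K : Type} [Field K] [CharZero K] [IsAlgClosed K] {P : GL Idx K}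
  (hP : (P : Matrix Idx Idx K) * gram K * (P : Matrix Idx Idx K)ᵀ = splitGram K)

/-- The diagonal characters of the split torus. -/
abbrev splitChar (i : Idx) : (splitTorus P hP).carrier →* Kˣ :=
  diagChar (splitTorus P hP) P (splitTorus_isDiag hP) i

/-- The weights of the split torus, in the order `e₁, -e₁, e₂, -e₂, 0`. -/
abbrev splitWeight (i : Idx) : Module.Dual ℝ (RealCochar (splitTorus P hP)) :=
  weight (splitTorus P hP) P (splitTorus_isDiag hP) i

theorem splitChar_torusElt (z : Kˣ × Kˣ) (h : torusElt P z ∈ (splitTorus P hP).carrier) (i : Idx) :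
    splitChar hP i ⟨torusElt P z, h⟩ = torusDiag z i := by
  ext
  rw [diagChar_apply, conj_torusElt, coe_diagGL, Matrix.diagonal_apply_eq]

theorem splitChar_bar (t : (splitTorus P hP).carrier) (i : Idx) :
    splitChar hP (bar i) t = (splitChar hP i t)⁻¹ := by
  obtain ⟨t, ht⟩ := t
  obtain ⟨z, rfl⟩ := (mem_splitTorus hP).1 ht
  rw [splitChar_torusElt, splitChar_torusElt, torusDiag_bar]

theorem splitWeight_bar (i : Idx) : splitWeight hP (bar i) = -splitWeight hP i :=
  weight_eq_neg _ fun t => splitChar_bar hP t i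

theorem splitWeight_inl_one : splitWeight hP (Sum.inl 1) = -splitWeight hP (Sum.inl 0) := by
  rw [← splitWeight_bar, bar_inl_zero]

theorem splitWeight_inr_one : splitWeight hP (Sum.inr 1) = -splitWeight hP (Sum.inr 0) := by
  rw [← splitWeight_bar, bar_inr_zero]

theorem splitWeight_inr_two : splitWeight hP (Sum.inr 2) = 0 := by
  have h := splitWeight_bar hP (Sum.inr 2)
  rw [bar_inr_two] at h
  exact LinearMap.ext fun X => self_eq_neg.1 (LinearMap.congr_fun h X)

/-- The equation `t X t⁻¹ = a X`, for `t` in the split torus, read off entrywise in the coordinates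
given by `P`. -/
theorem conj_eigen_iff (t : (splitTorus P hP).carrier) (X : Matrix Idx Idx K) (a : K) :
    ((t : GL Idx K) : Matrix Idx Idx K) * X * (((t : GL Idx K)⁻¹ : GL Idx K) : Matrix Idx Idx K) =
      a • X
      ↔ ∀ i j, (splitChar hP i t : K) * (P * X * (P⁻¹ : GL Idx K) : Matrix Idx Idx K) i j =
        a * (P * X * (P⁻¹ : GL Idx K) : Matrix Idx Idx K) i j * splitChar hP j t := by
  set Y := (P * X * (P⁻¹ : GL Idx K) : Matrix Idx Idx K) with hY
  set d := ((P * t * P⁻¹ : GL Idx K) : Matrix Idx Idx K) with hd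
  have h1 : ((t : GL Idx K) : Matrix Idx Idx K) * X * (((t : GL Idx K)⁻¹ : GL Idx K) :
      Matrix Idx Idx K) = a • X ↔ d * Y = (a • Y) * d := by
    have e1 : d * Y = P * ((t : GL Idx K) * X * ((t : GL Idx K)⁻¹ : GL Idx K)) *
        ((t : GL Idx K) * P⁻¹ : GL Idx K) := by
      simp [hd, hY, mul_assoc]
    have e2 : (a • Y) * d = P * (a • X) * ((t : GL Idx K) * P⁻¹ : GL Idx K) := by
      simp [hd, hY, mul_assoc]
    rw [e1, e2]
    refine ⟨fun h => by rw [h], fun h => ?_⟩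
    have h3 := congrArg (fun M => ((P⁻¹ : GL Idx K) : Matrix Idx Idx K) * M *
      (((t : GL Idx K) * P⁻¹ : GL Idx K)⁻¹ : GL Idx K)) h
    simpa [mul_assoc] using h3
  rw [h1, hd, conj_eq_diagonal (splitTorus_isDiag hP) t, ← Matrix.ext_iff]
  simp only [Matrix.diagonal_mul, Matrix.mul_diagonal, Matrix.smul_apply, smul_eq_mul]

/-- Each root of the centralizer of `C` is the difference of two weights with equal eigenvalue of
`C`. -/
theorem exists_of_mem_roots {C : Matrix Idx Idx K} {c : Idx → K}
    (hC : (P : Matrix Idx Idx K) * C = Matrix.diagonal c * P)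
    {α : Module.Dual ℝ (RealCochar (splitTorus P hP))}
    (hα : α ∈ roots (centPoints C) (splitTorus P hP)) :
    ∃ i j, j ≠ bar i ∧ c i = c j ∧ α = splitWeight hP i - splitWeight hP j := by
  obtain ⟨-, χ, hχ, X, hX, hX0, heig⟩ := hα
  obtain ⟨hform, hcomm⟩ := of_mem_lieAlg_centPoints hX
  rw [lie_form_conj hP] at hform
  rw [comm_iff_conj hC] at hcomm
  have heig' := fun t => (conj_eigen_iff hP t X _).1 (heig t)
  set Y := (P * X * (P⁻¹ : GL Idx K) : Matrix Idx Idx K) with hY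
  have hY0 : Y ≠ 0 := by
    intro h
    apply hX0
    have := congrArg (fun M => ((P⁻¹ : GL Idx K) : Matrix Idx Idx K) * M * P) h
    rw [hY] at this
    simpa [mul_assoc] using this
  obtain ⟨i, j, hij⟩ : ∃ i j, Y i j ≠ 0 := by
    by_contra! h
    exact hY0 (Matrix.ext h)
  refine ⟨i, j, ?_, ?_, ?_⟩
  -- the entries of `Y` at `(i, bar i)` vanish, by skew-symmetry for the split form
  · rintro rfl
    exact hij (self_eq_neg.1 (hform i i))
  · have := congrFun (congrFun hcomm i) j
    rw [Matrix.mul_diagonal, Matrix.diagonal_mul, mul_comm] at this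
    exact (mul_right_cancel₀ hij this).symm
  · refine hχ.unique ?_
    have : χ = splitChar hP i / splitChar hP j := by
      ext t
      rw [MonoidHom.div_apply, Units.val_div_eq_div_val, eq_div_iff (Units.ne_zero _)]
      apply mul_right_cancel₀ hij
      rw [heig' t i j]
      ring
    rw [this]
    exact isCharFunctional_weight_sub _ i j

theorem splitWeight_sub_mem_roots {C : Matrix Idx Idx K} {c : Idx → K}
    (hC : (P : Matrix Idx Idx K) * C = Matrix.diagonal c * P) (hc : ∀ i, c (bar i) = -c i)
    {i j : Idx} (hij : i ≠ j) (hj : j ≠ bar i) (hcij : c i = c j)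
    (h0 : splitWeight hP i - splitWeight hP j ≠ 0) :
    splitWeight hP i - splitWeight hP j ∈ roots (centPoints C) (splitTorus P hP) := by
  refine ⟨h0, splitChar hP i / splitChar hP j, isCharFunctional_weight_sub _ i j,
    rootVec P i j, mem_lieAlg_centPoints (rootVec_cube P hij hj) (rootVec_form hP i j)
      (rootVec_comm hC hc hcij), ?_, fun t => ?_⟩
  · intro h
    have h1 := splitRootVec_apply_self (K := K) hj
    rw [← conj_rootVec P, h] at h1
    simp at h1
  · rw [conj_eigen_iff, conj_rootVec]
    intro a b
    simp only [splitRootVec, Matrix.sub_apply, Matrix.single_apply, MonoidHom.div_apply]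
    have hi := (splitChar hP i t).ne_zero
    have hj := (splitChar hP j t).ne_zero
    by_cases h1 : i = a ∧ j = b <;> by_cases h2 : bar j = a ∧ bar i = b
    · rw [← h1.1, ← h1.2]; simp; field_simp
    · rw [← h1.1, ← h1.2]; simp; field_simp
    · rw [← h2.1, ← h2.2, splitChar_bar, splitChar_bar]; simp; field_simp
    · simp [h1, h2]

end Roots

end SmallSubgroups
end

noncomputable section
set_option linter.unusedSectionVars false
namespace SmallSubgroups

/-! ### Weyl groups -/

section Weyl

variable {ι : Type} [Fintype ι] [DecidableEq ι] {K : Type} [Field K] [CharZero K]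

theorem realConj_one {T : AlgTorus ι K} (h : ∀ s ∈ T.carrier, (1 : GL ι K) * s * 1⁻¹ ∈ T.carrier) :
    realConj (1 : GL ι K) h = LinearMap.id := by
  apply realCochar_hom_ext
  intro l
  rw [realConj, LinearMap.baseChange_tmul, LinearMap.id_apply]
  congr 1
  apply Additive.toMul.injective
  apply Subtype.ext; apply MonoidHom.ext; intro z; apply Subtype.ext
  change 1 * (l.toMul.1 z : GL ι K) * 1⁻¹ = l.toMul.1 z
  simp

theorem realConj_mul {T : AlgTorus ι K} {m n : GL ι K}
    (hm : ∀ s ∈ T.carrier, m * s * m⁻¹ ∈ T.carrier)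
    (hn : ∀ s ∈ T.carrier, n * s * n⁻¹ ∈ T.carrier)
    (hmn : ∀ s ∈ T.carrier, (m * n) * s * (m * n)⁻¹ ∈ T.carrier) :
    realConj (m * n) hmn = realConj m hm ∘ₗ realConj n hn := by
  apply realCochar_hom_ext
  intro l
  rw [LinearMap.comp_apply, realConj, realConj, realConj, LinearMap.baseChange_tmul,
    LinearMap.baseChange_tmul, LinearMap.baseChange_tmul]
  congr 1
  apply Additive.toMul.injective
  apply Subtype.ext; apply MonoidHom.ext; intro z; apply Subtype.ext
  change m * n * (l.toMul.1 z : GL ι K) * (m * n)⁻¹ = m * (n * (l.toMul.1 z : GL ι K) * n⁻¹) * m⁻¹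
  group

theorem realIncl_self {T : AlgTorus ι K} (h : T.carrier ≤ T.carrier) :
    realIncl h = LinearMap.id := realConj_one _

theorem id_mem_weylGroup (G : Subgroup (GL ι K)) (T : AlgTorus ι K) :
    LinearMap.id ∈ weylGroup G T :=
  ⟨1, one_mem _, by simp, (realConj_one _).symm⟩

theorem comp_mem_weylGroup {G : Subgroup (GL ι K)} {T : AlgTorus ι K}
    {v w : RealCochar T →ₗ[ℝ] RealCochar T} (hv : v ∈ weylGroup G T) (hw : w ∈ weylGroup G T) :
    v ∘ₗ w ∈ weylGroup G T := by
  obtain ⟨m, hm, hmT, rfl⟩ := hv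
  obtain ⟨n, hn, hnT, rfl⟩ := hw
  refine ⟨m * n, mul_mem hm hn, fun t => ?_, (realConj_mul _ _ _).symm⟩
  rw [hnT, hmT]
  have : m * (n * t * n⁻¹) * m⁻¹ = m * n * t * (m * n)⁻¹ := by group
  rw [this]

instance (G : Subgroup (GL ι K)) (T : AlgTorus ι K) : Nonempty (weylGroup G T) :=
  ⟨⟨_, id_mem_weylGroup G T⟩⟩

end Weyl

/-! ### The Weyl group of the split torus -/

section SplitWeyl

variable {K : Type} [Field K] [CharZero K] [IsAlgClosed K] {P : GL Idx K}
  (hP : (P : Matrix Idx Idx K) * gram K * (P : Matrix Idx Idx K)ᵀ = splitGram K)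

/-- The sum `|e₁| + |e₂|` of the absolute values of the two coordinates. -/
def height (X : RealCochar (splitTorus P hP)) : ℝ :=
  |splitWeight hP (Sum.inl 0) X| + |splitWeight hP (Sum.inr 0) X|

theorem sum_abs_splitWeight (X : RealCochar (splitTorus P hP)) :
    ∑ i, |splitWeight hP i X| = 2 * height hP X := by
  rw [sum_idx, splitWeight_inl_one, splitWeight_inr_one, splitWeight_inr_two, height]
  simp only [LinearMap.neg_apply, abs_neg, LinearMap.zero_apply, abs_zero]
  ring

/-- Weyl group elements permute the weights, so they preserve `|e₁| + |e₂|`. -/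
theorem height_weylGroup {H : Subgroup (GL Idx K)}
    {w : RealCochar (splitTorus P hP) →ₗ[ℝ] RealCochar (splitTorus P hP)}
    (hw : w ∈ weylGroup H (splitTorus P hP)) (X : RealCochar (splitTorus P hP)) :
    height hP (w X) = height hP X := by
  obtain ⟨n, -, hn, rfl⟩ := hw
  obtain ⟨σ, hσ⟩ := exists_perm_weight (splitTorus_isDiag hP) fun t ht => (hn t).1 ht
  have h1 := sum_abs_splitWeight hP (realConj n (fun t ht => (hn t).1 ht) X)
  have h2 := sum_abs_splitWeight hP X
  have h3 : ∑ i, |splitWeight hP i (realConj n (fun t ht => (hn t).1 ht) X)| =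
      ∑ i, |splitWeight hP i X| := by
    simp only [splitWeight, hσ]
    exact Equiv.sum_comp σ fun i => |splitWeight hP i X|
  linarith

/-- An element `n` of the identity component that normalizes the split torus, acting on it through
the involution `φ`, gives an element of the Weyl group that permutes the weights as `φ` permutes the
diagonal characters. -/
theorem mem_weylGroup_of_conj {n : GL Idx K} (hn : n ∈ identityComponent (soPoints K))
    {φ : Kˣ × Kˣ → Kˣ × Kˣ} (hφ : ∀ z, φ (φ z) = z)
    (h : ∀ z, ((P * n * P⁻¹ : GL Idx K) : Matrix Idx Idx K) *
        Matrix.diagonal (fun i => (torusDiag z i : K)) =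
      Matrix.diagonal (fun i => (torusDiag (φ z) i : K)) *
        ((P * n * P⁻¹ : GL Idx K) : Matrix Idx Idx K)) :
    ∃ w ∈ weylGroup (soPoints K) (splitTorus P hP), ∀ i j,
      (∀ z, torusDiag (φ z) i = torusDiag z j) →
        ∀ X, splitWeight hP i (w X) = splitWeight hP j X := by
  have h1 : ∀ z, n * torusElt P z * n⁻¹ = torusElt P (φ z) := by
    intro z
    have h2 : P * n * P⁻¹ * diagGL (torusDiag z) = diagGL (torusDiag (φ z)) * (P * n * P⁻¹) := by
      ext1
      exact h z
    rw [torusElt_apply, torusElt_apply]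
    calc n * (P⁻¹ * diagGL (torusDiag z) * P) * n⁻¹
        = P⁻¹ * (P * n * P⁻¹ * diagGL (torusDiag z)) * P * n⁻¹ := by group
      _ = P⁻¹ * diagGL (torusDiag (φ z)) * P := by rw [h2]; group
  have hT : ∀ t, t ∈ (splitTorus P hP).carrier ↔ n * t * n⁻¹ ∈ (splitTorus P hP).carrier := by
    intro t
    simp only [mem_splitTorus]
    constructor
    · rintro ⟨z, rfl⟩
      exact ⟨φ z, h1 z⟩
    · rintro ⟨z, hz⟩
      refine ⟨φ z, ?_⟩
      have h3 := h1 (φ z)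
      rw [hφ, ← hz] at h3
      exact (mul_left_cancel (mul_right_cancel h3)).symm
  refine ⟨_, ⟨n, hn, hT, rfl⟩, fun i j hij X => weight_comp_realConj _ _ (fun t => ?_) X⟩
  obtain ⟨t, ht⟩ := t
  obtain ⟨z, rfl⟩ := (mem_splitTorus hP).1 ht
  simp only [h1]
  rw [splitChar_torusElt, splitChar_torusElt, hij]

/-- The element `x_α(s)` of the root group with root vector `splitRootVec K i j`. -/
theorem exists_rootGL
    (hP : (P : Matrix Idx Idx K) * gram K * (P : Matrix Idx Idx K)ᵀ = splitGram K)
    {i j : Idx} (hij : i ≠ j) (hj : j ≠ bar i) (s : K) :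
    ∃ x ∈ identityComponent (soPoints K), ((P * x * P⁻¹ : GL Idx K) : Matrix Idx Idx K) =
      1 + s • splitRootVec K i j + (s ^ 2 / 2) • (splitRootVec K i j * splitRootVec K i j) := by
  refine ⟨nilExpGL (s • rootVec P i j) (smul_cube_eq_zero (rootVec_cube P hij hj) s), ?_, ?_⟩
  · rw [← centPoints_zero]
    refine nilExpGL_mem_identityComponent _ ?_ (by simp)
    rw [smul_mul_assoc, Matrix.transpose_smul, mul_smul_comm, ← smul_add, rootVec_form hP,
      smul_zero]
  · have h1 : splitRootVec K i j * splitRootVec K i j =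
        P * (rootVec P i j * rootVec P i j) * (P⁻¹ : GL Idx K) := by
      rw [← conj_rootVec P]
      simp only [mul_assoc]
      rw [← mul_assoc ((P⁻¹ : GL Idx K) : Matrix Idx Idx K), Units.inv_mul, one_mul]
    change (P : Matrix Idx Idx K) * nilExp (s • rootVec P i j) * (P⁻¹ : GL Idx K) = _
    simp only [nilExp, h1, mul_add, add_mul, mul_one, Units.mul_inv, conj_rootVec, mul_smul_comm,
      smul_mul_assoc, smul_smul]
    congr 2
    ring

/-- The product `x_α(s) x_{-α}(t) x_α(s)` of root group elements. For suitable `s` and `t` it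
represents the reflection in `α`. -/
theorem exists_reflection
    (hP : (P : Matrix Idx Idx K) * gram K * (P : Matrix Idx Idx K)ᵀ = splitGram K)
    (i j : Idx) (hij : i ≠ j) (hj : j ≠ bar i) (s t : K) :
    ∃ n ∈ identityComponent (soPoints K), ((P * n * P⁻¹ : GL Idx K) : Matrix Idx Idx K) =
      (1 + s • splitRootVec K i j + (s ^ 2 / 2) • (splitRootVec K i j * splitRootVec K i j)) *
      (1 + t • splitRootVec K j i + (t ^ 2 / 2) • (splitRootVec K j i * splitRootVec K j i)) *
      (1 + s • splitRootVec K i j + (s ^ 2 / 2) • (splitRootVec K i j * splitRootVec K i j)) := by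
  have hi : i ≠ bar j := fun h => hj (eq_bar_iff.1 h)
  obtain ⟨x, hx, hx'⟩ := exists_rootGL hP hij hj s
  obtain ⟨y, hy, hy'⟩ := exists_rootGL hP hij.symm hi t
  refine ⟨x * y * x, mul_mem (mul_mem hx hy) hx, ?_⟩
  rw [← hx', ← hy', ← Units.val_mul, ← Units.val_mul]
  congr 1
  group

variable (K) in
theorem shortRoot_matrix :
    1 + (1 : K) • splitRootVec K (Sum.inl 0) (Sum.inr 2) + ((1 : K) ^ 2 / 2) •
      (splitRootVec K (Sum.inl 0) (Sum.inr 2) * splitRootVec K (Sum.inl 0) (Sum.inr 2)) =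
      Matrix.fromBlocks !![1, -(1 / 2); 0, 1] !![0, 0, 1; 0, 0, 0] !![0, 0; 0, 0; 0, -1]
        !![1, 0, 0; 0, 1, 0; 0, 0, 1] := by
  rw [splitRootVec_mul_self (by simp), if_pos (by decide), if_neg (by decide), splitRootVec,
    bar_inl_zero, bar_inr_two]
  ext i j
  revert i j
  simp only [forall_idx]
  simp

variable (K) in
theorem shortRoot_neg_matrix :
    1 + (-2 : K) • splitRootVec K (Sum.inr 2) (Sum.inl 0) + ((-2 : K) ^ 2 / 2) •
      (splitRootVec K (Sum.inr 2) (Sum.inl 0) * splitRootVec K (Sum.inr 2) (Sum.inl 0)) =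
      Matrix.fromBlocks !![1, 0; -2, 1] !![0, 0, 0; 0, 0, 2] !![0, 0; 0, 0; -2, 0]
        !![1, 0, 0; 0, 1, 0; 0, 0, 1] := by
  rw [splitRootVec_mul_self (by simp), if_neg (by decide), if_pos (by decide), splitRootVec,
    bar_inl_zero, bar_inr_two]
  ext i j
  revert i j
  simp only [forall_idx]
  simp
  norm_num

variable (K) in
theorem longRoot_matrix :
    1 + (1 : K) • splitRootVec K (Sum.inl 0) (Sum.inr 0) + ((1 : K) ^ 2 / 2) •
      (splitRootVec K (Sum.inl 0) (Sum.inr 0) * splitRootVec K (Sum.inl 0) (Sum.inr 0)) =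
      Matrix.fromBlocks !![1, 0; 0, 1] !![1, 0, 0; 0, 0, 0] !![0, 0; 0, -1; 0, 0]
        !![1, 0, 0; 0, 1, 0; 0, 0, 1] := by
  rw [splitRootVec_mul_self (by simp), if_neg (by decide), if_neg (by decide), splitRootVec,
    bar_inl_zero, bar_inr_zero]
  ext i j
  revert i j
  simp only [forall_idx]
  simp

variable (K) in
theorem longRoot_neg_matrix :
    1 + (-1 : K) • splitRootVec K (Sum.inr 0) (Sum.inl 0) + ((-1 : K) ^ 2 / 2) •
      (splitRootVec K (Sum.inr 0) (Sum.inl 0) * splitRootVec K (Sum.inr 0) (Sum.inl 0)) =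
      Matrix.fromBlocks !![1, 0; 0, 1] !![0, 0, 0; 0, 1, 0] !![-1, 0; 0, 0; 0, 0]
        !![1, 0, 0; 0, 1, 0; 0, 0, 1] := by
  rw [splitRootVec_mul_self (by simp), if_neg (by decide), if_neg (by decide), splitRootVec,
    bar_inl_zero, bar_inr_zero]
  ext i j
  revert i j
  simp only [forall_idx]
  simp

variable (K) in
theorem shortReflection_matrix :
    (Matrix.fromBlocks !![1, -(1 / 2); 0, 1] !![0, 0, 1; 0, 0, 0] !![0, 0; 0, 0; 0, -1]
        !![1, 0, 0; 0, 1, 0; 0, 0, 1] :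
      Matrix Idx Idx K) *
      Matrix.fromBlocks !![1, 0; -2, 1] !![0, 0, 0; 0, 0, 2] !![0, 0; 0, 0; -2, 0]
        !![1, 0, 0; 0, 1, 0; 0, 0, 1] *
      Matrix.fromBlocks !![1, -(1 / 2); 0, 1] !![0, 0, 1; 0, 0, 0] !![0, 0; 0, 0; 0, -1]
        !![1, 0, 0; 0, 1, 0; 0, 0, 1] =
    Matrix.fromBlocks !![0, -(1 / 2); -2, 0] 0 0 !![1, 0, 0; 0, 1, 0; 0, 0, -1] := by
  rw [Matrix.fromBlocks_multiply, Matrix.fromBlocks_multiply]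
  congr 1 <;> ext i j <;> fin_cases i <;> fin_cases j <;> simp <;> norm_num

variable (K) in
theorem longReflection_matrix :
    (Matrix.fromBlocks !![1, 0; 0, 1] !![1, 0, 0; 0, 0, 0] !![0, 0; 0, -1; 0, 0]
        !![1, 0, 0; 0, 1, 0; 0, 0, 1] :
      Matrix Idx Idx K) *
      Matrix.fromBlocks !![1, 0; 0, 1] !![0, 0, 0; 0, 1, 0] !![-1, 0; 0, 0; 0, 0]
        !![1, 0, 0; 0, 1, 0; 0, 0, 1] *
      Matrix.fromBlocks !![1, 0; 0, 1] !![1, 0, 0; 0, 0, 0] !![0, 0; 0, -1; 0, 0]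
        !![1, 0, 0; 0, 1, 0; 0, 0, 1] =
    Matrix.fromBlocks 0 !![1, 0, 0; 0, 1, 0] !![-1, 0; 0, -1; 0, 0]
      !![0, 0, 0; 0, 0, 0; 0, 0, 1] := by
  rw [Matrix.fromBlocks_multiply, Matrix.fromBlocks_multiply]
  congr 1 <;> ext i j <;> fin_cases i <;> fin_cases j <;> simp

/-- The reflection in the short root `e₁`. -/
theorem exists_weyl_neg : ∃ w ∈ weylGroup (soPoints K) (splitTorus P hP), ∀ X,
    splitWeight hP (Sum.inl 0) (w X) = -splitWeight hP (Sum.inl 0) X ∧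
      splitWeight hP (Sum.inr 0) (w X) = splitWeight hP (Sum.inr 0) X := by
  obtain ⟨n, hn, hconj⟩ := exists_reflection hP (Sum.inl 0) (Sum.inr 2) (by simp) (by decide) 1 (-2)
  rw [shortRoot_matrix, shortRoot_neg_matrix, shortReflection_matrix] at hconj
  obtain ⟨w, hw, hww⟩ := mem_weylGroup_of_conj hP hn (φ := fun z => (z.1⁻¹, z.2)) (by simp) (by
    intro z
    rw [hconj]
    ext i j
    rw [Matrix.mul_diagonal, Matrix.diagonal_mul]
    revert i j
    simp only [forall_idx]
    simp [torusDiag, mul_comm])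
  refine ⟨w, hw, fun X => ⟨?_, ?_⟩⟩
  · rw [hww (Sum.inl 0) (Sum.inl 1) (by simp [torusDiag]), splitWeight_inl_one, LinearMap.neg_apply]
  · exact hww (Sum.inr 0) (Sum.inr 0) (by simp [torusDiag]) X

/-- The reflection in the long root `e₁ - e₂`. -/
theorem exists_weyl_swap : ∃ w ∈ weylGroup (soPoints K) (splitTorus P hP), ∀ X,
    splitWeight hP (Sum.inl 0) (w X) = splitWeight hP (Sum.inr 0) X ∧
      splitWeight hP (Sum.inr 0) (w X) = splitWeight hP (Sum.inl 0) X := by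
  obtain ⟨n, hn, hconj⟩ := exists_reflection hP (Sum.inl 0) (Sum.inr 0) (by simp) (by decide) 1 (-1)
  rw [longRoot_matrix, longRoot_neg_matrix, longReflection_matrix] at hconj
  obtain ⟨w, hw, hww⟩ := mem_weylGroup_of_conj hP hn (φ := fun z => (z.2, z.1)) (by simp) (by
    intro z
    rw [hconj]
    ext i j
    rw [Matrix.mul_diagonal, Matrix.diagonal_mul]
    revert i j
    simp only [forall_idx]
    simp [torusDiag])
  refine ⟨w, hw, fun X => ⟨?_, ?_⟩⟩
  · exact hww (Sum.inl 0) (Sum.inr 0) (by simp [torusDiag]) X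
  · exact hww (Sum.inr 0) (Sum.inl 0) (by simp [torusDiag]) X

end SplitWeyl

end SmallSubgroups
end

noncomputable section
set_option linter.unusedSectionVars false
namespace SmallSubgroups

/-! ### Half sums of roots -/

section HalfSums

variable {V : Type*} [AddCommGroup V] [Module ℝ V]

/-- The half sum of the positive roots `e₁, e₂, e₁ ± e₂` is `(3 e₁ + e₂) / 2`.  The point `x` serves
to see that the four roots are distinct. -/
theorem half_finsum_eq {a b : Module.Dual ℝ V} {x : V} (ha : a x = 3) (hb : b x = 1) (X : V) :
    ((1 / 2 : ℝ) • ∑ᶠ α ∈ ({a, b, a - b, a + b} : Set (Module.Dual ℝ V)), α) X =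
      (3 * a X + b X) / 2 := by
  have hne : ∀ {α β : Module.Dual ℝ V}, α x ≠ β x → α ≠ β := fun h h' => h (by rw [h'])
  rw [finsum_mem_insert _ _ (Set.toFinite _), finsum_mem_insert _ _ (Set.toFinite _),
    finsum_mem_pair]
  · simp only [LinearMap.smul_apply, LinearMap.add_apply, LinearMap.sub_apply, smul_eq_mul]
    ring
  · apply hne
    rw [LinearMap.sub_apply, LinearMap.add_apply, ha, hb]; norm_num
  · rintro (h | h)
    · refine hne ?_ h
      rw [LinearMap.sub_apply, ha, hb]; norm_num
    · refine hne ?_ h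
      rw [LinearMap.add_apply, ha, hb]; norm_num
  · rintro (h | h | h)
    · refine hne ?_ h
      rw [ha, hb]; norm_num
    · refine hne ?_ h
      rw [LinearMap.sub_apply, ha, hb]; norm_num
    · refine hne ?_ h
      rw [LinearMap.add_apply, ha, hb]; norm_num

theorem half_finsum_le {β : Module.Dual ℝ V} {s : Set (Module.Dual ℝ V)} (hs : s ⊆ {β}) {h : ℝ}
    (h0 : 0 ≤ h) {X : V} (hβ : β X ≤ h) : ((1 / 2 : ℝ) • ∑ᶠ α ∈ s, α) X ≤ 1 / 2 * h := by
  rcases Set.subset_singleton_iff_eq.1 hs with rfl | rfl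
  · rw [finsum_mem_empty, smul_zero, LinearMap.zero_apply]
    positivity
  · rw [finsum_mem_singleton, LinearMap.smul_apply, smul_eq_mul]
    exact mul_le_mul_of_nonneg_left hβ (by norm_num)

end HalfSums

/-! ### Smallness of Levi subgroups -/

section Norms

variable {K : Type} [Field K] [CharZero K] [IsAlgClosed K] {P : GL Idx K}
  (hP : (P : Matrix Idx Idx K) * gram K * (P : Matrix Idx Idx K)ᵀ = splitGram K)

theorem zpow_mem_regularGm (m : ℤ) : (fun z : Kˣ => ((z ^ m : Kˣ) : K)) ∈ regularGm K := by
  have h1 : (fun z : Kˣ => (z : K)) ∈ regularGm K := Algebra.subset_adjoin (by simp)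
  have h2 : (fun z : Kˣ => ((z⁻¹ : Kˣ) : K)) ∈ regularGm K := Algebra.subset_adjoin (by simp)
  obtain ⟨n, rfl | rfl⟩ := m.eq_nat_or_neg
  · have := (regularGm K).pow_mem h1 n
    convert this using 1
    funext z
    simp
  · have := (regularGm K).pow_mem h2 n
    convert this using 1
    funext z
    simp

/-- The cocharacter `z ↦ diag(z ^ m, z ^ (-m), z ^ n, z ^ (-n), 1)`, conjugated by `P`. -/
def splitCochar (m n : ℤ) : Cochar (splitTorus P hP) :=
  Additive.ofMul
    ⟨((torusElt P).comp (MonoidHom.prod (zpowGroupHom m) (zpowGroupHom n))).codRestrict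
        (splitTorus P hP).carrier fun _ => (mem_splitTorus hP).2 ⟨_, rfl⟩, by
      have hd : IsRegularMap fun z : Kˣ =>
          (diagGL (torusDiag (z ^ m, z ^ n)) : Matrix Idx Idx K) := by
        intro i j
        simp only [coe_diagGL, Matrix.diagonal_apply]
        by_cases hij : i = j
        · simp only [if_pos hij]
          simp only [← zpow_neg, torusDiag, MonoidHom.coe_mk, OneHom.coe_mk]
          revert i
          rw [forall_idx]
          exact ⟨fun _ => zpow_mem_regularGm m, fun _ => zpow_mem_regularGm (-m),
            fun _ => zpow_mem_regularGm n, fun _ => zpow_mem_regularGm (-n),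
            fun _ => (regularGm K).one_mem⟩
        · simp only [if_neg hij]
          exact (regularGm K).zero_mem
      have h := ((IsRegularMap.const ((P⁻¹ : GL Idx K) : Matrix Idx Idx K)).mul hd).mul
        (IsRegularMap.const (P : Matrix Idx Idx K))
      have e : ∀ z : Kˣ, ((torusElt P (z ^ m, z ^ n) : GL Idx K) : Matrix Idx Idx K) =
          (P⁻¹ : GL Idx K) * diagGL (torusDiag (z ^ m, z ^ n)) * P := fun z => by
        rw [torusElt_apply]; rfl
      simp only [← e] at h
      exact h⟩

theorem splitWeight_splitCochar (m n : ℤ) :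
    splitWeight hP (Sum.inl 0) (1 ⊗ₜ[ℤ] splitCochar hP m n) = m ∧
      splitWeight hP (Sum.inr 0) (1 ⊗ₜ[ℤ] splitCochar hP m n) = n := by
  have h : ∀ i (z : Kˣ), z ^ intWeight _ P (splitTorus_isDiag hP) i (splitCochar hP m n) =
      torusDiag (z ^ m, z ^ n) i := by
    intro i z
    rw [← diagChar_eval]
    exact splitChar_torusElt hP _ _ i
  rw [splitWeight, splitWeight, weight_tmul, weight_tmul]
  exact ⟨congrArg Int.cast (zpow_two_injective (K := K) fun z => by rw [h]; rfl),
    congrArg Int.cast (zpow_two_injective (K := K) fun z => by rw [h]; rfl)⟩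

/-- An element of the open Weyl chamber `e₁ > e₂ > 0`. -/
def dominantElt : RealCochar (splitTorus P hP) := 1 ⊗ₜ[ℤ] splitCochar hP 3 1

theorem splitWeight_dominantElt :
    splitWeight hP (Sum.inl 0) (dominantElt hP) = 3 ∧
      splitWeight hP (Sum.inr 0) (dominantElt hP) = 1 := by
  have := splitWeight_splitCochar hP 3 1
  rw [dominantElt, this.1, this.2]
  norm_num

theorem isRegularElt_dominantElt {C : Matrix Idx Idx K} {c : Idx → K}
    (hC : (P : Matrix Idx Idx K) * C = Matrix.diagonal c * P) :
    IsRegularElt (centPoints C) (splitTorus P hP) (dominantElt hP) := by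
  intro α hα h
  obtain ⟨i, j, hj, -, rfl⟩ := exists_of_mem_roots hP hC hα
  have hij : i ≠ j := by
    rintro rfl
    exact hα.1 (sub_self _)
  obtain ⟨h1, h2⟩ := splitWeight_dominantElt hP
  rw [LinearMap.sub_apply] at h
  clear hα
  revert i j
  simp only [forall_idx, splitWeight_inl_one, splitWeight_inr_one, splitWeight_inr_two,
    LinearMap.neg_apply, LinearMap.zero_apply, h1, h2]
  norm_num

/-- The positive roots of `SO(Q)`. -/
theorem posRoots_soPoints : posRoots (soPoints K) (splitTorus P hP) (dominantElt hP) =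
    {splitWeight hP (Sum.inl 0), splitWeight hP (Sum.inr 0),
      splitWeight hP (Sum.inl 0) - splitWeight hP (Sum.inr 0),
      splitWeight hP (Sum.inl 0) + splitWeight hP (Sum.inr 0)} := by
  have hC : (P : Matrix Idx Idx K) * (0 : Matrix Idx Idx K) =
      Matrix.diagonal (0 : Idx → K) * P := by
    simp
  obtain ⟨h1, h2⟩ := splitWeight_dominantElt hP
  have hroot : ∀ i j, j ≠ bar i →
      splitWeight hP i (dominantElt hP) > splitWeight hP j (dominantElt hP) →
      splitWeight hP i - splitWeight hP j ∈
        posRoots (soPoints K) (splitTorus P hP) (dominantElt hP) := by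
    intro i j hj hpos
    have hpos' : 0 < (splitWeight hP i - splitWeight hP j) (dominantElt hP) := by
      rw [LinearMap.sub_apply]; linarith
    refine ⟨?_, hpos'⟩
    rw [← centPoints_zero]
    refine splitWeight_sub_mem_roots hP hC (fun i => by simp) ?_ hj rfl ?_
    · rintro rfl; exact lt_irrefl _ hpos
    · intro h0
      rw [h0] at hpos'
      simp at hpos'
  apply Set.Subset.antisymm
  · rintro α ⟨hα, hpos⟩
    rw [← centPoints_zero] at hα
    obtain ⟨i, j, hj, -, rfl⟩ := exists_of_mem_roots hP hC hα
    rw [LinearMap.sub_apply] at hpos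
    clear hα
    revert i j
    simp only [forall_idx, splitWeight_inl_one, splitWeight_inr_one, splitWeight_inr_two,
      LinearMap.neg_apply, LinearMap.zero_apply, h1, h2, bar_inl_zero, bar_inl_one, bar_inr_zero,
      bar_inr_one, bar_inr_two, Set.mem_insert_iff, Set.mem_singleton_iff]
    norm_num [add_comm, sub_eq_add_neg]
  · have e1 := hroot (Sum.inl 0) (Sum.inr 2) (by decide) (by rw [h1, splitWeight_inr_two]; norm_num)
    have e2 := hroot (Sum.inr 0) (Sum.inr 2) (by decide) (by rw [h2, splitWeight_inr_two]; norm_num)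
    have e3 := hroot (Sum.inl 0) (Sum.inr 0) (by decide) (by rw [h1, h2]; norm_num)
    have e4 := hroot (Sum.inl 0) (Sum.inr 1) (by decide) (by
      simp only [splitWeight_inr_one, LinearMap.neg_apply, h1, h2]; norm_num)
    simp only [splitWeight_inr_two, sub_zero] at e1 e2
    simp only [splitWeight_inr_one, sub_neg_eq_add] at e4
    intro α hα
    simp only [Set.mem_insert_iff, Set.mem_singleton_iff] at hα
    rcases hα with h | h | h | h <;> rw [h]
    exacts [e1, e2, e3, e4]

theorem rho_soPoints (X : RealCochar (splitTorus P hP)) :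
    rho (soPoints K) (splitTorus P hP) (dominantElt hP) X =
      (3 * splitWeight hP (Sum.inl 0) X + splitWeight hP (Sum.inr 0) X) / 2 := by
  obtain ⟨h1, h2⟩ := splitWeight_dominantElt hP
  rw [rho, posRoots_soPoints]
  exact half_finsum_eq h1 h2 X

/-- The values `⟨ρ, w X⟩` are at most `3 (|e₁| + |e₂|) / 2`, so the supremum `‖X‖_G` of real numbers
is not a junk value and bounds each of them. -/
theorem rho_le_rhoNorm {X : RealCochar (splitTorus P hP)}
    {w : RealCochar (splitTorus P hP) →ₗ[ℝ] RealCochar (splitTorus P hP)}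
    (hw : w ∈ weylGroup (soPoints K) (splitTorus P hP)) :
    rho (soPoints K) (splitTorus P hP) (dominantElt hP) (w X) ≤
      rhoNorm (soPoints K) (splitTorus P hP) (dominantElt hP) X := by
  refine le_ciSup (f := fun w : weylGroup (soPoints K) (splitTorus P hP) =>
    rho (soPoints K) (splitTorus P hP) (dominantElt hP) (w.1 X)) ?_ ⟨w, hw⟩
  refine ⟨3 / 2 * height hP X, ?_⟩
  rintro _ ⟨⟨v, hv⟩, rfl⟩
  simp only [rho_soPoints]
  rw [← height_weylGroup hP hv X, height]
  have h1 := le_abs_self (splitWeight hP (Sum.inl 0) (v X))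
  have h2 := le_abs_self (splitWeight hP (Sum.inr 0) (v X))
  have h3 := abs_nonneg (splitWeight hP (Sum.inr 0) (v X))
  linarith

/-- `f` gives the effect of some Weyl group element on the coordinates `(e₁, e₂)`. -/
def WeylRealizes (f : ℝ → ℝ → ℝ × ℝ) : Prop :=
  ∃ w ∈ weylGroup (soPoints K) (splitTorus P hP), ∀ X,
    splitWeight hP (Sum.inl 0) (w X) =
        (f (splitWeight hP (Sum.inl 0) X) (splitWeight hP (Sum.inr 0) X)).1 ∧
      splitWeight hP (Sum.inr 0) (w X) =
        (f (splitWeight hP (Sum.inl 0) X) (splitWeight hP (Sum.inr 0) X)).2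

theorem WeylRealizes.comp {f g : ℝ → ℝ → ℝ × ℝ} (hf : WeylRealizes hP f) (hg : WeylRealizes hP g) :
    WeylRealizes hP fun x y => f (g x y).1 (g x y).2 := by
  obtain ⟨v, hv, hv'⟩ := hf
  obtain ⟨w, hw, hw'⟩ := hg
  refine ⟨v ∘ₗ w, comp_mem_weylGroup hv hw, fun X => ?_⟩
  rw [LinearMap.comp_apply, (hv' _).1, (hv' _).2, (hw' X).1, (hw' X).2]
  exact ⟨rfl, rfl⟩

theorem weylRealizes_id : WeylRealizes hP fun x y => (x, y) :=
  ⟨_, id_mem_weylGroup _ _, fun _ => ⟨rfl, rfl⟩⟩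

theorem weylRealizes_neg : WeylRealizes hP fun x y => (-x, y) := exists_weyl_neg hP

theorem weylRealizes_swap : WeylRealizes hP fun x y => (y, x) := exists_weyl_swap hP

theorem weylRealizes_neg_right : WeylRealizes hP fun x y => (x, -y) :=
  (weylRealizes_swap hP).comp hP ((weylRealizes_neg hP).comp hP (weylRealizes_swap hP))

theorem WeylRealizes.le_rhoNorm {f : ℝ → ℝ → ℝ × ℝ} (hf : WeylRealizes hP f)
    {X : RealCochar (splitTorus P hP)} {x y : ℝ} (hx : splitWeight hP (Sum.inl 0) X = x)
    (hy : splitWeight hP (Sum.inr 0) X = y) :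
    (3 * (f x y).1 + (f x y).2) / 2 ≤
      rhoNorm (soPoints K) (splitTorus P hP) (dominantElt hP) X := by
  obtain ⟨w, hw, hw'⟩ := hf
  have := rho_le_rhoNorm hP (X := X) hw
  rwa [rho_soPoints, (hw' X).1, (hw' X).2, hx, hy] at this

/-- The sign changes in the Weyl group allow to replace `e₁` and `e₂` by their absolute values in
`WeylRealizes.le_rhoNorm`. -/
theorem WeylRealizes.abs_le_rhoNorm {f : ℝ → ℝ → ℝ × ℝ} (hf : WeylRealizes hP f)
    (X : RealCochar (splitTorus P hP)) :
    (3 * (f |splitWeight hP (Sum.inl 0) X| |splitWeight hP (Sum.inr 0) X|).1 +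
      (f |splitWeight hP (Sum.inl 0) X| |splitWeight hP (Sum.inr 0) X|).2) / 2 ≤
        rhoNorm (soPoints K) (splitTorus P hP) (dominantElt hP) X := by
  rcases abs_choice (splitWeight hP (Sum.inl 0) X) with h | h <;>
    rcases abs_choice (splitWeight hP (Sum.inr 0) X) with h' | h' <;> rw [h, h']
  · exact hf.le_rhoNorm hP rfl rfl
  · exact (hf.comp hP (weylRealizes_neg_right hP)).le_rhoNorm hP rfl rfl
  · exact (hf.comp hP (weylRealizes_neg hP)).le_rhoNorm hP rfl rfl
  · exact (hf.comp hP ((weylRealizes_neg hP).comp hP (weylRealizes_neg_right hP))).le_rhoNorm hP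
      rfl rfl

theorem le_rhoNorm_soPoints (X : RealCochar (splitTorus P hP)) :
    (3 * |splitWeight hP (Sum.inl 0) X| + |splitWeight hP (Sum.inr 0) X|) / 2 ≤
        rhoNorm (soPoints K) (splitTorus P hP) (dominantElt hP) X ∧
      (3 * |splitWeight hP (Sum.inr 0) X| + |splitWeight hP (Sum.inl 0) X|) / 2 ≤
        rhoNorm (soPoints K) (splitTorus P hP) (dominantElt hP) X :=
  ⟨(weylRealizes_id hP).abs_le_rhoNorm hP X, (weylRealizes_swap hP).abs_le_rhoNorm hP X⟩

/-- The average of the two bounds of `le_rhoNorm_soPoints` is `|e₁| + |e₂|`. -/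
theorem height_le_rhoNorm (X : RealCochar (splitTorus P hP)) :
    height hP X ≤ rhoNorm (soPoints K) (splitTorus P hP) (dominantElt hP) X := by
  obtain ⟨h1, h2⟩ := le_rhoNorm_soPoints hP X
  rw [height]
  linarith

/-- If `H` has at most one positive root `β`, and `β ≤ |e₁| + |e₂|`, then `‖X‖_H` is at most half of
`|e₁| + |e₂|`. -/
theorem rhoNorm_le_height {H : Subgroup (GL Idx K)}
    {β : Module.Dual ℝ (RealCochar (splitTorus P hP))} (hβ : ∀ X, β X ≤ height hP X)
    (hH : posRoots H (splitTorus P hP) (dominantElt hP) ⊆ {β})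
    (X : RealCochar (splitTorus P hP)) :
    rhoNorm H (splitTorus P hP) (dominantElt hP) X ≤ 1 / 2 * height hP X := by
  refine ciSup_le fun ⟨w, hw⟩ => ?_
  rw [← height_weylGroup hP hw X]
  exact half_finsum_le hH (add_nonneg (abs_nonneg _) (abs_nonneg _)) (hβ _)

/-- The centralizer `H` in `SO(Q)` of an element of its Lie algebra that `P` diagonalizes is small
as soon as it has at most one positive root `β`, and `β ≤ |e₁| + |e₂|`. It is tempered as `‖X‖_H` is
at most half of `|e₁| + |e₂|`. It contains a maximal torus of `SO(Q)`, and for the cocharacter `X`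
with `(e₁, e₂) = (1, 0)` one has `‖w X‖_H ≤ 1 / 2 < 3 / 4 ≤ ‖X‖_G / 2`. -/
theorem isSmall_centPoints {C : Matrix Idx Idx K} {c : Idx → K}
    (hC : (P : Matrix Idx Idx K) * C = Matrix.diagonal c * P) (hc : ∀ i, c (bar i) = -c i)
    {β : Module.Dual ℝ (RealCochar (splitTorus P hP))} (hβ : ∀ X, β X ≤ height hP X)
    (hH : posRoots (centPoints C) (splitTorus P hP) (dominantElt hP) ⊆ {β}) :
    IsSmall (soPoints K) (centPoints C) := by
  have hC0 : (P : Matrix Idx Idx K) * (0 : Matrix Idx Idx K) =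
      Matrix.diagonal (0 : Idx → K) * P := by
    simp
  have hredG : IsReductive (soPoints K) := by
    rw [← centPoints_zero]
    exact isReductive_centPoints hP hC0 (by simp)
  have hredH := isReductive_centPoints hP hC hc
  have hmaxG : IsMaximalTorus (splitTorus P hP) (soPoints K) := by
    rw [← centPoints_zero]
    exact isMaximalTorus_splitTorus hP hC0
  have hmaxH := isMaximalTorus_splitTorus hP hC
  have hregG : IsRegularElt (soPoints K) (splitTorus P hP) (dominantElt hP) := by
    rw [← centPoints_zero]
    exact isRegularElt_dominantElt hP hC0
  have hregH := isRegularElt_dominantElt hP hC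
  -- `S = T` is the split torus, so the alternative (b) is the one to prove
  refine ⟨isZariskiClosed_centPoints C, Or.inl ⟨hredH, ⟨hredG, hredH, centPoints_le C,
    splitTorus P hP, splitTorus P hP, le_rfl, dominantElt hP, dominantElt hP, hmaxH, hmaxG, hregH,
    hregG, fun X => ?_⟩, Or.inr ⟨splitTorus P hP, dominantElt hP, dominantElt hP, hmaxH, hmaxG,
      hregH,
    hregG, 1 ⊗ₜ[ℤ] splitCochar hP 1 0, fun w hw => ?_⟩⟩⟩
  · rw [realIncl_self, LinearMap.id_apply]
    have h1 := rhoNorm_le_height hP hβ hH X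
    have h2 := height_le_rhoNorm hP X
    linarith
  · have h1 := rhoNorm_le_height hP hβ hH (w (1 ⊗ₜ[ℤ] splitCochar hP 1 0))
    rw [height_weylGroup hP hw] at h1
    have h2 := (le_rhoNorm_soPoints hP (1 ⊗ₜ[ℤ] splitCochar hP 1 0)).1
    rw [height] at h1
    rw [(splitWeight_splitCochar hP 1 0).1, (splitWeight_splitCochar hP 1 0).2] at h1 h2
    norm_num at h1 h2
    linarith

/-- The Levi subgroup `GL₁ × SO₃`, with the short positive root `e₂`, is small. -/
theorem isSmall_centPoints_short {C : Matrix Idx Idx K} {a : K} (ha : a ≠ 0)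
    (hC : (P : Matrix Idx Idx K) * C = Matrix.diagonal (Sum.elim ![a, -a] ![0, 0, 0]) * P)
    (hP : (P : Matrix Idx Idx K) * gram K * (P : Matrix Idx Idx K)ᵀ = splitGram K) :
    IsSmall (soPoints K) (centPoints C) := by
  refine isSmall_centPoints hP hC ?_ (β := splitWeight hP (Sum.inr 0)) (fun X => ?_) ?_
  · rw [forall_idx]
    simp [bar_inl_zero, bar_inl_one, bar_inr_zero, bar_inr_one, bar_inr_two]
  · exact (le_abs_self _).trans (le_add_of_nonneg_left (abs_nonneg _))
  · rintro α ⟨hα, hpos⟩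
    obtain ⟨i, j, hj, hij, rfl⟩ := exists_of_mem_roots hP hC hα
    obtain ⟨h1, h2⟩ := splitWeight_dominantElt hP
    rw [LinearMap.sub_apply] at hpos
    clear hα
    have ha' : ¬ a = -a := fun h => ha (self_eq_neg.1 h)
    have ha'' : ¬ -a = a := fun h => ha' h.symm
    revert i j
    simp only [forall_idx, splitWeight_inl_one, splitWeight_inr_one, splitWeight_inr_two,
      LinearMap.neg_apply, LinearMap.zero_apply, h1, h2, bar_inl_zero, bar_inl_one, bar_inr_zero,
      bar_inr_one, bar_inr_two, Set.mem_singleton_iff]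
    have h3 : (![0, 0, 0] : Fin 3 → K) 2 = 0 := rfl
    norm_num [h3, ha, ha.symm, ha', ha'']

/-- The Levi subgroup `GL₂`, with the long positive root `e₁ - e₂`, is small. -/
theorem isSmall_centPoints_long {C : Matrix Idx Idx K} {a : K} (ha : a ≠ 0)
    (hC : (P : Matrix Idx Idx K) * C = Matrix.diagonal (Sum.elim ![a, -a] ![a, -a, 0]) * P)
    (hP : (P : Matrix Idx Idx K) * gram K * (P : Matrix Idx Idx K)ᵀ = splitGram K) :
    IsSmall (soPoints K) (centPoints C) := by
  refine isSmall_centPoints hP hC ?_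
    (β := splitWeight hP (Sum.inl 0) - splitWeight hP (Sum.inr 0)) (fun X => ?_) ?_
  · rw [forall_idx]
    simp [bar_inl_zero, bar_inl_one, bar_inr_zero, bar_inr_one, bar_inr_two]
  · rw [LinearMap.sub_apply, height, sub_eq_add_neg]
    exact add_le_add (le_abs_self _) (neg_le_abs _)
  · rintro α ⟨hα, hpos⟩
    obtain ⟨i, j, hj, hij, rfl⟩ := exists_of_mem_roots hP hC hα
    obtain ⟨h1, h2⟩ := splitWeight_dominantElt hP
    rw [LinearMap.sub_apply] at hpos
    clear hα
    have ha' : ¬ a = -a := fun h => ha (self_eq_neg.1 h)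
    have ha'' : ¬ -a = a := fun h => ha' h.symm
    revert i j
    simp only [forall_idx, splitWeight_inl_one, splitWeight_inr_one, splitWeight_inr_two,
      LinearMap.neg_apply, LinearMap.zero_apply, h1, h2, bar_inl_zero, bar_inl_one, bar_inr_zero,
      bar_inr_one, bar_inr_two, Set.mem_singleton_iff]
    have h3 : (![a, -a, 0] : Fin 3 → K) 2 = 0 := rfl
    norm_num [h3, ha, ha.symm, ha', ha'', sub_eq_add_neg, add_comm]

end Norms

end SmallSubgroups
end

noncomputable section
set_option linter.unusedSectionVars false
namespace SmallSubgroups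

/-! ### Two elements of the Lie algebra and their splittings -/

section Splittings

variable {K : Type} [Field K]

theorem splitGram_mul_self : splitGram K * splitGram K = 1 := by
  ext i j
  rw [mul_splitGram_apply, Matrix.one_apply, splitGram]
  exact if_congr (by rw [bar.injective.eq_iff, eq_comm]) rfl rfl

theorem exists_GL_of_form {P : Matrix Idx Idx K} (h : P * gram K * Pᵀ = splitGram K) :
    ∃ U : GL Idx K, (U : Matrix Idx Idx K) = P := by
  have h1 : P * (gram K * Pᵀ * splitGram K) = 1 := by
    rw [← mul_assoc, ← mul_assoc, h, splitGram_mul_self]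
  exact ⟨⟨P, _, h1, mul_eq_one_comm.1 h1⟩, rfl⟩

theorem exists_sq_eq_neg_one (K : Type) [Field K] [IsAlgClosed K] : ∃ r : K, r * r = -1 := by
  obtain ⟨r, hr⟩ := IsAlgClosed.exists_pow_nat_eq (-1 : K) (n := 2) two_pos
  exact ⟨r, by rw [← sq, hr]⟩

/-- The generator `diag(1, -1, 0, 0, 0)` of the Lie algebra of `A`. -/
def boost (F : Type) [Field F] : Matrix Idx Idx F := Matrix.diagonal (Sum.elim ![1, -1] ![0, 0, 0])

/-- The rational element `J` of the Lie algebra of `SO(Q)` with eigenvalues `±i, ±i, 0`: it kills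
`e₀ - e₁ / 2`, and it acts as a complex structure on its orthogonal complement, sending
`e₀ + e₁ / 2` to `e₂` and `e₃` to `e₄`. -/
def complexStr (F : Type) [Field F] : Matrix Idx Idx F :=
  Matrix.of <| Sum.elim
    ![Sum.elim ![0, 0] ![-1, 0, 0], Sum.elim ![0, 0] ![-1 / 2, 0, 0]]
    ![Sum.elim ![1 / 2, 1] ![0, 0, 0], Sum.elim ![0, 0] ![0, 0, -1], Sum.elim ![0, 0] ![0, 1, 0]]

variable [CharZero K]

/-- Coordinates in which `Q` is split and `boost` is diagonal; they require a square root `r` of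
`-1` to split `x₂² + x₃²`. -/
theorem exists_splitting_boost {r : K} (hr : r * r = -1) : ∃ P : GL Idx K,
    (P : Matrix Idx Idx K) * gram K * (P : Matrix Idx Idx K)ᵀ = splitGram K ∧
    (P : Matrix Idx Idx K) * boost K =
      Matrix.diagonal (Sum.elim ![1, -1] ![0, 0, 0]) * (P : Matrix Idx Idx K) := by
  let P : Matrix Idx Idx K := Matrix.of <| Sum.elim
    ![Sum.elim ![1, 0] ![0, 0, 0], Sum.elim ![0, 1] ![0, 0, 0]]
    ![Sum.elim ![0, 0] ![1, r, 0], Sum.elim ![0, 0] ![1 / 2, -r / 2, 0],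
      Sum.elim ![0, 0] ![0, 0, 1]]
  have h1 : P * gram K * Pᵀ = splitGram K := by
    rw [← Matrix.ext_iff]
    simp only [forall_idx]
    simp [P, Matrix.mul_apply, Fin.sum_univ_three, gram, splitGram, bar_inl_zero, bar_inl_one,
      bar_inr_zero,
      bar_inr_one, bar_inr_two, Matrix.one_apply]
    all_goals grind
  obtain ⟨U, hU⟩ := exists_GL_of_form h1
  refine ⟨U, by rw [hU, h1], ?_⟩
  rw [hU, ← Matrix.ext_iff]
  simp only [forall_idx]
  simp [P, boost]

/-- Coordinates in which `Q` is split and `J` is diagonal: the rows of `P` are left eigenvectors of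
`J`, for the eigenvalues `r, -r, r, -r, 0` with `r² = -1`. -/
theorem exists_splitting_complexStr {r : K} (hr : r * r = -1) : ∃ P : GL Idx K,
    (P : Matrix Idx Idx K) * gram K * (P : Matrix Idx Idx K)ᵀ = splitGram K ∧
    (P : Matrix Idx Idx K) * complexStr K =
      Matrix.diagonal (Sum.elim ![r, -r] ![r, -r, 0]) * (P : Matrix Idx Idx K) := by
  let P : Matrix Idx Idx K := Matrix.of <| Sum.elim
    ![Sum.elim ![1 / 2, 1] ![r, 0, 0], Sum.elim ![1 / 4, 1 / 2] ![-r / 2, 0, 0]]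
    ![Sum.elim ![0, 0] ![0, 1, r], Sum.elim ![0, 0] ![0, 1 / 2, -r / 2],
      Sum.elim ![-r / 2, r] ![0, 0, 0]]
  have h1 : P * gram K * Pᵀ = splitGram K := by
    rw [← Matrix.ext_iff]
    simp only [forall_idx]
    simp [P, Matrix.mul_apply, Fin.sum_univ_three, gram, splitGram, bar_inl_zero, bar_inl_one,
      bar_inr_zero,
      bar_inr_one, bar_inr_two, Matrix.one_apply]
    all_goals grind
  obtain ⟨U, hU⟩ := exists_GL_of_form h1
  refine ⟨U, by rw [hU, h1], ?_⟩
  rw [hU, ← Matrix.ext_iff]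
  simp only [forall_idx]
  simp [P, complexStr, Matrix.mul_apply, Fin.sum_univ_three]
  all_goals grind

end Splittings

/-! ### Smallness over a field of characteristic zero -/

section BaseChange

variable {F : Type} [Field F] [CharZero F]

theorem map_gram {F R : Type} [Field F] [CommRing R] [Algebra F R] :
    (gram F).map (algebraMap F R) = gram R := by
  rw [← Matrix.ext_iff]
  simp only [forall_idx]
  simp [gram]

theorem map_boost {F R : Type} [Field F] [Field R] [Algebra F R] :
    (boost F).map (algebraMap F R) = boost R := by
  rw [← Matrix.ext_iff]
  simp only [forall_idx]
  simp [boost]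

theorem map_complexStr {F R : Type} [Field F] [Field R] [Algebra F R] :
    (complexStr F).map (algebraMap F R) = complexStr R := by
  have h2 : algebraMap F R 2 = 2 := map_ofNat _ 2
  rw [← Matrix.ext_iff]
  simp only [forall_idx]
  simp [complexStr, h2]

theorem isSmallOver_centGroup {C : Matrix Idx Idx F}
    (h : IsSmall (soPoints (AlgebraicClosure F))
      (centPoints (C.map (algebraMap F (AlgebraicClosure F))))) :
    IsSmallOver (soGroup F) (centGroup C) :=
  ⟨fun _ _ _ => centPoints_le _, h⟩

theorem isSmallOver_boost : IsSmallOver (soGroup F) (centGroup (boost F)) := by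
  apply isSmallOver_centGroup
  rw [map_boost]
  obtain ⟨r, hr⟩ := exists_sq_eq_neg_one (AlgebraicClosure F)
  obtain ⟨P, hP, hC⟩ := exists_splitting_boost hr
  exact isSmall_centPoints_short one_ne_zero hC hP

/-- The centralizer in `SO(Q)` of any conjugate of `J` under `SO(Q)(F)` is small: if `P` splits `Q`
and diagonalizes `J`, then `P g` does so for `g⁻¹ J g`. -/
theorem isSmallOver_conj_complexStr {g : GL Idx F} (hg : g ∈ soPoints F) :
    IsSmallOver (soGroup F)
      (centGroup ((g⁻¹ : GL Idx F) * complexStr F * (g : Matrix Idx Idx F))) := by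
  apply isSmallOver_centGroup
  obtain ⟨r, hr⟩ := exists_sq_eq_neg_one (AlgebraicClosure F)
  obtain ⟨P, hP, hC⟩ := exists_splitting_complexStr hr
  let φ := algebraMap F (AlgebraicClosure F)
  let g' : GL Idx (AlgebraicClosure F) := Matrix.GeneralLinearGroup.map φ g
  have e1 : (g' : Matrix Idx Idx (AlgebraicClosure F)) = (g : Matrix Idx Idx F).map φ := rfl
  have e2 : ((g'⁻¹ : GL Idx _) : Matrix Idx Idx (AlgebraicClosure F)) =
      ((g⁻¹ : GL Idx F) : Matrix Idx Idx F).map φ := by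
    rw [← map_inv]; rfl
  have hform : (g' : Matrix Idx Idx _) * gram _ * (g' : Matrix Idx Idx _)ᵀ =
      gram (AlgebraicClosure F) := by
    rw [e1, ← map_gram (F := F), ← Matrix.transpose_map, ← Matrix.map_mul, ← Matrix.map_mul, hg.1]
  rw [Matrix.map_mul, Matrix.map_mul, map_complexStr, ← e1, ← e2]
  have hr0 : r ≠ 0 := by
    rintro rfl
    simp at hr
  refine isSmall_centPoints_long (P := P * g') hr0 ?_ ?_
  · rw [Units.val_mul]
    have e3 : (g' : Matrix Idx Idx (AlgebraicClosure F)) *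
        ((g'⁻¹ : GL Idx (AlgebraicClosure F)) : Matrix Idx Idx (AlgebraicClosure F)) = 1 := by
      rw [← Units.val_mul, mul_inv_cancel, Units.val_one]
    rw [← mul_assoc, ← mul_assoc, mul_assoc _ _ (Units.val g'⁻¹), e3, mul_one, hC, mul_assoc]
  · rw [Units.val_mul, Matrix.transpose_mul, ← mul_assoc, mul_assoc _ (Units.val g'),
      mul_assoc _ (Units.val g' * _), hform, hP]

end BaseChange

/-! ### The real group `AM` -/

section RealPoints

theorem A_le_centPoints_boost : A ≤ centPoints (boost ℝ) := by
  rintro g ⟨a, ha, hg⟩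
  refine ⟨⟨?_, ?_⟩, ?_⟩
  · rw [hg, gram, Matrix.fromBlocks_transpose, Matrix.fromBlocks_multiply,
      Matrix.fromBlocks_multiply]
    congr 1
    · ext i j; fin_cases i <;> fin_cases j <;> simp [ha.ne']
    all_goals simp
  · rw [hg, Matrix.det_fromBlocks_zero₂₁, Matrix.det_one, Matrix.det_diagonal]
    simp [ha.ne']
  · rw [hg, ← Matrix.ext_iff, boost]
    simp only [forall_idx]
    simp

theorem M_le_centPoints_boost : M ≤ centPoints (boost ℝ) := by
  rintro g ⟨ε, m, hε, hm, hg⟩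
  obtain ⟨hm1, hm2⟩ := Matrix.mem_specialOrthogonalGroup_iff.1 hm
  replace hm1 : m * mᵀ = 1 := (Matrix.mem_orthogonalGroup_iff _ _).1 hm1
  have hε' : ε * ε = 1 := by rcases hε with rfl | rfl <;> norm_num
  refine ⟨⟨?_, ?_⟩, ?_⟩
  · rw [hg, gram, Matrix.fromBlocks_transpose, Matrix.fromBlocks_multiply,
      Matrix.fromBlocks_multiply]
    simp [hm1, hε']
  · rw [hg, Matrix.det_fromBlocks_zero₂₁, hm2, Matrix.det_smul]
    simp [sq, hε']
  · rw [hg, ← Matrix.ext_iff, boost]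
    simp only [forall_idx]
    simp

/-- An element of the centralizer of `boost` is block diagonal, with a diagonal first block. -/
theorem exists_of_mem_centPoints_boost {g : GL Idx ℝ} (hg : g ∈ centPoints (boost ℝ)) :
    ∃ (x y : ℝ) (m : Matrix (Fin 3) (Fin 3) ℝ), x * y = 1 ∧
      m ∈ Matrix.specialOrthogonalGroup (Fin 3) ℝ ∧
      (g : Matrix Idx Idx ℝ) = Matrix.fromBlocks (Matrix.diagonal ![x, y]) 0 0 m := by
  obtain ⟨⟨h1, h2⟩, h3⟩ := hg
  have hform : (g : Matrix Idx Idx ℝ) = Matrix.fromBlocks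
      (Matrix.diagonal ![(g : Matrix Idx Idx ℝ) (Sum.inl 0) (Sum.inl 0),
        (g : Matrix Idx Idx ℝ) (Sum.inl 1) (Sum.inl 1)]) 0 0
      (g : Matrix Idx Idx ℝ).toBlocks₂₂ := by
    have h4 : ∀ i j, (g : Matrix Idx Idx ℝ) i j * (Sum.elim ![1, -1] ![0, 0, 0] : Idx → ℝ) j =
        (Sum.elim ![1, -1] ![0, 0, 0] : Idx → ℝ) i * (g : Matrix Idx Idx ℝ) i j := by
      intro i j
      have := congrFun₂ h3 i j
      rwa [boost, Matrix.mul_diagonal, Matrix.diagonal_mul] at this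
    simp only [forall_idx] at h4
    rw [← Matrix.ext_iff]
    simp only [forall_idx]
    simp [Matrix.toBlocks₂₂] at h4 ⊢
    grind
  generalize (g : Matrix Idx Idx ℝ) (Sum.inl 0) (Sum.inl 0) = x at hform
  generalize (g : Matrix Idx Idx ℝ) (Sum.inl 1) (Sum.inl 1) = y at hform
  generalize (g : Matrix Idx Idx ℝ).toBlocks₂₂ = m at hform
  have hxy : x * y = 1 := by
    have := congrFun₂ h1 (Sum.inl 0) (Sum.inl 1)
    rw [hform] at this
    simpa [gram, Matrix.fromBlocks_multiply, Matrix.fromBlocks_transpose] using this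
  refine ⟨x, y, m, hxy, ?_, hform⟩
  · have h4 : x * y = 1 := hxy
    refine Matrix.mem_specialOrthogonalGroup_iff.2 ⟨(Matrix.mem_orthogonalGroup_iff _ _).2 ?_, ?_⟩
    · have := congrArg Matrix.toBlocks₂₂ h1
      rw [hform] at this
      simpa [gram, Matrix.fromBlocks_multiply, Matrix.fromBlocks_transpose] using this
    · rw [hform, Matrix.det_fromBlocks_zero₂₁, Matrix.det_diagonal] at h2
      simpa [h4] using h2

/-- The element `diag(a, a⁻¹, 1, 1, 1)` of `A`. -/
def boostGL (a : ℝ) (ha : 0 < a) : GL Idx ℝ where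
  val := Matrix.fromBlocks (Matrix.diagonal ![a, a⁻¹]) 0 0 1
  inv := Matrix.fromBlocks (Matrix.diagonal ![a⁻¹, a]) 0 0 1
  val_inv := by
    rw [Matrix.fromBlocks_multiply, ← Matrix.fromBlocks_one]
    congr 1
    · ext i j; fin_cases i <;> fin_cases j <;> simp [ha.ne']
    all_goals simp
  inv_val := by
    rw [Matrix.fromBlocks_multiply, ← Matrix.fromBlocks_one]
    congr 1
    · ext i j; fin_cases i <;> fin_cases j <;> simp [ha.ne']
    all_goals simp

theorem boostGL_mem_A (a : ℝ) (ha : 0 < a) : boostGL a ha ∈ A := ⟨a, ha, rfl⟩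

theorem boostGL_mem_G (a : ℝ) (ha : 0 < a) : boostGL a ha ∈ G :=
  (A_le_centPoints_boost (boostGL_mem_A a ha)).1

theorem centPoints_boost : centPoints (boost ℝ) = AM := by
  refine le_antisymm (fun g hg => ?_) (sup_le A_le_centPoints_boost M_le_centPoints_boost)
  obtain ⟨x, y, m, hxy, hm, hgm⟩ := exists_of_mem_centPoints_boost hg
  have hx : x ≠ 0 := left_ne_zero_of_mul_eq_one hxy
  have hx' := abs_pos.2 hx
  rw [← mul_inv_cancel_left (boostGL |x| hx') g]
  refine Subgroup.mul_mem_sup (boostGL_mem_A _ _) ⟨x / |x|, m, ?_, hm, ?_⟩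
  · rcases abs_choice x with h | h <;> rw [h]
    · left; field_simp
    · right; field_simp
  · rw [Units.val_mul, hgm]
    change Matrix.fromBlocks (Matrix.diagonal ![|x|⁻¹, |x|]) 0 0 1 * _ = _
    rw [Matrix.fromBlocks_multiply]
    congr 1
    · have hy : y = x⁻¹ := eq_inv_of_mul_eq_one_right hxy
      have hxx : |x| * |x| = x * x := abs_mul_abs_self x
      ext i j
      fin_cases i <;> fin_cases j <;> simp [hy]
      · field_simp
      · field_simp
        linarith
    all_goals simp

end RealPoints

end SmallSubgroups
end

noncomputable section
set_option linter.unusedSectionVars false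
namespace SmallSubgroups

open scoped Quaternion

/-! ### Quaternions and the Lie algebra of `SO(4)` -/

section Quaternions

/-- Left multiplication by `q` on `ℍ = ℝ⁴`. -/
def leftMul (q : ℍ[ℝ]) : Matrix (Fin 4) (Fin 4) ℝ :=
  !![q.re, -q.imI, -q.imJ, -q.imK;
     q.imI, q.re, -q.imK, q.imJ;
     q.imJ, q.imK, q.re, -q.imI;
     q.imK, -q.imJ, q.imI, q.re]

/-- Right multiplication by `q` on `ℍ = ℝ⁴`. -/
def rightMul (q : ℍ[ℝ]) : Matrix (Fin 4) (Fin 4) ℝ :=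
  !![q.re, -q.imI, -q.imJ, -q.imK;
     q.imI, q.re, q.imK, -q.imJ;
     q.imJ, -q.imK, q.re, q.imI;
     q.imK, q.imJ, -q.imI, q.re]

/-- The imaginary unit `i`. -/
def quatI : ℍ[ℝ] := ⟨0, 1, 0, 0⟩

theorem quatI_re : quatI.re = 0 := rfl

theorem quatI_imI : quatI.imI = 1 := rfl

theorem quatI_imJ : quatI.imJ = 0 := rfl

theorem quatI_imK : quatI.imK = 0 := rfl

theorem leftMul_mul (p q : ℍ[ℝ]) : leftMul (p * q) = leftMul p * leftMul q := by
  ext i j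
  fin_cases i <;> fin_cases j <;>
    simp [leftMul, Matrix.mul_apply, Fin.sum_univ_four] <;> ring

theorem rightMul_mul (p q : ℍ[ℝ]) : rightMul (p * q) = rightMul q * rightMul p := by
  ext i j
  fin_cases i <;> fin_cases j <;>
    simp [rightMul, Matrix.mul_apply, Fin.sum_univ_four] <;> ring

theorem leftMul_mul_rightMul (p q : ℍ[ℝ]) : leftMul p * rightMul q = rightMul q * leftMul p := by
  ext i j
  fin_cases i <;> fin_cases j <;>
    simp [leftMul, rightMul, Matrix.mul_apply, Fin.sum_univ_four] <;> ring

theorem leftMul_star (q : ℍ[ℝ]) : leftMul (star q) = (leftMul q)ᵀ := by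
  ext i j
  fin_cases i <;> fin_cases j <;> simp [leftMul]

theorem rightMul_star (q : ℍ[ℝ]) : rightMul (star q) = (rightMul q)ᵀ := by
  ext i j
  fin_cases i <;> fin_cases j <;> simp [rightMul]

theorem leftMul_one : leftMul 1 = 1 := by
  ext i j
  fin_cases i <;> fin_cases j <;> simp [leftMul]

theorem rightMul_one : rightMul 1 = 1 := by
  ext i j
  fin_cases i <;> fin_cases j <;> simp [rightMul]

theorem leftMul_add (p q : ℍ[ℝ]) : leftMul (p + q) = leftMul p + leftMul q := by
  ext i j
  fin_cases i <;> fin_cases j <;> simp [leftMul] <;> ring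

theorem rightMul_add (p q : ℍ[ℝ]) : rightMul (p + q) = rightMul p + rightMul q := by
  ext i j
  fin_cases i <;> fin_cases j <;> simp [rightMul] <;> ring

theorem leftMul_smul (c : ℝ) (q : ℍ[ℝ]) : leftMul (c • q) = c • leftMul q := by
  ext i j
  fin_cases i <;> fin_cases j <;> simp [leftMul]

theorem rightMul_smul (c : ℝ) (q : ℍ[ℝ]) : rightMul (c • q) = c • rightMul q := by
  ext i j
  fin_cases i <;> fin_cases j <;> simp [rightMul]

/-- `𝔰𝔬(4) = 𝔰𝔬(3) ⊕ 𝔰𝔬(3)`, the left and right multiplications by imaginary quaternions. -/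
theorem exists_of_skew {N : Matrix (Fin 4) (Fin 4) ℝ} (hN : Nᵀ = -N) :
    ∃ a b : ℍ[ℝ], a.re = 0 ∧ b.re = 0 ∧ N = leftMul a + rightMul b := by
  refine ⟨⟨0, (N 1 0 + N 3 2) / 2, (N 2 0 + N 1 3) / 2, (N 3 0 + N 2 1) / 2⟩,
    ⟨0, (N 1 0 - N 3 2) / 2, (N 2 0 - N 1 3) / 2, (N 3 0 - N 2 1) / 2⟩, rfl, rfl, ?_⟩
  have h : ∀ i j, N i j = -N j i := fun i j => by
    have := congrFun₂ hN j i
    simpa using this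
  ext i j
  fin_cases i <;> fin_cases j <;> simp [leftMul, rightMul] <;>
    linarith [h 0 0, h 1 1, h 2 2, h 3 3, h 0 1, h 0 2, h 0 3, h 1 2, h 1 3, h 2 3]

theorem leftMul_add_rightMul_inj {a b a' b' : ℍ[ℝ]} (ha : a.re = a'.re)
    (h : leftMul a + rightMul b = leftMul a' + rightMul b') : a = a' ∧ b = b' := by
  have h' := fun i j => congrFun₂ h i j
  have e := fun i => h' i 0
  have e1 := h' 3 2
  have e2 := h' 1 3
  have e3 := h' 2 1
  simp [leftMul, rightMul, Fin.forall_fin_succ] at e e1 e2 e3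
  constructor <;> ext <;> linarith

/-- The imaginary quaternions commuting with a nonzero imaginary quaternion are its multiples. -/
theorem exists_smul_of_commute {a x : ℍ[ℝ]} (ha : a.re = 0) (hx : x.re = 0) (h0 : a ≠ 0)
    (h : a * x = x * a) : ∃ t : ℝ, x = t • a := by
  have h1 : star (a * x) = a * x := by
    rw [star_mul, Quaternion.star_eq_neg.2 ha, Quaternion.star_eq_neg.2 hx, neg_mul_neg, h]
  have h2 : a * x = ((a * x).re : ℍ[ℝ]) := Quaternion.star_eq_self.1 h1
  have h3 : star a * (a * x) = ((Quaternion.normSq a : ℝ) : ℍ[ℝ]) * x := by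
    rw [← mul_assoc, Quaternion.star_mul_self]
  have h4 := Quaternion.normSq_ne_zero.2 h0
  refine ⟨-((a * x).re / Quaternion.normSq a), ?_⟩
  rw [h2, Quaternion.star_eq_neg.2 ha, Quaternion.mul_coe_eq_smul, Quaternion.coe_mul_eq_smul] at h3
  rw [neg_smul, div_eq_inv_mul, mul_smul, ← smul_neg, ← smul_neg, h3, smul_smul, inv_mul_cancel₀ h4,
    one_smul]

/-- Every nonzero imaginary quaternion is conjugate to a multiple of `i`. -/
theorem exists_unit_conj_quatI {a : ℍ[ℝ]} (ha : a.re = 0) (h0 : a ≠ 0) :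
    ∃ (q : ℍ[ℝ]) (c : ℝ), q * star q = 1 ∧ c ≠ 0 ∧ q * a = c • (quatI * q) := by
  obtain ⟨n, hn0, hn⟩ : ∃ n : ℝ, n ≠ 0 ∧ n ^ 2 = Quaternion.normSq a :=
    ⟨√(Quaternion.normSq a),
      Real.sqrt_ne_zero'.2 (lt_of_le_of_ne Quaternion.normSq_nonneg
        (Quaternion.normSq_ne_zero.2 h0).symm),
      Real.sq_sqrt Quaternion.normSq_nonneg⟩
  by_cases hq : n • quatI + a = 0
  · refine ⟨1, -n, by simp, neg_ne_zero.2 hn0, ?_⟩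
    rw [one_mul, mul_one, neg_smul]
    exact eq_neg_of_add_eq_zero_right hq
  · -- `(n i + a) a = n i (n i + a)`, since `a² = -n² = (n i)²`
    have h1 : (n • quatI + a) * a = n • (quatI * (n • quatI + a)) := by
      rw [Quaternion.normSq_def', ha] at hn
      ext <;> simp [quatI_re, quatI_imI, quatI_imJ, quatI_imK, ha] <;> linarith
    have hm := Quaternion.normSq_ne_zero.2 hq
    set m := Quaternion.normSq (n • quatI + a) with hm'
    have hs : (√m)⁻¹ * (√m)⁻¹ * m = 1 := by
      have : √m * √m = m := Real.mul_self_sqrt Quaternion.normSq_nonneg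
      have h5 : √m ≠ 0 := by
        intro h; rw [h] at this; exact hm (by rw [← this]; ring)
      field_simp
      rw [sq, this]
    refine ⟨(√m)⁻¹ • (n • quatI + a), n, ?_, hn0, ?_⟩
    · rw [Quaternion.star_smul, smul_mul_smul_comm, Quaternion.self_mul_star, ← hm',
        ← Quaternion.coe_mul_eq_smul, ← Quaternion.coe_mul, hs, Quaternion.coe_one]
    · rw [smul_mul_assoc, h1, mul_smul_comm, smul_comm]

end Quaternions

/-! ### The positive definite part of `Q` -/

section Embedding

/-- The orthonormal vectors `f₁ = (e₀ + e₁)/√2, e₂, e₃, e₄`, as the columns of a matrix.  They span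
the positive definite part of `Q`. -/
def posBasis : Matrix Idx (Fin 4) ℝ :=
  Matrix.of <| Sum.elim ![![√2 / 2, 0, 0, 0], ![√2 / 2, 0, 0, 0]]
    ![![0, 1, 0, 0], ![0, 0, 1, 0], ![0, 0, 0, 1]]

/-- The orthogonal projection to the line of `f₀ = (e₀ - e₁)/√2`. -/
def negProj : Matrix Idx Idx ℝ := Matrix.fromBlocks !![1 / 2, -1 / 2; -1 / 2, 1 / 2] 0 0 0

theorem half_sqrt_two : √2 / 2 * (√2 / 2) = 1 / 2 := by
  have : √2 * √2 = 2 := Real.mul_self_sqrt (by norm_num)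
  linarith

theorem posBasis_transpose_mul : posBasisᵀ * posBasis = 1 := by
  have := half_sqrt_two
  ext i j
  fin_cases i <;> fin_cases j <;> simp [posBasis, Matrix.mul_apply, Fin.sum_univ_three]
  grind

theorem posBasis_mul_transpose : posBasis * posBasisᵀ = 1 - negProj := by
  have := half_sqrt_two
  rw [← Matrix.ext_iff]
  simp only [forall_idx]
  simp [posBasis, negProj, Matrix.mul_apply, Fin.sum_univ_four]
  grind

theorem negProj_mul_posBasis : negProj * posBasis = 0 := by
  rw [← Matrix.ext_iff]
  simp only [forall_idx, Fin.forall_fin_succ]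
  simp [posBasis, negProj, Matrix.mul_apply]
  grind

theorem negProj_transpose : negProjᵀ = negProj := by
  rw [← Matrix.ext_iff]
  simp only [forall_idx]
  simp [negProj]

theorem posBasis_transpose_mul_negProj : posBasisᵀ * negProj = 0 := by
  rw [← negProj_transpose, ← Matrix.transpose_mul, negProj_mul_posBasis, Matrix.transpose_zero]

theorem negProj_mul_self : negProj * negProj = negProj := by
  rw [← Matrix.ext_iff]
  simp only [forall_idx]
  simp [negProj, Matrix.mul_apply]
  grind

theorem gram_eq : gram ℝ = 1 - (2 : ℝ) • negProj := by
  rw [← Matrix.ext_iff]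
  simp only [forall_idx]
  simp [negProj, gram]
  norm_num

/-- `negProj * X * negProj` is a multiple of `negProj`, as `negProj` has rank one. -/
theorem negProj_mul_mul_negProj (X : Matrix Idx Idx ℝ) :
    ∃ c : ℝ, negProj * X * negProj = c • negProj ∧ (Xᵀ = -X → c = 0) := by
  refine ⟨(X (Sum.inl 0) (Sum.inl 0) - X (Sum.inl 0) (Sum.inl 1) - X (Sum.inl 1) (Sum.inl 0) +
    X (Sum.inl 1) (Sum.inl 1)) / 2, ?_, fun h => ?_⟩
  · rw [← Matrix.ext_iff]
    simp only [forall_idx]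
    simp [negProj, Matrix.mul_apply]
    grind
  · have h1 := congrFun₂ h (Sum.inl 0) (Sum.inl 0)
    have h2 := congrFun₂ h (Sum.inl 0) (Sum.inl 1)
    have h3 := congrFun₂ h (Sum.inl 1) (Sum.inl 1)
    simp at h1 h2 h3
    linarith

/-- A matrix of size four, regarded as acting on the positive definite part of `Q`, and by zero on
the orthogonal complement. -/
def emb (N : Matrix (Fin 4) (Fin 4) ℝ) : Matrix Idx Idx ℝ := posBasis * N * posBasisᵀ

theorem emb_mul (N N' : Matrix (Fin 4) (Fin 4) ℝ) : emb N * emb N' = emb (N * N') := by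
  simp only [emb]
  calc _ = posBasis * N * (posBasisᵀ * posBasis) * N' * posBasisᵀ := by simp only [Matrix.mul_assoc]
    _ = _ := by rw [posBasis_transpose_mul, Matrix.mul_one, Matrix.mul_assoc posBasis]

theorem emb_one : emb 1 = 1 - negProj := by rw [emb, Matrix.mul_one, posBasis_mul_transpose]

theorem emb_add (N N' : Matrix (Fin 4) (Fin 4) ℝ) : emb (N + N') = emb N + emb N' := by
  simp only [emb, Matrix.mul_add, Matrix.add_mul]

theorem emb_smul (c : ℝ) (N : Matrix (Fin 4) (Fin 4) ℝ) : emb (c • N) = c • emb N := by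
  simp only [emb, Matrix.mul_smul, Matrix.smul_mul]

theorem emb_transpose (N : Matrix (Fin 4) (Fin 4) ℝ) : (emb N)ᵀ = emb Nᵀ := by
  simp only [emb, Matrix.transpose_mul, Matrix.transpose_transpose, Matrix.mul_assoc]

theorem emb_mul_negProj (N : Matrix (Fin 4) (Fin 4) ℝ) : emb N * negProj = 0 := by
  rw [emb, Matrix.mul_assoc, posBasis_transpose_mul_negProj, Matrix.mul_zero]

theorem negProj_mul_emb (N : Matrix (Fin 4) (Fin 4) ℝ) : negProj * emb N = 0 := by
  rw [emb, ← Matrix.mul_assoc, ← Matrix.mul_assoc, negProj_mul_posBasis, Matrix.zero_mul,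
    Matrix.zero_mul]

theorem emb_injective : Function.Injective emb := by
  intro N N' h
  have : ∀ N, posBasisᵀ * emb N * posBasis = N := fun N => by
    simp only [emb]
    calc _ = (posBasisᵀ * posBasis) * N * (posBasisᵀ * posBasis) := by simp only [Matrix.mul_assoc]
      _ = _ := by rw [posBasis_transpose_mul, Matrix.one_mul, Matrix.mul_one]
  rw [← this N, h, this]

theorem emb_mul_gram (N : Matrix (Fin 4) (Fin 4) ℝ) : emb N * gram ℝ = emb N := by
  rw [gram_eq, Matrix.mul_sub, Matrix.mul_one, Matrix.mul_smul, emb_mul_negProj, smul_zero,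
      sub_zero]

theorem gram_mul_emb (N : Matrix (Fin 4) (Fin 4) ℝ) : gram ℝ * emb N = emb N := by
  rw [gram_eq, Matrix.sub_mul, Matrix.one_mul, Matrix.smul_mul, negProj_mul_emb, smul_zero,
      sub_zero]

theorem commute_negProj {X : Matrix Idx Idx ℝ} (h : X * gram ℝ = gram ℝ * X) :
    X * negProj = negProj * X := by
  simp only [gram_eq, Matrix.mul_sub, Matrix.sub_mul, Matrix.mul_one, Matrix.one_mul,
    Matrix.mul_smul, Matrix.smul_mul, sub_right_inj] at h
  exact smul_right_injective _ (two_ne_zero (α := ℝ)) h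

/-- A matrix that commutes with the projection to `f₀` is block diagonal. -/
theorem exists_emb_of_commute {X : Matrix Idx Idx ℝ} (h : X * negProj = negProj * X) :
    ∃ (N : Matrix (Fin 4) (Fin 4) ℝ) (c : ℝ), X = emb N + c • negProj ∧
      N = posBasisᵀ * X * posBasis ∧ (Xᵀ = -X → c = 0) := by
  obtain ⟨c, hc, hc0⟩ := negProj_mul_mul_negProj X
  refine ⟨_, c, ?_, rfl, hc0⟩
  have h1 : emb (posBasisᵀ * X * posBasis) = (1 - negProj) * X * (1 - negProj) := by
    rw [emb, ← posBasis_mul_transpose]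
    simp only [Matrix.mul_assoc]
  have h2 : X * negProj = c • negProj := by
    rw [← hc, ← h, Matrix.mul_assoc, negProj_mul_self]
  have h3 : negProj * X = c • negProj := by rw [← h, h2]
  rw [h1, Matrix.sub_mul, Matrix.one_mul, h3, Matrix.mul_sub, Matrix.mul_one, Matrix.sub_mul, h2,
    Matrix.smul_mul, negProj_mul_self]
  abel

end Embedding

end SmallSubgroups
end

noncomputable section
set_option linter.unusedSectionVars false
namespace SmallSubgroups

/-! ### Exponentials of matrices -/

section Banach

variable {𝔸 : Type*} [NormedRing 𝔸] [NormedAlgebra ℝ 𝔸] [CompleteSpace 𝔸]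

/-- Rodrigues' rotation formula, in a Banach algebra. -/
theorem exp_smul_eq_of_cube_of_normed {N : 𝔸} (hN : N * N * N = -N) (t : ℝ) :
    NormedSpace.exp (t • N) = 1 + Real.sin t • N + (1 - Real.cos t) • (N * N) := by
  let f : ℝ → 𝔸 := fun t => NormedSpace.exp (t • (-N)) *
      (1 + Real.sin t • N + (1 - Real.cos t) • (N * N))
  have hf : ∀ t, HasDerivAt f 0 t := fun t => by
    have h1 := hasDerivAt_exp_smul_const (𝕂 := ℝ) (-N) t
    have h2 : HasDerivAt (fun t => 1 + Real.sin t • N + (1 - Real.cos t) • (N * N))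
        (Real.cos t • N + Real.sin t • (N * N)) t := by
      have h3 := ((Real.hasDerivAt_sin t).smul_const N).const_add 1
      have h4 := ((Real.hasDerivAt_cos t).const_sub 1).smul_const (N * N)
      rw [neg_neg] at h4
      exact h3.add h4
    convert! h1.mul h2 using 1
    have h5 : N * (N * N) = -N := by rw [← mul_assoc, hN]
    rw [mul_assoc, ← mul_add]
    simp only [neg_mul, mul_neg, mul_add, mul_one, mul_smul_comm, h5]
    module
  have h0 : f t = f 0 := is_const_of_deriv_eq_zero (fun t => (hf t).differentiableAt)
    (fun t => (hf t).deriv) t 0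
  have h6 : f 0 = 1 := by simp [f]
  let : NormedAlgebra ℚ 𝔸 := NormedAlgebra.restrictScalars ℚ ℝ 𝔸
  have h7 : NormedSpace.exp (t • N) * NormedSpace.exp (t • (-N)) = 1 := by
    rw [← NormedSpace.exp_add_of_commute]
    · simp
    · rw [smul_neg]
      exact (Commute.refl _).neg_right
  calc NormedSpace.exp (t • N) = NormedSpace.exp (t • N) * f t := by rw [h0, h6, mul_one]
    _ = _ := by rw [← mul_assoc, h7, one_mul]

/-- If the one-parameter groups of `X` and `Y` fix `C`, by multiplication on the two sides, then so
do `X` and `Y` infinitesimally. -/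
theorem form_of_exp_of_normed {X Y C : 𝔸}
    (h : ∀ t : ℝ, NormedSpace.exp (t • X) * C * NormedSpace.exp (t • Y) = C) :
    X * C + C * Y = 0 := by
  have h1 := hasDerivAt_exp_smul_const (𝕂 := ℝ) X 0
  have h2 := hasDerivAt_exp_smul_const (𝕂 := ℝ) Y 0
  have h3 := (h1.mul_const C).mul h2
  have h4 : HasDerivAt (fun t : ℝ => NormedSpace.exp (t • X) * C *
      NormedSpace.exp (t • Y)) 0 0 := by
    simp only [h]
    exact hasDerivAt_const _ _
  have := h3.unique h4
  simpa using this

end Banach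

section MatrixExp

variable {n : Type*} [Fintype n] [DecidableEq n]

open scoped Matrix.Norms.Operator in
theorem exp_smul_eq_of_cube {N : Matrix n n ℝ} (hN : N * N * N = -N) (t : ℝ) :
    NormedSpace.exp (t • N) = 1 + Real.sin t • N + (1 - Real.cos t) • (N * N) :=
  exp_smul_eq_of_cube_of_normed hN t

open scoped Matrix.Norms.Operator in
theorem form_of_exp {X Y C : Matrix n n ℝ}
    (h : ∀ t : ℝ, NormedSpace.exp (t • X) * C * NormedSpace.exp (t • Y) = C) :
    X * C + C * Y = 0 :=
  form_of_exp_of_normed h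

end MatrixExp

/-! ### Exponentials in the maximal compact subgroup -/

section OrthogonalExp

theorem exp_mul_comm {X C : Matrix Idx Idx ℝ} (h : X * C = C * X) :
    NormedSpace.exp X * C = C * NormedSpace.exp X :=
  Commute.exp_left (show Commute X C from h)

theorem exp_mul_exp_neg (X : Matrix Idx Idx ℝ) : NormedSpace.exp X * NormedSpace.exp (-X) = 1 := by
  rw [← Matrix.exp_add_of_commute _ _ (Commute.refl X).neg_right, add_neg_cancel,
      NormedSpace.exp_zero]

theorem mem_K_of_exp {X : Matrix Idx Idx ℝ} (hX : Xᵀ = -X) (hB : X * gram ℝ = gram ℝ * X)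
    {g : GL Idx ℝ} (hg : (g : Matrix Idx Idx ℝ) = NormedSpace.exp X) : g ∈ K := by
  have horth : ∀ Y : Matrix Idx Idx ℝ, Yᵀ = -Y →
      NormedSpace.exp Y * (NormedSpace.exp Y)ᵀ = 1 := fun Y hY => by
    rw [← Matrix.exp_transpose, hY, exp_mul_exp_neg]
  -- the determinant is a square, since `exp X = exp (X / 2) ^ 2`
  have hdet : (NormedSpace.exp X).det = 1 := by
    have h1 : NormedSpace.exp X = NormedSpace.exp ((1 / 2 : ℝ) • X) *
      NormedSpace.exp ((1 / 2 : ℝ) • X) := by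
      rw [← Matrix.exp_add_of_commute _ _ (Commute.refl _), ← add_smul]
      norm_num
    have h2 := congrArg Matrix.det (horth ((1 / 2 : ℝ) • X)
      (by rw [Matrix.transpose_smul, hX, smul_neg]))
    rw [Matrix.det_mul, Matrix.det_transpose, Matrix.det_one] at h2
    rw [h1, Matrix.det_mul, h2]
  have ho := horth X hX
  rw [← hg] at ho hdet
  refine ⟨⟨?_, hdet⟩, Matrix.mem_specialOrthogonalGroup_iff.2
    ⟨(Matrix.mem_orthogonalGroup_iff _ _).2 ho, hdet⟩⟩
  have hc : (g : Matrix Idx Idx ℝ) * gram ℝ = gram ℝ * (g : Matrix Idx Idx ℝ) := by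
    rw [hg, exp_mul_comm hB]
  rw [hc, Matrix.mul_assoc, ho, Matrix.mul_one]

/-- For orthogonal matrices, to preserve `Q` means to commute with its Gram matrix. -/
theorem mem_K_iff {g : GL Idx ℝ} : g ∈ K ↔ (g : Matrix Idx Idx ℝ) * gram ℝ = gram ℝ * g ∧
    (g : Matrix Idx Idx ℝ) * (g : Matrix Idx Idx ℝ)ᵀ = 1 ∧ (g : Matrix Idx Idx ℝ).det = 1 := by
  constructor
  · rintro ⟨⟨h1, h2⟩, h3⟩
    have h4 : (g : Matrix Idx Idx ℝ) * (g : Matrix Idx Idx ℝ)ᵀ = 1 :=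
      (Matrix.mem_orthogonalGroup_iff _ _).1 (Matrix.mem_specialOrthogonalGroup_iff.1 h3).1
    refine ⟨?_, h4, h2⟩
    have h5 : (g : Matrix Idx Idx ℝ)ᵀ * (g : Matrix Idx Idx ℝ) = 1 := mul_eq_one_comm.1 h4
    calc _ = (g : Matrix Idx Idx ℝ) * gram ℝ * ((g : Matrix Idx Idx ℝ)ᵀ *
      (g : Matrix Idx Idx ℝ)) := by
          rw [h5, Matrix.mul_one]
      _ = _ := by rw [← Matrix.mul_assoc, h1]
  · rintro ⟨h1, h2, h3⟩
    refine ⟨⟨?_, h3⟩, Matrix.mem_specialOrthogonalGroup_iff.2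
      ⟨(Matrix.mem_orthogonalGroup_iff _ _).2 h2, h3⟩⟩
    rw [h1, Matrix.mul_assoc, h2, Matrix.mul_one]

/-- The Lie algebra of a connected Lie subgroup of `K` consists of skew-symmetric matrices
commuting with the Gram matrix. -/
theorem skew_of_forall_exp_mem_K {X : Matrix Idx Idx ℝ}
    (h : ∀ (t : ℝ) (g : GL Idx ℝ), (g : Matrix Idx Idx ℝ) = NormedSpace.exp (t • X) → g ∈ K) :
    Xᵀ = -X ∧ X * gram ℝ = gram ℝ * X := by
  have h1 : ∀ t : ℝ, NormedSpace.exp (t • X) * gram ℝ = gram ℝ * NormedSpace.exp (t • X) ∧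
      NormedSpace.exp (t • X) * (NormedSpace.exp (t • X))ᵀ = 1 := fun t => by
    obtain ⟨g, hg⟩ := Matrix.isUnit_exp (t • X)
    have := mem_K_iff.1 (h t g hg)
    rw [hg] at this
    exact ⟨this.1, this.2.1⟩
  have h2 : Xᵀ = -X := by
    have : X * 1 + 1 * Xᵀ = 0 := form_of_exp fun t => by
      rw [Matrix.mul_one, ← Matrix.transpose_smul, Matrix.exp_transpose, (h1 t).2]
    rw [Matrix.mul_one, Matrix.one_mul] at this
    exact eq_neg_of_add_eq_zero_right this
  refine ⟨h2, ?_⟩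
  have : X * gram ℝ + gram ℝ * Xᵀ = 0 := form_of_exp fun t => by
    rw [← Matrix.transpose_smul, Matrix.exp_transpose, (h1 t).1, Matrix.mul_assoc, (h1 t).2,
      Matrix.mul_one]
  rw [h2, Matrix.mul_neg] at this
  exact add_neg_eq_zero.1 this

end OrthogonalExp

/-! ### Unit quaternions -/

section UnitQuaternions

open scoped Quaternion

/-- Polar form of a unit quaternion.  For `q = ±1` the axis `b` is chosen to be `i`. -/
theorem exists_polar {q : ℍ[ℝ]} (hq : q * star q = 1) :
    ∃ (t : ℝ) (b : ℍ[ℝ]), b.re = 0 ∧ b * b = -1 ∧ q = (Real.cos t : ℍ[ℝ]) + Real.sin t • b := by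
  have h1 : q.re ^ 2 + (q.imI ^ 2 + q.imJ ^ 2 + q.imK ^ 2) = 1 := by
    have := congrArg QuaternionAlgebra.re hq
    simp at this
    linarith
  set m := q.imI ^ 2 + q.imJ ^ 2 + q.imK ^ 2 with hm
  have hm0 : 0 ≤ m := by positivity
  have hc : Real.cos (Real.arccos q.re) = q.re :=
    Real.cos_arccos (by nlinarith) (by nlinarith)
  have hs : Real.sin (Real.arccos q.re) = √m := by
    rw [Real.sin_arccos]; congr 1; linarith
  rcases hm0.eq_or_lt with h0 | h0
  · refine ⟨Real.arccos q.re, quatI, rfl, ?_, ?_⟩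
    · ext <;> simp [quatI_re, quatI_imI, quatI_imJ, quatI_imK]
    · rw [hs, hc, ← h0, Real.sqrt_zero, zero_smul, add_zero]
      have h2 : q.imI = 0 := by nlinarith [sq_nonneg q.imI, sq_nonneg q.imJ, sq_nonneg q.imK]
      have h3 : q.imJ = 0 := by nlinarith [sq_nonneg q.imI, sq_nonneg q.imJ, sq_nonneg q.imK]
      have h4 : q.imK = 0 := by nlinarith [sq_nonneg q.imI, sq_nonneg q.imJ, sq_nonneg q.imK]
      ext <;> simp [h2, h3, h4]
  · have hsq : √m * √m = m := Real.mul_self_sqrt hm0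
    have hs0 : √m ≠ 0 := (Real.sqrt_pos.2 h0).ne'
    refine ⟨Real.arccos q.re, (√m)⁻¹ • q.im, by simp, ?_, ?_⟩
    · have h5 : q.im * q.im = ((-m : ℝ) : ℍ[ℝ]) := by
        ext
        · simp
          linarith
        all_goals simp
        all_goals ring
      have h6 : (√m)⁻¹ * (√m)⁻¹ * -m = -1 := by
        rw [← mul_inv, hsq, mul_neg, inv_mul_cancel₀ h0.ne']
      rw [smul_mul_smul_comm, h5, ← Quaternion.coe_mul_eq_smul, ← Quaternion.coe_mul, h6,
        Quaternion.coe_neg, Quaternion.coe_one]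
    · rw [hs, hc, smul_smul, mul_inv_cancel₀ hs0, one_smul]
      exact (Quaternion.re_add_im q).symm

/-- The rotation of `K` given by left multiplication by a unit quaternion is an exponential. -/
theorem emb_leftMul_add_negProj (b : ℍ[ℝ]) (hb : b * b = -1) (t : ℝ) :
    emb (leftMul ((Real.cos t : ℍ[ℝ]) + Real.sin t • b)) + negProj =
      NormedSpace.exp (t • emb (leftMul b)) := by
  have h2 : emb (leftMul b) * emb (leftMul b) = -(1 - negProj) := by
    rw [emb_mul, ← leftMul_mul, hb, ← emb_one, ← leftMul_one, ← neg_one_smul ℝ (1 : ℍ[ℝ]),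
      leftMul_smul,
      emb_smul, neg_one_smul]
  rw [exp_smul_eq_of_cube (by rw [h2, neg_mul, ← emb_one, emb_mul, one_mul]), h2, leftMul_add,
    leftMul_smul, emb_add, emb_smul, ← mul_one (Real.cos t : ℍ[ℝ]), Quaternion.coe_mul_eq_smul,
    leftMul_smul, emb_smul, leftMul_one, emb_one]
  module

/-- The rotation of `K` given by right multiplication by a unit quaternion is an exponential. -/
theorem emb_rightMul_add_negProj (b : ℍ[ℝ]) (hb : b * b = -1) (t : ℝ) :
    emb (rightMul ((Real.cos t : ℍ[ℝ]) + Real.sin t • b)) + negProj =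
      NormedSpace.exp (t • emb (rightMul b)) := by
  have h2 : emb (rightMul b) * emb (rightMul b) = -(1 - negProj) := by
    rw [emb_mul, ← rightMul_mul, hb, ← emb_one, ← rightMul_one, ← neg_one_smul ℝ (1 : ℍ[ℝ]),
      rightMul_smul,
      emb_smul, neg_one_smul]
  rw [exp_smul_eq_of_cube (by rw [h2, neg_mul, ← emb_one, emb_mul, one_mul]), h2, rightMul_add,
    rightMul_smul, emb_add, emb_smul, ← mul_one (Real.cos t : ℍ[ℝ]), Quaternion.coe_mul_eq_smul,
    rightMul_smul, emb_smul, rightMul_one, emb_one]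
  module

end UnitQuaternions

end SmallSubgroups
end

noncomputable section
set_option linter.unusedSectionVars false
namespace SmallSubgroups

open scoped Quaternion

/-! ### Centralizers in the Lie algebra of `K` -/

section SkewMatrices

/-- The centralizer of `Z` in the Lie algebra of `K`. -/
def skewCent (Z : Matrix Idx Idx ℝ) : Submodule ℝ (Matrix Idx Idx ℝ) where
  carrier := {X | (Xᵀ = -X ∧ X * gram ℝ = gram ℝ * X) ∧ X * Z = Z * X}
  zero_mem' := by simp
  add_mem' := by
    rintro X Y ⟨⟨h1, h2⟩, h3⟩ ⟨⟨h4, h5⟩, h6⟩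
    refine ⟨⟨?_, ?_⟩, ?_⟩
    · rw [Matrix.transpose_add, h1, h4, neg_add]
    · rw [Matrix.add_mul, Matrix.mul_add, h2, h5]
    · rw [Matrix.add_mul, Matrix.mul_add, h3, h6]
  smul_mem' := by
    rintro c X ⟨⟨h1, h2⟩, h3⟩
    refine ⟨⟨?_, ?_⟩, ?_⟩
    · rw [Matrix.transpose_smul, h1, smul_neg]
    · rw [Matrix.smul_mul, Matrix.mul_smul, h2]
    · rw [Matrix.smul_mul, Matrix.mul_smul, h3]

/-- The Lie algebra of `K` is `𝔰𝔬(4)`, hence made up of left and right multiplications by imaginary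
quaternions. -/
theorem exists_emb_of_skew {X : Matrix Idx Idx ℝ} (hX : Xᵀ = -X)
    (hB : X * gram ℝ = gram ℝ * X) :
    ∃ a b : ℍ[ℝ], a.re = 0 ∧ b.re = 0 ∧ X = emb (leftMul a + rightMul b) := by
  obtain ⟨N, c, h1, h2, h3⟩ := exists_emb_of_commute (commute_negProj hB)
  obtain ⟨a, b, ha, hb, hN⟩ := exists_of_skew (N := N) (by
    rw [h2, Matrix.transpose_mul, Matrix.transpose_mul, hX, Matrix.transpose_transpose]
    simp only [Matrix.neg_mul, Matrix.mul_neg, Matrix.mul_assoc])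
  exact ⟨a, b, ha, hb, by rw [h1, h3 hX, zero_smul, add_zero, hN]⟩

theorem leftMul_emb_skew {a : ℍ[ℝ]} (ha : a.re = 0) :
    (emb (leftMul a))ᵀ = -emb (leftMul a) := by
  rw [emb_transpose, ← leftMul_star, Quaternion.star_eq_neg.2 ha, ← neg_one_smul ℝ a, leftMul_smul,
    emb_smul, neg_one_smul]

theorem rightMul_emb_skew {a : ℍ[ℝ]} (ha : a.re = 0) :
    (emb (rightMul a))ᵀ = -emb (rightMul a) := by
  rw [emb_transpose, ← rightMul_star, Quaternion.star_eq_neg.2 ha, ← neg_one_smul ℝ a,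
      rightMul_smul,
    emb_smul, neg_one_smul]

theorem emb_comm_gram (N : Matrix (Fin 4) (Fin 4) ℝ) : emb N * gram ℝ = gram ℝ * emb N := by
  rw [emb_mul_gram, gram_mul_emb]

theorem commute_of_emb {a b a' b' : ℍ[ℝ]}
    (h : emb (leftMul a + rightMul b) * emb (leftMul a' + rightMul b') =
      emb (leftMul a' + rightMul b') * emb (leftMul a + rightMul b)) :
    a * a' = a' * a ∧ b * b' = b' * b := by
  rw [emb_mul, emb_mul] at h
  have h1 := emb_injective h
  have h2 : leftMul (a * a') + rightMul (b' * b) = leftMul (a' * a) + rightMul (b * b') := by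
    rw [leftMul_mul, leftMul_mul, rightMul_mul, rightMul_mul]
    simp only [Matrix.add_mul, Matrix.mul_add, leftMul_mul_rightMul] at h1
    rw [← sub_eq_zero] at h1 ⊢
    rw [← h1]
    abel
  have h3 := leftMul_add_rightMul_inj (by simp; ring) h2
  exact ⟨h3.1, h3.2.symm⟩

/-- The imaginary unit `j`. -/
def quatJ : ℍ[ℝ] := ⟨0, 0, 1, 0⟩

/-- The imaginary unit `k`. -/
def quatK : ℍ[ℝ] := ⟨0, 0, 0, 1⟩

theorem eq_sum_quat {a : ℍ[ℝ]} (ha : a.re = 0) :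
    a = a.imI • quatI + a.imJ • quatJ + a.imK • quatK := by
  have hJ : quatJ.re = 0 ∧ quatJ.imI = 0 ∧ quatJ.imJ = 1 ∧ quatJ.imK = 0 := ⟨rfl, rfl, rfl, rfl⟩
  have hK : quatK.re = 0 ∧ quatK.imI = 0 ∧ quatK.imJ = 0 ∧ quatK.imK = 1 := ⟨rfl, rfl, rfl, rfl⟩
  ext <;> simp [ha, hJ, hK, quatI_re, quatI_imI, quatI_imJ, quatI_imK]

theorem finrank_le_of_forall_exists {V : Type*} [AddCommGroup V] [Module ℝ V] {S : Submodule ℝ V}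
    {n : ℕ} (v : Fin n → V) (h : ∀ x ∈ S, ∃ c : Fin n → ℝ, ∑ i, c i • v i = x) :
    Module.finrank ℝ S ≤ n := by
  have h1 : S ≤ Submodule.span ℝ (Set.range v) := fun x hx =>
    (Submodule.mem_span_range_iff_exists_fun ℝ).2 (h x hx)
  have := FiniteDimensional.span_of_finite ℝ (Set.finite_range v)
  have h2 := finrank_range_le_card (R := ℝ) v
  rw [Fintype.card_fin] at h2
  exact (Submodule.finrank_mono h1).trans h2

/-- If neither `a` nor `b` vanishes, the centralizer of `L(a) + R(b)` is spanned by `L(a)` and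
`R(b)`. -/
theorem finrank_skewCent_le_two {a b : ℍ[ℝ]} (ha : a.re = 0) (hb : b.re = 0) (ha0 : a ≠ 0)
    (hb0 : b ≠ 0) : Module.finrank ℝ (skewCent (emb (leftMul a + rightMul b))) ≤ 2 := by
  refine finrank_le_of_forall_exists ![emb (leftMul a), emb (rightMul b)] ?_
  rintro X ⟨⟨h1, h2⟩, h3⟩
  obtain ⟨x, y, hx, hy, rfl⟩ := exists_emb_of_skew h1 h2
  obtain ⟨h4, h5⟩ := commute_of_emb h3
  obtain ⟨s, rfl⟩ := exists_smul_of_commute ha hx ha0 h4.symm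
  obtain ⟨t, rfl⟩ := exists_smul_of_commute hb hy hb0 h5.symm
  refine ⟨![s, t], ?_⟩
  simp [Fin.sum_univ_two, emb_add, leftMul_smul, rightMul_smul, emb_smul]

theorem finrank_skewCent_leftMul_le {a : ℍ[ℝ]} (ha : a.re = 0) (ha0 : a ≠ 0) :
    Module.finrank ℝ (skewCent (emb (leftMul a + rightMul 0))) ≤ 4 := by
  refine finrank_le_of_forall_exists ![emb (leftMul a), emb (rightMul quatI),
    emb (rightMul quatJ), emb (rightMul quatK)] ?_
  rintro X ⟨⟨h1, h2⟩, h3⟩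
  obtain ⟨x, y, hx, hy, rfl⟩ := exists_emb_of_skew h1 h2
  obtain ⟨h4, -⟩ := commute_of_emb h3
  obtain ⟨s, rfl⟩ := exists_smul_of_commute ha hx ha0 h4.symm
  refine ⟨![s, y.imI, y.imJ, y.imK], ?_⟩
  conv_rhs => rw [eq_sum_quat hy]
  simp [Fin.sum_univ_four, emb_add, leftMul_smul, rightMul_smul, rightMul_add, emb_smul, add_assoc]

theorem finrank_skewCent_rightMul_le {b : ℍ[ℝ]} (hb : b.re = 0) (hb0 : b ≠ 0) :
    Module.finrank ℝ (skewCent (emb (leftMul 0 + rightMul b))) ≤ 4 := by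
  refine finrank_le_of_forall_exists ![emb (leftMul quatI),
    emb (leftMul quatJ), emb (leftMul quatK), emb (rightMul b)] ?_
  rintro X ⟨⟨h1, h2⟩, h3⟩
  obtain ⟨x, y, hx, hy, rfl⟩ := exists_emb_of_skew h1 h2
  obtain ⟨-, h4⟩ := commute_of_emb h3
  obtain ⟨s, rfl⟩ := exists_smul_of_commute hb hy hb0 h4.symm
  refine ⟨![x.imI, x.imJ, x.imK, s], ?_⟩
  conv_rhs => rw [eq_sum_quat hx]
  simp [Fin.sum_univ_four, emb_add, leftMul_smul, rightMul_smul, leftMul_add, emb_smul, add_assoc]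

end SkewMatrices

/-! ### Conjugation by rotations -/

section Rotations

theorem leftMul_zero : leftMul 0 = 0 := by
  rw [← zero_smul ℝ (0 : ℍ[ℝ]), leftMul_smul, zero_smul]

theorem rightMul_zero : rightMul 0 = 0 := by
  rw [← zero_smul ℝ (0 : ℍ[ℝ]), rightMul_smul, zero_smul]

/-- The complex structure on the positive definite part of `Q`, sending `f₁` to `e₂` and `e₃` to
`e₄`. -/
def stdComplexStr : Matrix Idx Idx ℝ := emb (leftMul quatI)

theorem exists_leftMul_mem_K {q : ℍ[ℝ]} (hq : q * star q = 1) :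
    ∃ k ∈ K, (k : Matrix Idx Idx ℝ) = emb (leftMul q) + negProj := by
  obtain ⟨t, b, hb, hb', rfl⟩ := exists_polar hq
  obtain ⟨k, hk⟩ := Matrix.isUnit_exp (t • emb (leftMul b))
  refine ⟨k, mem_K_of_exp ?_ ?_ hk, by rw [hk, emb_leftMul_add_negProj b hb']⟩
  · rw [Matrix.transpose_smul, leftMul_emb_skew hb, smul_neg]
  · rw [Matrix.smul_mul, Matrix.mul_smul, emb_comm_gram]

/-- Conjugation by left multiplications carries `L(a)` to a multiple of `L(i)`. -/
theorem exists_K_conj_leftMul {a : ℍ[ℝ]} (ha : a.re = 0) (ha0 : a ≠ 0) :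
    ∃ k ∈ K, ∃ c : ℝ, c ≠ 0 ∧
      (k : Matrix Idx Idx ℝ) * emb (leftMul a) = c • (stdComplexStr * k) := by
  obtain ⟨q, c, hq, hc, h⟩ := exists_unit_conj_quatI ha ha0
  obtain ⟨k, hk, hkq⟩ := exists_leftMul_mem_K hq
  refine ⟨k, hk, c, hc, ?_⟩
  rw [hkq, Matrix.add_mul, negProj_mul_emb, add_zero, emb_mul, ← leftMul_mul, h, stdComplexStr,
    Matrix.mul_add, emb_mul_negProj, add_zero, emb_mul, ← leftMul_mul, leftMul_smul, emb_smul]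

/-- The element of `K` exchanging left and right multiplications: quaternionic conjugation on the
positive definite part, and `-1` on the negative line. -/
theorem exists_swap_mem_K : ∃ r ∈ K, ∀ b : ℍ[ℝ],
    (r : Matrix Idx Idx ℝ) * emb (rightMul b) = emb (leftMul (star b)) * r := by
  let c : Matrix (Fin 4) (Fin 4) ℝ := Matrix.diagonal ![1, -1, -1, -1]
  let R : Matrix Idx Idx ℝ := emb c - negProj
  have hc : c * c = 1 := by
    ext i j
    fin_cases i <;> fin_cases j <;> simp [c]
  have hct : cᵀ = c := Matrix.diagonal_transpose _
  have hR : R * R = 1 := by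
    simp only [R, Matrix.sub_mul, Matrix.mul_sub, emb_mul, hc, emb_mul_negProj, negProj_mul_emb,
      negProj_mul_self, emb_one]
    abel
  have hRt : Rᵀ = R := by
    simp only [R, Matrix.transpose_sub, emb_transpose, hct, negProj_transpose]
  have hRe : R = Matrix.fromBlocks !![0, 1; 1, 0] 0 0 (-1) := by
    have := half_sqrt_two
    rw [← Matrix.ext_iff]
    simp only [forall_idx]
    simp [R, c, emb, posBasis, negProj, Matrix.mul_apply, Fin.sum_univ_four]
    grind
  have hdet : R.det = 1 := by
    rw [hRe, Matrix.det_fromBlocks_zero₂₁, Matrix.det_neg, Matrix.det_fin_two]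
    norm_num
  refine ⟨⟨R, R, hR, hR⟩, mem_K_iff.2 ⟨?_, ?_, hdet⟩, fun b => ?_⟩
  · simp only [R, Matrix.sub_mul, Matrix.mul_sub, gram_eq, Matrix.smul_mul, Matrix.mul_smul,
      Matrix.one_mul, Matrix.mul_one, emb_mul_negProj, negProj_mul_emb]
    module
  · change R * Rᵀ = 1
    rw [hRt, hR]
  · have h1 : c * rightMul b = leftMul (star b) * c := by
      ext i j
      fin_cases i <;> fin_cases j <;> simp [c, rightMul, leftMul]
    simp only [R, Matrix.sub_mul, Matrix.mul_sub, emb_mul, emb_mul_negProj, negProj_mul_emb, h1]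

/-- Right multiplications become left multiplications under an element of `K`, so `R(b)` too is
conjugate to a multiple of `L(i)`. -/
theorem exists_K_conj_rightMul {b : ℍ[ℝ]} (hb : b.re = 0) (hb0 : b ≠ 0) :
    ∃ k ∈ K, ∃ c : ℝ, c ≠ 0 ∧
      (k : Matrix Idx Idx ℝ) * emb (rightMul b) = c • (stdComplexStr * k) := by
  obtain ⟨r, hr, hrb⟩ := exists_swap_mem_K
  obtain ⟨k, hk, c, hc, h⟩ := exists_K_conj_leftMul (a := star b) (by simpa using hb)
    (star_ne_zero.2 hb0)
  refine ⟨k * r, mul_mem hk hr, c, hc, ?_⟩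
  rw [Units.val_mul, Matrix.mul_assoc, hrb, ← Matrix.mul_assoc, h, Matrix.smul_mul,
      Matrix.mul_assoc]

/-- If `k` carries `Z` to a multiple of `Z'`, then it carries the centralizer of `Z` to that of
`Z'`. -/
theorem conj_mem_skewCent {k : GL Idx ℝ} (hk : k ∈ K) {Z Z' X : Matrix Idx Idx ℝ} {c : ℝ}
    (hc : c ≠ 0) (h : (k : Matrix Idx Idx ℝ) * Z = c • (Z' * k)) (hX : X ∈ skewCent Z) :
    (k : Matrix Idx Idx ℝ) * X * (k : Matrix Idx Idx ℝ)ᵀ ∈ skewCent Z' := by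
  obtain ⟨hk1, hk2, -⟩ := mem_K_iff.1 hk
  have hk3 : (k : Matrix Idx Idx ℝ)ᵀ * (k : Matrix Idx Idx ℝ) = 1 := mul_eq_one_comm.1 hk2
  have hk4 : (k : Matrix Idx Idx ℝ)ᵀ * gram ℝ = gram ℝ * (k : Matrix Idx Idx ℝ)ᵀ := by
    have := congrArg Matrix.transpose hk1
    rw [Matrix.transpose_mul, Matrix.transpose_mul, gram_transpose] at this
    exact this.symm
  generalize (k : Matrix Idx Idx ℝ) = k at *
  obtain ⟨⟨h1, h2⟩, h3⟩ := hX
  refine ⟨⟨?_, ?_⟩, ?_⟩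
  · simp only [Matrix.transpose_mul, Matrix.transpose_transpose, h1, Matrix.mul_neg,
      Matrix.neg_mul, Matrix.mul_assoc]
  · rw [Matrix.mul_assoc, hk4, ← Matrix.mul_assoc, Matrix.mul_assoc k, h2, ← Matrix.mul_assoc, hk1,
      Matrix.mul_assoc, Matrix.mul_assoc, Matrix.mul_assoc]
  · have h5 : Z' * k = c⁻¹ • (k * Z) := by rw [h, smul_smul, inv_mul_cancel₀ hc, one_smul]
    have h6 : kᵀ * Z' = c⁻¹ • (Z * kᵀ) := by
      calc kᵀ * Z' = kᵀ * (Z' * k) * kᵀ := by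
            rw [Matrix.mul_assoc, Matrix.mul_assoc, hk2, Matrix.mul_one]
        _ = c⁻¹ • ((kᵀ * k) * Z * kᵀ) := by
            rw [h5, Matrix.mul_smul, Matrix.smul_mul, Matrix.mul_assoc kᵀ k Z]
        _ = _ := by rw [hk3, Matrix.one_mul]
    rw [Matrix.mul_assoc, h6, ← Matrix.mul_assoc, ← Matrix.mul_assoc, h5, Matrix.mul_smul,
      Matrix.smul_mul, Matrix.smul_mul, ← Matrix.mul_assoc, Matrix.mul_assoc k X Z, h3,
        Matrix.mul_assoc k Z X]

/-- A subspace of dimension at least four of the Lie algebra of `K`, with a nonzero central element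
`Z = L(a) + R(b)`, is the centralizer of `Z`, and `Z` is conjugate under `K` to a multiple of the
standard complex structure: by dimension one of `a` and `b` vanishes. -/
theorem eq_skewCent_of_central {L : Submodule ℝ (Matrix Idx Idx ℝ)}
    (hL : ∀ X ∈ L, Xᵀ = -X ∧ X * gram ℝ = gram ℝ * X) (h4 : 4 ≤ Module.finrank ℝ L)
    {Z : Matrix Idx Idx ℝ} (hZ : Z ∈ L) (hZ0 : Z ≠ 0) (hcomm : ∀ X ∈ L, X * Z = Z * X) :
    L = skewCent Z ∧ ∃ k ∈ K, ∃ c : ℝ, c ≠ 0 ∧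
      (k : Matrix Idx Idx ℝ) * Z = c • (stdComplexStr * k) := by
  have hle : L ≤ skewCent Z := fun X hX => ⟨hL X hX, hcomm X hX⟩
  have hfin := Submodule.finrank_mono hle
  obtain ⟨a, b, ha, hb, rfl⟩ := exists_emb_of_skew (hL Z hZ).1 (hL Z hZ).2
  by_cases ha0 : a = 0
  · subst ha0
    by_cases hb0 : b = 0
    · subst hb0
      refine (hZ0 ?_).elim
      rw [leftMul_zero, rightMul_zero, add_zero, ← zero_smul ℝ (0 : Matrix (Fin 4) (Fin 4) ℝ),
        emb_smul, zero_smul]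
    · refine ⟨Submodule.eq_of_le_of_finrank_le hle
        ((finrank_skewCent_rightMul_le hb hb0).trans h4), ?_⟩
      rw [leftMul_zero, zero_add]
      exact exists_K_conj_rightMul hb hb0
  · by_cases hb0 : b = 0
    · subst hb0
      refine ⟨Submodule.eq_of_le_of_finrank_le hle
        ((finrank_skewCent_leftMul_le ha ha0).trans h4), ?_⟩
      rw [rightMul_zero, add_zero]
      exact exists_K_conj_leftMul ha ha0
    · have := finrank_skewCent_le_two ha hb ha0 hb0
      omega

end Rotations

end SmallSubgroups
end

noncomputable section
set_option linter.unusedSectionVars false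
namespace SmallSubgroups

open scoped Quaternion

/-! ### The unitary group of the quaternions as a complex plane -/

section UnitaryGroup

theorem leftMul_quatI_sq : leftMul quatI * leftMul quatI = -1 := by
  have h : quatI * quatI = (-1 : ℝ) • (1 : ℍ[ℝ]) := by
    ext <;> simp [quatI_re, quatI_imI, quatI_imJ, quatI_imK]
  rw [← leftMul_mul, h, leftMul_smul, leftMul_one, neg_one_smul]

theorem rightMul_sub (p q : ℍ[ℝ]) : rightMul (p - q) = rightMul p - rightMul q := by
  rw [eq_sub_iff_add_eq, ← rightMul_add, sub_add_cancel]

/-- A real matrix commuting with the complex structure `i` of `ℍ` is a complex combination of right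
multiplications. -/
theorem exists_of_commute_quatI {N : Matrix (Fin 4) (Fin 4) ℝ}
    (h : N * leftMul quatI = leftMul quatI * N) :
    ∃ x y : ℍ[ℝ], N = rightMul x + leftMul quatI * rightMul y := by
  -- With `u = N 1` and `w = N j` one needs `u = x + i y` and `w = (x - i y) j`.
  obtain ⟨u, hu⟩ : ∃ u : ℍ[ℝ], u.re = N 0 0 ∧ u.imI = N 1 0 ∧ u.imJ = N 2 0 ∧ u.imK = N 3 0 :=
    ⟨⟨_, _, _, _⟩, rfl, rfl, rfl, rfl⟩
  obtain ⟨w, hw⟩ : ∃ w : ℍ[ℝ], w.re = N 0 2 ∧ w.imI = N 1 2 ∧ w.imJ = N 2 2 ∧ w.imK = N 3 2 :=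
    ⟨⟨_, _, _, _⟩, rfl, rfl, rfl, rfl⟩
  have hJ : quatJ.re = 0 ∧ quatJ.imI = 0 ∧ quatJ.imJ = 1 ∧ quatJ.imK = 0 := ⟨rfl, rfl, rfl, rfl⟩
  refine ⟨(1 / 2 : ℝ) • (u - quatJ * w), (1 / 2 : ℝ) • -(quatI * (u + quatJ * w)), ?_⟩
  have h' := fun i j => congrFun₂ h i j
  simp only [Fin.forall_fin_succ] at h'
  simp [leftMul, quatI_re, quatI_imI, quatI_imJ, quatI_imK, Matrix.mul_apply,
      Fin.sum_univ_four] at h'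
  ext i j
  fin_cases i <;> fin_cases j <;>
    simp [leftMul, rightMul, quatI_re, quatI_imI, quatI_imJ, quatI_imK, hJ, hu, hw] <;> linarith

theorem rightMul_add_eq_one {x y : ℍ[ℝ]}
    (h : rightMul x + leftMul quatI * rightMul y = 1) : x = 1 ∧ y = 0 := by
  have h' := fun i j => congrFun₂ h i j
  simp only [Fin.forall_fin_succ] at h'
  simp [leftMul, rightMul, quatI_re, quatI_imI, quatI_imJ, quatI_imK] at h'
  constructor <;> ext <;> simp <;> linarith

/-- The unitary group `U(2)` of `ℍ = ℂ²` is generated by the scalars of modulus one and the right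
multiplications by unit quaternions. For a unitary matrix `R(x) + i R(y)`, unitarity makes
`star x * y` real, so `x` and `y` are real multiples of one unit quaternion. -/
theorem exists_of_unitary {N : Matrix (Fin 4) (Fin 4) ℝ}
    (h : N * leftMul quatI = leftMul quatI * N) (hN : N * Nᵀ = 1) :
    ∃ (t : ℝ) (q : ℍ[ℝ]), q * star q = 1 ∧
      N = leftMul ((Real.cos t : ℍ[ℝ]) + Real.sin t • quatI) * rightMul q := by
  obtain ⟨x, y, rfl⟩ := exists_of_commute_quatI h
  have hI : (leftMul quatI)ᵀ = -leftMul quatI := by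
    rw [← leftMul_star, Quaternion.star_eq_neg.2 quatI_re, ← neg_one_smul ℝ, leftMul_smul,
      neg_one_smul]
  -- the real and imaginary parts of `N Nᴴ = 1`
  have h1 : rightMul (star x * x + star y * y) +
      leftMul quatI * rightMul (star x * y - star y * x) = 1 := by
    rw [← hN]
    simp only [rightMul_add, rightMul_sub, rightMul_mul, rightMul_star, Matrix.transpose_add,
      Matrix.transpose_mul, hI, Matrix.mul_add, Matrix.add_mul, Matrix.mul_neg, Matrix.mul_sub]
    have e1 : rightMul x * ((rightMul y)ᵀ * leftMul quatI) =
        leftMul quatI * (rightMul x * (rightMul y)ᵀ) := by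
      rw [← rightMul_star, ← Matrix.mul_assoc, ← rightMul_mul, leftMul_mul_rightMul]
    have e2 : leftMul quatI * rightMul y * ((rightMul y)ᵀ * leftMul quatI) =
        -(rightMul y * (rightMul y)ᵀ) := by
      rw [← rightMul_star, Matrix.mul_assoc, ← Matrix.mul_assoc (rightMul y), ← rightMul_mul,
        ← leftMul_mul_rightMul, ← Matrix.mul_assoc, leftMul_quatI_sq, Matrix.neg_mul,
          Matrix.one_mul]
    rw [e1, e2, Matrix.mul_assoc]
    abel
  obtain ⟨h2, h3⟩ := rightMul_add_eq_one h1
  have h4 : Quaternion.normSq x + Quaternion.normSq y = 1 := by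
    rw [Quaternion.star_mul_self, Quaternion.star_mul_self, ← Quaternion.coe_add] at h2
    exact Quaternion.coe_injective h2
  obtain ⟨q, α, β, hq, rfl, rfl⟩ : ∃ (q : ℍ[ℝ]) (α β : ℝ),
      Quaternion.normSq q = 1 ∧ x = α • q ∧ y = β • q := by
    by_cases hx : x = 0
    · subst hx
      exact ⟨y, 0, 1, by simpa using h4, by simp, by simp⟩
    · have hx0 : 0 < Quaternion.normSq x :=
        lt_of_le_of_ne Quaternion.normSq_nonneg (Quaternion.normSq_ne_zero.2 hx).symm
      obtain ⟨n, hn0, hn⟩ : ∃ n : ℝ, n ≠ 0 ∧ n ^ 2 = Quaternion.normSq x :=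
        ⟨_, (Real.sqrt_pos.2 hx0).ne', Real.sq_sqrt hx0.le⟩
      have h5 : star x * y = ((star x * y).re : ℍ[ℝ]) := by
        refine Quaternion.star_eq_self.1 ?_
        rw [star_mul, star_star]
        exact (sub_eq_zero.1 h3).symm
      have h6 : x * (star x * y) = Quaternion.normSq x • y := by
        rw [← mul_assoc, Quaternion.self_mul_star, Quaternion.coe_mul_eq_smul]
      refine ⟨n⁻¹ • x, n, n⁻¹ * (star x * y).re, ?_, ?_, ?_⟩
      · rw [Quaternion.normSq_smul, inv_pow, hn, inv_mul_cancel₀ hx0.ne']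
      · rw [smul_smul, mul_inv_cancel₀ hn0, one_smul]
      · rw [h5, Quaternion.mul_coe_eq_smul, ← hn] at h6
        rw [smul_comm, mul_smul, smul_smul, smul_smul, mul_smul, h6, smul_smul,
          show n⁻¹ * n⁻¹ * n ^ 2 = 1 by field_simp, one_smul]
  have h5 : α ^ 2 + β ^ 2 = 1 := by
    rw [Quaternion.normSq_smul, Quaternion.normSq_smul, hq] at h4
    linarith
  obtain ⟨t, rfl, rfl⟩ : ∃ t, α = Real.cos t ∧ β = Real.sin t := by
    have h6 : ‖(⟨α, β⟩ : ℂ)‖ = 1 := by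
      rw [Complex.norm_def, Complex.normSq_mk, ← sq, ← sq, h5, Real.sqrt_one]
    have h7 := Complex.norm_mul_cos_arg ⟨α, β⟩
    have h8 := Complex.norm_mul_sin_arg ⟨α, β⟩
    rw [h6, one_mul] at h7 h8
    exact ⟨_, h7.symm, h8.symm⟩
  refine ⟨t, q, by rw [Quaternion.self_mul_star, hq, Quaternion.coe_one], ?_⟩
  rw [leftMul_add, leftMul_smul, ← mul_one (Real.cos t : ℍ[ℝ]), Quaternion.coe_mul_eq_smul,
    leftMul_smul, leftMul_one, rightMul_smul, rightMul_smul, Matrix.add_mul, Matrix.smul_mul,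
    Matrix.smul_mul, Matrix.one_mul, Matrix.mul_smul]

end UnitaryGroup

/-! ### The centralizer of the standard complex structure -/

section Centralizer

theorem stdComplexStr_sq : stdComplexStr * stdComplexStr = negProj - 1 := by
  rw [stdComplexStr, emb_mul, leftMul_quatI_sq, ← neg_sub, ← emb_one, ← neg_one_smul ℝ, emb_smul,
    neg_one_smul]

theorem negProj_ne_zero : negProj ≠ 0 := fun h => by
  have := congrFun₂ h (Sum.inl 0) (Sum.inl 0)
  simp [negProj] at this

/-- An element of `SO(Q)(ℝ)` commuting with the standard complex structure is a unitary
transformation of the positive definite part, and `±1` on the negative line. -/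
theorem exists_of_mem_centPoints_stdComplexStr {g : GL Idx ℝ}
    (hg : g ∈ centPoints stdComplexStr) :
    ∃ (N : Matrix (Fin 4) (Fin 4) ℝ) (c : ℝ), (g : Matrix Idx Idx ℝ) = emb N + c • negProj ∧
      N * leftMul quatI = leftMul quatI * N ∧ N * Nᵀ = 1 ∧ c ^ 2 = 1 := by
  obtain ⟨⟨h1, -⟩, h2⟩ := hg
  generalize (g : Matrix Idx Idx ℝ) = g at *
  have h3 : g * negProj = negProj * g := by
    have : g * (stdComplexStr * stdComplexStr) = stdComplexStr * stdComplexStr * g := by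
      rw [← Matrix.mul_assoc, h2, Matrix.mul_assoc, h2, ← Matrix.mul_assoc]
    rw [stdComplexStr_sq, Matrix.mul_sub, Matrix.sub_mul, Matrix.mul_one, Matrix.one_mul] at this
    exact sub_left_injective this
  obtain ⟨N, c, rfl, -, -⟩ := exists_emb_of_commute h3
  have h4 : emb (N * Nᵀ) - c ^ 2 • negProj = emb 1 - negProj := by
    have e : gram ℝ = emb 1 - negProj := by rw [gram_eq, emb_one]; module
    rw [e] at h1
    rw [← h1]
    simp only [Matrix.transpose_add, Matrix.transpose_smul, emb_transpose, negProj_transpose,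
      Matrix.mul_add, Matrix.add_mul, Matrix.mul_sub, Matrix.sub_mul, Matrix.smul_mul,
      Matrix.mul_smul, emb_mul, emb_mul_negProj, negProj_mul_emb, negProj_mul_self, Matrix.mul_one,
      Matrix.zero_mul]
    module
  have h5 : c ^ 2 = 1 := by
    have := congrArg (· * negProj) h4
    simp only [Matrix.sub_mul, emb_mul_negProj, Matrix.smul_mul, negProj_mul_self, zero_sub,
      neg_inj] at this
    exact smul_left_injective ℝ negProj_ne_zero (this.trans (one_smul ℝ _).symm)
  refine ⟨N, c, rfl, ?_, ?_, h5⟩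
  · rw [stdComplexStr, Matrix.mul_add, Matrix.add_mul, Matrix.smul_mul, Matrix.mul_smul,
      emb_mul_negProj, negProj_mul_emb, smul_zero, add_zero, add_zero, emb_mul, emb_mul] at h2
    exact emb_injective h2
  · rw [h5, one_smul] at h4
    exact emb_injective (sub_left_injective h4)

theorem stdComplexStr_mem_skewCent : stdComplexStr ∈ skewCent stdComplexStr :=
  ⟨⟨leftMul_emb_skew quatI_re, emb_comm_gram _⟩, rfl⟩

theorem rightMul_mem_skewCent {b : ℍ[ℝ]} (hb : b.re = 0) :
    emb (rightMul b) ∈ skewCent stdComplexStr :=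
  ⟨⟨rightMul_emb_skew hb, emb_comm_gram _⟩, by
    rw [stdComplexStr, emb_mul, emb_mul, leftMul_mul_rightMul]⟩

/-- The centralizer of the standard complex structure in `SO(Q)(ℝ)` is generated by the exponentials
of its Lie algebra. -/
theorem closure_exp_skewCent :
    Subgroup.closure {g : GL Idx ℝ | ∃ X ∈ skewCent stdComplexStr,
      (g : Matrix Idx Idx ℝ) = NormedSpace.exp X} = centPoints stdComplexStr := by
  have hle : Subgroup.closure {g : GL Idx ℝ | ∃ X ∈ skewCent stdComplexStr,
      (g : Matrix Idx Idx ℝ) = NormedSpace.exp X} ≤ centPoints stdComplexStr := by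
    rw [Subgroup.closure_le]
    rintro g ⟨X, ⟨⟨h1, h2⟩, h3⟩, hg⟩
    exact ⟨(mem_K_of_exp h1 h2 hg).1, by rw [hg, exp_mul_comm h3]⟩
  refine le_antisymm hle fun g hg => ?_
  obtain ⟨N, c, hgN, hN1, hN2, hc⟩ := exists_of_mem_centPoints_stdComplexStr hg
  obtain ⟨t, q, hq, rfl⟩ := exists_of_unitary hN1 hN2
  obtain ⟨s, b, hb, hb', rfl⟩ := exists_polar hq
  have hI : quatI * quatI = -1 := by
    ext <;> simp [quatI_re, quatI_imI, quatI_imJ, quatI_imK]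
  obtain ⟨u, hu⟩ := Matrix.isUnit_exp (t • emb (leftMul quatI))
  obtain ⟨v, hv⟩ := Matrix.isUnit_exp (s • emb (rightMul b))
  have huv : u * v ∈ Subgroup.closure {g : GL Idx ℝ | ∃ X ∈ skewCent stdComplexStr,
      (g : Matrix Idx Idx ℝ) = NormedSpace.exp X} :=
    mul_mem (Subgroup.subset_closure ⟨_, Submodule.smul_mem _ _ stdComplexStr_mem_skewCent, hu⟩)
      (Subgroup.subset_closure ⟨_, Submodule.smul_mem _ _ (rightMul_mem_skewCent hb), hv⟩)
  rw [← emb_leftMul_add_negProj _ hI] at hu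
  rw [← emb_rightMul_add_negProj _ hb'] at hv
  generalize (Real.cos t : ℍ[ℝ]) + Real.sin t • quatI = p at *
  generalize (Real.cos s : ℍ[ℝ]) + Real.sin s • b = q at *
  have huv' : (u : Matrix Idx Idx ℝ) * v = emb (leftMul p * rightMul q) + negProj := by
    rw [hu, hv, Matrix.add_mul, Matrix.mul_add, Matrix.mul_add, emb_mul, emb_mul_negProj,
      negProj_mul_emb, negProj_mul_self, zero_add, add_zero]
  rcases mul_self_eq_one_iff.1 ((sq c).symm.trans hc) with rfl | rfl
  · rw [one_smul, ← huv', ← Units.val_mul] at hgN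
    rwa [Units.ext hgN]
  · -- Here `g = u v B`, which contradicts `det B = -1`.
    have h1 : (g : Matrix Idx Idx ℝ) = (u * v : GL Idx ℝ) * gram ℝ := by
      rw [hgN, Units.val_mul, huv', Matrix.add_mul, emb_mul_gram, gram_eq, Matrix.mul_sub,
        Matrix.mul_smul, negProj_mul_self, Matrix.mul_one]
      module
    have h2 := congrArg Matrix.det h1
    have h3 : (gram ℝ).det = -1 := by
      rw [gram, Matrix.det_fromBlocks_zero₂₁, Matrix.det_one, Matrix.det_fin_two]
      norm_num
    rw [Matrix.det_mul, hg.1.2, (hle huv).1.2, h3] at h2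
    norm_num at h2

end Centralizer

/-! ### From the standard to the rational complex structure -/

section Conjugation

theorem map_conj_centPoints {R : Type} [CommRing R] {g : GL Idx R} (hg : g ∈ soPoints R)
    {C C' : Matrix Idx Idx R} (h : (g : Matrix Idx Idx R) * C = C' * g) :
    (centPoints C).map (MulAut.conj g).toMonoidHom = centPoints C' := by
  have h' : ((g⁻¹ : GL Idx R) : Matrix Idx Idx R) * C' =
      C * ((g⁻¹ : GL Idx R) : Matrix Idx Idx R) := by
    calc _ = ((g⁻¹ : GL Idx R) : Matrix Idx Idx R) * (C' * g) *
      ((g⁻¹ : GL Idx R) : Matrix Idx Idx R) := by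
          simp [mul_assoc]
      _ = _ := by rw [← h]; simp
  ext x
  rw [Subgroup.mem_map]
  constructor
  · rintro ⟨y, ⟨hy1, hy2⟩, rfl⟩
    refine ⟨mul_mem (mul_mem hg hy1) (inv_mem hg), ?_⟩
    change ((g * y * g⁻¹ : GL Idx R) : Matrix Idx Idx R) * C' =
      C' * ((g * y * g⁻¹ : GL Idx R) : Matrix Idx Idx R)
    simp only [Units.val_mul]
    rw [mul_assoc, h', mul_assoc, ← mul_assoc _ C, hy2, mul_assoc, ← mul_assoc, h]
    simp only [mul_assoc]
  · rintro ⟨hx1, hx2⟩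
    refine ⟨g⁻¹ * x * g, ⟨mul_mem (mul_mem (inv_mem hg) hx1) hg, ?_⟩, by simp [mul_assoc]⟩
    simp only [Units.val_mul]
    rw [mul_assoc, h, mul_assoc, ← mul_assoc _ C', hx2, mul_assoc, ← mul_assoc, h']
    simp only [mul_assoc]

/-- The element `diag(√2, 1/√2, 1, 1, 1)` of `A` carries the standard complex structure to the
rational one. -/
theorem boost_mul_stdComplexStr :
    (boostGL √2 (by positivity) : Matrix Idx Idx ℝ) * stdComplexStr =
      complexStr ℝ * (boostGL √2 (by positivity) : Matrix Idx Idx ℝ) := by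
  have h1 := half_sqrt_two
  have h2 : √2 * √2 = 2 := by linarith
  have h3 : (√2)⁻¹ = √2 / 2 := inv_eq_of_mul_eq_one_right (by linarith)
  change Matrix.fromBlocks (Matrix.diagonal ![√2, (√2)⁻¹]) 0 0 1 * _ =
    _ * Matrix.fromBlocks (Matrix.diagonal ![√2, (√2)⁻¹]) 0 0 1
  rw [← Matrix.ext_iff, h3]
  simp only [forall_idx]
  simp [stdComplexStr, complexStr, emb, leftMul, posBasis, quatI_re, quatI_imI, quatI_imJ,
      quatI_imK,
    Matrix.mul_apply, Fin.sum_univ_four, Fin.sum_univ_three, Matrix.diagonal_apply]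
  grind

end Conjugation

end SmallSubgroups
end

noncomputable section
set_option linter.unusedSectionVars false
namespace SmallSubgroups

/-! ### Connected subgroups isogenous to `SO(3) × SO(2)` -/

section LieSubgroups

attribute [local instance] LieRing.ofAssociativeRing

/-- The generator of `𝔰𝔬(2)`. -/
def so2Gen : LieAlgebra.Orthogonal.so (Fin 2) ℝ :=
  ⟨!![0, -1; 1, 0], by
    rw [LieAlgebra.Orthogonal.mem_so]
    ext i j
    fin_cases i <;> fin_cases j <;> simp⟩

theorem lie_so2 (X Y : LieAlgebra.Orthogonal.so (Fin 2) ℝ) : ⁅X, Y⁆ = 0 := by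
  have h : ∀ X : LieAlgebra.Orthogonal.so (Fin 2) ℝ, ∃ c : ℝ, (X : Matrix (Fin 2) (Fin 2) ℝ) =
      !![0, -c; c, 0] := fun X => by
    have hX := (LieAlgebra.Orthogonal.mem_so (n := Fin 2) (R := ℝ) X.1).1 X.2
    refine ⟨X.1 1 0, ?_⟩
    have h' := fun i j => congrFun₂ hX i j
    simp only [Fin.forall_fin_succ] at h'
    simp at h'
    ext i j
    fin_cases i <;> fin_cases j <;> simp <;> linarith
  obtain ⟨c, hc⟩ := h X
  obtain ⟨d, hd⟩ := h Y
  apply Subtype.ext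
  change (X : Matrix (Fin 2) (Fin 2) ℝ) * Y - Y * X = 0
  rw [hc, hd]
  ext i j
  fin_cases i <;> fin_cases j <;> simp <;> ring

/-- An identification of `ℝ³` with the skew-symmetric matrices of size three. -/
def crossMatrix : (Fin 3 → ℝ) →ₗ[ℝ] Matrix (Fin 3) (Fin 3) ℝ where
  toFun v := !![0, -v 0, -v 1; v 0, 0, -v 2; v 1, v 2, 0]
  map_add' v w := by
    ext i j
    fin_cases i <;> fin_cases j <;> simp <;> ring
  map_smul' c v := by
    ext i j
    fin_cases i <;> fin_cases j <;> simp

theorem crossMatrix_injective : Function.Injective crossMatrix := by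
  intro v w h
  have e0 := congrFun₂ h 1 0
  have e1 := congrFun₂ h 2 0
  have e2 := congrFun₂ h 2 1
  simp [crossMatrix] at e0 e1 e2
  ext i
  fin_cases i <;> simp [e0, e1, e2]

theorem crossMatrix_mem (v : Fin 3 → ℝ) :
    crossMatrix v ∈ (LieAlgebra.Orthogonal.so (Fin 3) ℝ).toSubmodule := by
  refine (LieAlgebra.Orthogonal.mem_so (n := Fin 3) (R := ℝ) _).2 ?_
  ext i j
  fin_cases i <;> fin_cases j <;> simp [crossMatrix]

theorem so2Gen_ne_zero : so2Gen ≠ 0 := fun h => by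
  have h3 := congrArg (fun p : LieAlgebra.Orthogonal.so (Fin 2) ℝ =>
    (p : Matrix (Fin 2) (Fin 2) ℝ) 1 0) h
  simp [so2Gen] at h3

theorem four_le_finrank_so3_prod_so2 :
    4 ≤ Module.finrank ℝ
      (LieAlgebra.Orthogonal.so (Fin 3) ℝ × LieAlgebra.Orthogonal.so (Fin 2) ℝ) := by
  have h3 : 3 ≤ Module.finrank ℝ (LieAlgebra.Orthogonal.so (Fin 3) ℝ).toSubmodule := by
    have := LinearMap.finrank_le_finrank_of_injective
      (f := crossMatrix.codRestrict _ crossMatrix_mem)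
      (fun v w h => crossMatrix_injective (congrArg Subtype.val h))
    simpa using this
  have h2 : 0 < Module.finrank ℝ (LieAlgebra.Orthogonal.so (Fin 2) ℝ) :=
    Module.finrank_pos_iff_exists_ne_zero.2 ⟨so2Gen, so2Gen_ne_zero⟩
  rw [Module.finrank_prod]
  exact Nat.add_le_add h3 h2

/-- Every connected subgroup of `K` isogenous to `SO(3) × SO(2)` is conjugate under `K` to the
centralizer of the standard complex structure: its Lie algebra has dimension at least four, and a
generator `Z` of the factor `𝔰𝔬(2)` is central in it. -/
theorem exists_conj_eq_centPoints {K₁ : Subgroup (GL Idx ℝ)} (hK : K₁ ≤ K)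
    (h : IsConnectedIsogenousSO3SO2 K₁) :
    ∃ k ∈ K, K₁.map (MulAut.conj k).toMonoidHom = centPoints stdComplexStr := by
  obtain ⟨L, rfl, ⟨e⟩⟩ := h
  have hL : ∀ X ∈ L.toSubmodule, Xᵀ = -X ∧ X * gram ℝ = gram ℝ * X := fun X hX =>
    skew_of_forall_exp_mem_K fun t g hg =>
      hK (Subgroup.subset_closure ⟨t • X, L.toSubmodule.smul_mem t hX, hg⟩)
  have h4 : 4 ≤ Module.finrank ℝ L.toSubmodule :=
    four_le_finrank_so3_prod_so2.trans_eq e.toLinearEquiv.finrank_eq.symm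
  let Z : L := e.symm (0, so2Gen)
  have hZ0 : (Z : Matrix Idx Idx ℝ) ≠ 0 := fun h0 => by
    have h1 : Z = 0 := Subtype.ext h0
    have h2 := congrArg e h1
    rw [LieEquiv.apply_symm_apply, map_zero] at h2
    exact so2Gen_ne_zero (congrArg Prod.snd h2)
  have hcomm : ∀ X ∈ L.toSubmodule, X * (Z : Matrix Idx Idx ℝ) = Z * X := fun X hX => by
    have h1 : ⁅(⟨X, hX⟩ : L), Z⁆ = 0 := by
      have h2 : e ⁅(⟨X, hX⟩ : L), Z⁆ = e 0 := by
        rw [LieEquiv.map_lie, LieEquiv.apply_symm_apply, map_zero]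
        exact Prod.ext (lie_zero _) (lie_so2 _ _)
      exact e.injective h2
    have h2 := congrArg Subtype.val h1
    exact sub_eq_zero.1 h2
  obtain ⟨hLZ, k, hk, c, hc, hkZ⟩ := eq_skewCent_of_central hL h4 Z.2 hZ0 hcomm
  refine ⟨k, hk, ?_⟩
  have hLZ' : ∀ X, X ∈ L ↔ X ∈ skewCent Z := fun X => by rw [← hLZ]; rfl
  have hkT : (k : Matrix Idx Idx ℝ)ᵀ = ((k⁻¹ : GL Idx ℝ) : Matrix Idx Idx ℝ) := by
    rw [Matrix.coe_units_inv, Matrix.inv_eq_right_inv (mem_K_iff.1 hk).2.1]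
  have hexp : ∀ (u : GL Idx ℝ) (X : Matrix Idx Idx ℝ),
      NormedSpace.exp ((u : Matrix Idx Idx ℝ) * X * ((u⁻¹ : GL Idx ℝ) : Matrix Idx Idx ℝ)) =
        u * NormedSpace.exp X * ((u⁻¹ : GL Idx ℝ) : Matrix Idx Idx ℝ) := fun u X => by
    rw [Matrix.coe_units_inv, Matrix.exp_conj _ _ u.isUnit]
  have hkZ' : ((k⁻¹ : GL Idx ℝ) : Matrix Idx Idx ℝ) * stdComplexStr =
      c⁻¹ • ((Z : Matrix Idx Idx ℝ) * ((k⁻¹ : GL Idx ℝ) : Matrix Idx Idx ℝ)) := by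
    have h1 : ((k⁻¹ : GL Idx ℝ) : Matrix Idx Idx ℝ) * ((k : Matrix Idx Idx ℝ) * Z) *
        ((k⁻¹ : GL Idx ℝ) : Matrix Idx Idx ℝ) =
        (Z : Matrix Idx Idx ℝ) * ((k⁻¹ : GL Idx ℝ) : Matrix Idx Idx ℝ) := by
      simp
    rw [← h1, hkZ, Matrix.mul_smul, Matrix.smul_mul, smul_smul, inv_mul_cancel₀ hc, one_smul]
    simp [Matrix.mul_assoc]
  rw [connectedLieSubgroup, MonoidHom.map_closure, ← closure_exp_skewCent]
  congr 1
  ext g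
  constructor
  · rintro ⟨x, ⟨X, hX, hx⟩, rfl⟩
    refine ⟨_, conj_mem_skewCent hk hc hkZ ((hLZ' X).1 hX), ?_⟩
    rw [hkT, hexp, ← hx]
    rfl
  · rintro ⟨X, hX, hg⟩
    have h1 := conj_mem_skewCent (inv_mem hk) (inv_ne_zero hc) hkZ' hX
    refine ⟨k⁻¹ * g * k, ⟨_, (hLZ' _).2 h1, ?_⟩, ?_⟩
    · have hkT' : ((k⁻¹ : GL Idx ℝ) : Matrix Idx Idx ℝ)ᵀ =
      ((k⁻¹⁻¹ : GL Idx ℝ) : Matrix Idx Idx ℝ) := by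
        rw [← hkT, Matrix.transpose_transpose, inv_inv]
      rw [hkT', hexp, ← hg, inv_inv]
      rfl
    · simp [mul_assoc]

end LieSubgroups

section Assembly

theorem isSmallOver_complexStr {F : Type} [Field F] [CharZero F] :
    IsSmallOver (soGroup F) (centGroup (complexStr F)) := by
  simpa using isSmallOver_conj_complexStr (one_mem (soPoints F))

/-- Every connected subgroup of `K` isogenous to `SO(3) × SO(2)` is conjugate in `G` to the
centralizer of the rational matrix `J`. -/
theorem exists_conj_eq_centPoints_complexStr {K₁ : Subgroup (GL Idx ℝ)} (hK : K₁ ≤ K)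
    (h : IsConnectedIsogenousSO3SO2 K₁) :
    ∃ g ∈ G, K₁.map (MulAut.conj g).toMonoidHom = centPoints (complexStr ℝ) := by
  obtain ⟨k, hk, hkK⟩ := exists_conj_eq_centPoints hK h
  refine ⟨boostGL √2 (by positivity) * k, mul_mem (boostGL_mem_G _ _) hk.1, ?_⟩
  rw [← map_conj_centPoints (boostGL_mem_G _ _) boost_mul_stdComplexStr, ← hkK, Subgroup.map_map,
    map_mul]
  rfl

end Assembly

end SmallSubgroups
end

open SmallSubgroups in
theorem lemma5p2 :
    (∃ H : AlgGroup Idx ℚ, H.points ℝ = AM ∧ IsSmallOver (soGroup ℚ) H) ∧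
    (∀ K₁ : Subgroup (GL Idx ℝ), K₁ ≤ SmallSubgroups.K → IsConnectedIsogenousSO3SO2 K₁ →
      (∃ H : AlgGroup Idx ℝ, H.points ℝ = K₁ ∧ IsSmallOver (soGroup ℝ) H) ∧
      (∃ g ∈ SmallSubgroups.G, ∃ H : AlgGroup Idx ℚ,
        H.points ℝ = K₁.map (MulAut.conj g).toMonoidHom ∧ IsSmallOver (soGroup ℚ) H)) := by
  refine ⟨⟨centGroup (boost ℚ), ?_, isSmallOver_boost⟩, fun K₁ hK h => ?_⟩
  · change centPoints ((boost ℚ).map (algebraMap ℚ ℝ)) = AM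
    rw [map_boost, centPoints_boost]
  · obtain ⟨g, hg, hgK⟩ := exists_conj_eq_centPoints_complexStr hK h
    refine ⟨⟨centGroup (((g⁻¹ : GL Idx ℝ) : Matrix Idx Idx ℝ) * complexStr ℝ * (g : Matrix Idx Idx ℝ)),
      ?_, isSmallOver_conj_complexStr hg⟩, g, hg, centGroup (complexStr ℚ), ?_,
      isSmallOver_complexStr⟩
    · apply Subgroup.map_injective (f := (MulAut.conj g).toMonoidHom) (MulAut.conj g).injective
      change (centPoints (Matrix.map _ id)).map (MulAut.conj g).toMonoidHom =
        K₁.map (MulAut.conj g).toMonoidHom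
      rw [hgK, Matrix.map_id]
      refine map_conj_centPoints hg ?_
      rw [← mul_assoc, ← mul_assoc, ← Units.val_mul, mul_inv_cancel, Units.val_one, one_mul]
    · change centPoints ((complexStr ℚ).map (algebraMap ℚ ℝ)) = _
      rw [map_complexStr, hgK]
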